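/- Let $F$ be an algebraically closed field of characteristic $0$. For a representation $\rho$ of a Lie superalgebra $\mathfrak g=\mathfrak g_{\bar 0}\oplus\mathfrak g_{\bar 1}$ in a finite-dimensional superspace $V$, let $\exp(\mathfrak g_{\bar 0})\subset GL(V)$ be the subgroup generated by all $\exp \rho(a)$ with $a\in\mathfrak g_{\bar 0}$ and $\rho(a)$ nilpotent, and all $t^{\rho(a)}$ with $t\in F^\times$, $a\in\mathfrak g_{\bar 0}$ and $\rho(a)$ diagonalizable with integer eigenvalues. Consider the subgroups $G\subset GL(V)$ that contain $\exp(\mathfrak g_{\bar 0})$, preserve parity (each element of $G$ maps $V_{\bar 0}$ to $V_{\bar 0}$ and $V_{\bar 1}$ to $V_{\bar 1}$), and are such that for every $h\in G$ there is an (even) automorphism $\sigma$ of $\mathfrak g$ with $h\rho(x)h^{-1}=\rho(\sigma(x))$ for all $x\in\mathfrak g$. Write $G=G_1\cdot G_2$ if $G_1,G_2$ are normal subgroups of $G$ which together generate $G$ and $G_1\cap G_2$ is a finite central subgroup of $G$. Below, $F^\times$ acts on $V$ by scalar multiplication, and every other factor is identified with its image under the indicated faithful action on $V$. In each of the following cases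 there is a largest such group $G$, and it is as stated. (a) $\mathfrak g=\mathfrak{sl}_n$ ($n\ge1$) and $V=F^n\oplus F^n$, two copies of the standard module with the same parity: $G=GL_2\cdot SL_n$, where $GL_2$ mixes the two copies and $SL_n$ acts diagonally, i.e. $V=F^2\otimes F^n$. In particular, for $n=2$, $G=F^\times\cdot SO_4$, where $SO_4$ is the special orthogonal group of a non-degenerate symmetric bilinear form on $V$; and for $n=3$, $G=F^\times\cdot(SL_2\times SL_3)$. (b) $\mathfrak g=\mathfrak{sl}_2\oplus\mathfrak{sl}_3$ and $V=F^3\boxtimes F^2$ (of either parity): $G=F^\times\cdot(SL_2\times SL_3)$. (c) $\mathfrak g=\mathfrak{sl}_5$ and $V=\Lambda^2F^5$ (of either parity): $G$ is the image of $GL_5$ in $GL(\Lambda^2F^5)$ under its natural action; equivalently $G=F^\times\cdot SL_5$. (d) $\mathfrak g=\mathfrak{sl}(m,n)$ ($m,n\ge 0$) and $V=F^{m|n}$ is the standard module: $G=GL_m\times GL_n$, acting block-diagonally. (e) $\mathfrak g=\mathfrak{spo}(2k,n)$ ($k,n\ge0$, $2k+n\geq1$) and $V=F^{2k|n}$ is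 the standard module: $G=F^\times\cdot(Sp_{2k}\times O_n)$. (f) $\mathfrak g=P_n$ ($n\ge1$), the Lie superalgebra of all block matrices $\begin{pmatrix}a&b\\c&-a^T\end{pmatrix}$ with $\operatorname{tr}a=0$, $b^T=b$, $c^T=-c$, acting on its standard module $V=F^n\oplus F^{n*}$, where $F^n$ and $F^{n*}$ have different parities: $G=F^\times\cdot GL_n$, where $A\in GL_n$ acts by $\operatorname{diag}(A,(A^{-1})^T)$. (g) $\mathfrak g=\hat P_4=P_4+Fz$, the non-trivial central extension of $P_4$, in its standard module $V=F^4\oplus F^{4*}$ (of different parities), on which $\begin{pmatrix}a&b\\c&-a^T\end{pmatrix}+\zeta z$ acts by $\begin{pmatrix}a&b-c^*\\c&-a^T\end{pmatrix}+\zeta\cdot 1$; here $c^*_{ij}=c_{kl}$ for every even permutation $(i,j,k,l)$ of the four indices. Then $G=F^\times\cdot SL_4$, where $S\in SL_4$ acts by $\operatorname{diag}(S,(S^{-1})^T)$; equivalently, $G=\{\operatorname{diag}(A,\lambda (A^{-1})^T): A\in GL_4,\ \lambda\in F^\times,\ \lambda^2=\det A\}$, which restricts to $GL_4$ on $F^4$,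 two-to-one. -/

import Mathlib

noncomputable section

open scoped TensorProduct

attribute [local instance] LieRing.ofAssociativeRing

/-! ### Superspaces, Lie superalgebras and their representations -/

/-- A superspace: a vector space with a decomposition into an even and an odd part. -/
structure Superspace (F V : Type*) [Field F] [AddCommGroup V] [Module F V] where
  part : ZMod 2 → Submodule F V
  isCompl : IsCompl (part 0) (part 1)

/-- The superspace structure on `V` for which all of `V` has parity `p`. -/
def Superspace.pure (F V : Type*) [Field F] [AddCommGroup V] [Module F V] (p : ZMod 2) :
    Superspace F V where
  part i := if i = p then ⊤ else ⊥
  isCompl := by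
    have h : p = 0 ∨ p = 1 := by revert p; decide
    rcases h with rfl | rfl
    · simpa using isCompl_top_bot
    · simpa using isCompl_bot_top

/-- The sign `(-1)^{ij}` attached to two parities. -/
def superSign (F : Type*) [Field F] (i j : ZMod 2) : F := (-1) ^ (i.val * j.val)

/-- A Lie superalgebra structure over a field of characteristic zero on the vector space `L`. -/
structure LieSuperalgebra (F L : Type*) [Field F] [AddCommGroup L] [Module F L]
    extends Superspace F L where
  bracket : L →ₗ[F] L →ₗ[F] L
  bracket_mem : ∀ {i j : ZMod 2} {x y : L}, x ∈ part i → y ∈ part j → bracket x y ∈ part (i + j)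
  skew : ∀ {i j : ZMod 2} {x y : L}, x ∈ part i → y ∈ part j →
    bracket x y = -(superSign F i j • bracket y x)
  jacobi : ∀ {i j : ZMod 2} {x y : L} (z : L), x ∈ part i → y ∈ part j →
    bracket x (bracket y z) = bracket (bracket x y) z + superSign F i j • bracket y (bracket x z)

/-- An (even) automorphism of a Lie superalgebra. -/
def LieSuperalgebra.IsAutomorphism {F L : Type*} [Field F] [AddCommGroup L] [Module F L]
    (𝔤 : LieSuperalgebra F L) (σ : L ≃ₗ[F] L) : Prop :=
  (∀ i, ∀ x ∈ 𝔤.part i, σ x ∈ 𝔤.part i) ∧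
    ∀ x y, σ (𝔤.bracket x y) = 𝔤.bracket (σ x) (σ y)

/-- A representation of a Lie superalgebra in a superspace. -/
structure LieSuperalgebra.Rep {F L V : Type*} [Field F] [AddCommGroup L] [Module F L]
    [AddCommGroup V] [Module F V] (𝔤 : LieSuperalgebra F L) (𝒱 : Superspace F V) where
  ρ : L →ₗ[F] Module.End F V
  map_part : ∀ {i j : ZMod 2} {x : L} {v : V}, x ∈ 𝔤.part i → v ∈ 𝒱.part j → ρ x v ∈ 𝒱.part (i + j)
  map_bracket : ∀ {i j : ZMod 2} {x y : L}, x ∈ 𝔤.part i → y ∈ 𝔤.part j →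
    ρ (𝔤.bracket x y) = ρ x * ρ y - superSign F i j • (ρ y * ρ x)

/-! ### The group generated by exponentials, and the groups `G` under consideration -/

section Groups

variable {F L V : Type*} [Field F] [AddCommGroup L] [Module F L] [AddCommGroup V] [Module F V]

/-- The exponential series of a nilpotent endomorphism (a finite sum). -/
def nilExp (a : Module.End F V) : Module.End F V :=
  ∑ i ∈ Finset.range (nilpotencyClass a), ((i.factorial : F)⁻¹) • a ^ i

/-- `a` is diagonalizable with integer eigenvalues and `u = t ^ a`. -/
def IsTorusPower (u a : Module.End F V) (t : Fˣ) : Prop :=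
  (⨆ k : ℤ, a.eigenspace (k : F)) = ⊤ ∧
    ∀ k : ℤ, ∀ v ∈ a.eigenspace (k : F), u v = ((t ^ k : Fˣ) : F) • v

variable {𝔤 : LieSuperalgebra F L} {𝒱 : Superspace F V}

/-- The subgroup `exp(𝔤₀)` of `GL(V)`, for the even part `𝔤₀` of `𝔤`. -/
def LieSuperalgebra.Rep.expEven (R : 𝔤.Rep 𝒱) : Subgroup (LinearMap.GeneralLinearGroup F V) :=
  Subgroup.closure
    ({u | ∃ x ∈ 𝔤.part 0, IsNilpotent (R.ρ x) ∧ (u : Module.End F V) = nilExp (R.ρ x)} ∪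
     {u | ∃ x ∈ 𝔤.part 0, ∃ t : Fˣ, IsTorusPower (u : Module.End F V) (R.ρ x) t})

/-- `G ⊆ GL(V)` contains `exp(𝔤₀)`, preserves parity, and conjugation by each of its elements
induces an automorphism of `𝔤`. -/
structure LieSuperalgebra.Rep.IsAdmissible (R : 𝔤.Rep 𝒱)
    (G : Subgroup (LinearMap.GeneralLinearGroup F V)) : Prop where
  expEven_le : R.expEven ≤ G
  parity : ∀ h ∈ G, ∀ i, ∀ v ∈ 𝒱.part i, (h : Module.End F V) v ∈ 𝒱.part i
  conj : ∀ h ∈ G, ∃ σ : L ≃ₗ[F] L, 𝔤.IsAutomorphism σ ∧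
    ∀ x, (h : Module.End F V) * R.ρ x * ((h⁻¹ : LinearMap.GeneralLinearGroup F V) : Module.End F V)
      = R.ρ (σ x)

/-- `G` is the maximal admissible group. -/
def LieSuperalgebra.Rep.IsMaximalGroup (R : 𝔤.Rep 𝒱)
    (G : Subgroup (LinearMap.GeneralLinearGroup F V)) : Prop :=
  IsGreatest {H | R.IsAdmissible H} G

/-- `G = H₁ · H₂`: the groups `H₁` and `H₂`, embedded in `Γ` by `f₁` and `f₂`, are normal subgroups
of `G` which together generate `G`, and their intersection is a finite central subgroup of `G`. -/
structure IsAlmostDirectProduct {Γ H₁ H₂ : Type*} [Group Γ] [Group H₁] [Group H₂]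
    (G : Subgroup Γ) (f₁ : H₁ →* Γ) (f₂ : H₂ →* Γ) : Prop where
  injective_left : Function.Injective f₁
  injective_right : Function.Injective f₂
  sup_eq : f₁.range ⊔ f₂.range = G
  normal_left : ∀ g ∈ G, ∀ x ∈ f₁.range, g * x * g⁻¹ ∈ f₁.range
  normal_right : ∀ g ∈ G, ∀ x ∈ f₂.range, g * x * g⁻¹ ∈ f₂.range
  finite : Set.Finite ((f₁.range ⊓ f₂.range : Subgroup Γ) : Set Γ)
  central : ∀ x ∈ f₁.range ⊓ f₂.range, ∀ g ∈ G, x * g = g * x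

/-- `Fˣ` acting on `V` by scalar multiplication. -/
def scalarHom (F V : Type*) [Field F] [AddCommGroup V] [Module F V] :
    Fˣ →* LinearMap.GeneralLinearGroup F V :=
  Units.map (algebraMap F (Module.End F V) : F →* Module.End F V)

/-- The special orthogonal group of a bilinear form. -/
def specialOrthogonal (B : LinearMap.BilinForm F V) :
    Subgroup (LinearMap.GeneralLinearGroup F V) where
  carrier := {h | LinearMap.det (h : Module.End F V) = 1 ∧
    ∀ v w, B ((h : Module.End F V) v) ((h : Module.End F V) w) = B v w}
  one_mem' := by simp
  mul_mem' := by
    rintro a b ⟨ha, ha'⟩ ⟨hb, hb'⟩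
    refine ⟨by simp [ha, hb], fun v w => ?_⟩
    simp [ha', hb']
  inv_mem' := by
    rintro a ⟨ha, ha'⟩
    have h1 : (a : Module.End F V) * ((a⁻¹ : LinearMap.GeneralLinearGroup F V) : Module.End F V)
        = 1 := by simp
    refine ⟨?_, fun v w => ?_⟩
    · have h3 := congrArg LinearMap.det h1
      rwa [map_mul, ha, one_mul, map_one] at h3
    · have h2 : ∀ v, (a : Module.End F V)
          (((a⁻¹ : LinearMap.GeneralLinearGroup F V) : Module.End F V) v) = v :=
        fun v => LinearMap.congr_fun h1 v
      rw [← ha', h2, h2]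

end Groups

/-! ### Ordinary Lie algebras as purely even Lie superalgebras -/

section Even

variable (F L : Type*) [Field F] [LieRing L] [LieAlgebra F L]

/-- A Lie algebra, seen as a purely even Lie superalgebra. -/
def LieSuperalgebra.ofLie : LieSuperalgebra F L where
  toSuperspace := Superspace.pure F L 0
  bracket := LinearMap.mk₂ F (fun x y => ⁅x, y⁆) (fun x y z => add_lie x y z)
    (fun c x y => smul_lie c x y) (fun x y z => lie_add x y z) (fun c x y => lie_smul c x y)
  bracket_mem := by
    intro i j x y hx hy
    have key : ∀ k : ZMod 2, k = 0 ∨ k = 1 := by decide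
    rcases key i with rfl | rfl <;> rcases key j with rfl | rfl <;>
      simp_all [Superspace.pure]
  skew := by
    intro i j x y hx hy
    have key : ∀ k : ZMod 2, k = 0 ∨ k = 1 := by decide
    rcases key i with rfl | rfl <;> rcases key j with rfl | rfl <;>
      simp_all [Superspace.pure, superSign]
  jacobi := by
    intro i j x y z hx hy
    have key : ∀ k : ZMod 2, k = 0 ∨ k = 1 := by decide
    rcases key i with rfl | rfl <;> rcases key j with rfl | rfl <;>
      simp_all [Superspace.pure, superSign]

variable {F L} {V : Type*} [AddCommGroup V] [Module F V]

/-- A representation of a Lie algebra, as a representation of the purely even Lie superalgebra in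
the superspace `V` all of whose elements have parity `p`. -/
def LieSuperalgebra.Rep.ofLie (p : ZMod 2) (φ : L →ₗ[F] Module.End F V)
    (hφ : ∀ x y, φ ⁅x, y⁆ = φ x * φ y - φ y * φ x) :
    (LieSuperalgebra.ofLie F L).Rep (Superspace.pure F V p) where
  ρ := φ
  map_part := by
    intro i j x v hx hv
    have key : ∀ k : ZMod 2, k = 0 ∨ k = 1 := by decide
    rcases key i with rfl | rfl
    · by_cases h : j = p <;> simp_all [Superspace.pure]
    · simp_all [Superspace.pure, LieSuperalgebra.ofLie]
  map_bracket := by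
    intro i j x y hx hy
    have key : ∀ k : ZMod 2, k = 0 ∨ k = 1 := by decide
    rcases key i with rfl | rfl <;> rcases key j with rfl | rfl <;>
      simp_all [Superspace.pure, LieSuperalgebra.ofLie, superSign]

end Even

/-- The inclusion of `sl_n` in the space of `n × n` matrices. -/
def slVal (F : Type*) [Field F] (n : ℕ) :
    LieAlgebra.SpecialLinear.sl (Fin n) F →ₗ[F] Matrix (Fin n) (Fin n) F where
  toFun x := x.val
  map_add' _ _ := rfl
  map_smul' _ _ := rfl

theorem slVal_lie (F : Type*) [Field F] (n : ℕ) (x y : LieAlgebra.SpecialLinear.sl (Fin n) F) :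
    slVal F n ⁅x, y⁆ = slVal F n x * slVal F n y - slVal F n y * slVal F n x := rfl

/-! ### `sl_n` on `Fⁿ ⊕ Fⁿ` -/

section TwoCopies

variable (F : Type*) [Field F] (n : ℕ)

/-- The diagonal action of an `n × n` matrix on `Fⁿ ⊕ Fⁿ`. -/
def diagAction : Matrix (Fin n) (Fin n) F →ₗ[F] Module.End F (Fin 2 → Fin n → F) where
  toFun x := LinearMap.pi fun i => Matrix.toLin' x ∘ₗ LinearMap.proj i
  map_add' x y := by ext; simp
  map_smul' c x := by ext; simp

/-- The representation of `sl_n` in `Fⁿ ⊕ Fⁿ`, where both summands have parity `p`. -/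
def slTwoCopies (p : ZMod 2) :
    (LieSuperalgebra.ofLie F (LieAlgebra.SpecialLinear.sl (Fin n) F)).Rep
      (Superspace.pure F (Fin 2 → Fin n → F) p) :=
  LieSuperalgebra.Rep.ofLie p
    (diagAction F n ∘ₗ slVal F n) (by
      intro x y
      ext
      simp [diagAction, slVal_lie])

/-- `GL_2` acting on `Fⁿ ⊕ Fⁿ = F² ⊗ Fⁿ` by mixing the two copies of `Fⁿ`. -/
def gl2Mixing : GL (Fin 2) F →* LinearMap.GeneralLinearGroup F (Fin 2 → Fin n → F) :=
  MonoidHom.toHomUnits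
    { toFun := fun A => LinearMap.pi fun i => ∑ j, (A : Matrix (Fin 2) (Fin 2) F) i j •
        (LinearMap.proj j : (Fin 2 → Fin n → F) →ₗ[F] Fin n → F)
      map_one' := by
        refine LinearMap.ext fun v => funext fun i => ?_
        fin_cases i <;> simp
      map_mul' := fun A B => by
        refine LinearMap.ext fun v => funext fun i => funext fun k => ?_
        simp [Matrix.mul_apply, Fin.sum_univ_two]
        ring }

/-- `GL_n` acting diagonally on `Fⁿ ⊕ Fⁿ`. -/
def glDiag : GL (Fin n) F →* LinearMap.GeneralLinearGroup F (Fin 2 → Fin n → F) :=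
  MonoidHom.toHomUnits
    { toFun := fun B => diagAction F n B
      map_one' := by ext; simp [diagAction]
      map_mul' := fun A B => by ext; simp [diagAction] }

/-- `SL_n` acting diagonally on `Fⁿ ⊕ Fⁿ`. -/
def slDiag : Matrix.SpecialLinearGroup (Fin n) F →*
    LinearMap.GeneralLinearGroup F (Fin 2 → Fin n → F) :=
  (glDiag F n).comp Matrix.SpecialLinearGroup.toGL

/-- `SL_2 × SL_n` acting on `Fⁿ ⊕ Fⁿ = F² ⊗ Fⁿ`. -/
def sl2slMixing : Matrix.SpecialLinearGroup (Fin 2) F × Matrix.SpecialLinearGroup (Fin n) F →*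
    LinearMap.GeneralLinearGroup F (Fin 2 → Fin n → F) :=
  MonoidHom.noncommCoprod ((gl2Mixing F n).comp Matrix.SpecialLinearGroup.toGL) (slDiag F n) (by
    intro A B
    apply Units.ext
    refine LinearMap.ext fun v => funext fun i => ?_
    simp [gl2Mixing, slDiag, glDiag, diagAction, Matrix.mulVec_add, Matrix.mulVec_smul])

end TwoCopies

/-! ### `sl_2 ⊕ sl_3` on `F³ ⊠ F²` -/

section Box

variable (F : Type*) [Field F]

/-- The representation of `sl_2 ⊕ sl_3` in `F³ ⊠ F²`, in parity `p`. -/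
def slBox (p : ZMod 2) :
    (LieSuperalgebra.ofLie F
      (LieAlgebra.SpecialLinear.sl (Fin 2) F × LieAlgebra.SpecialLinear.sl (Fin 3) F)).Rep
      (Superspace.pure F ((Fin 3 → F) ⊗[F] (Fin 2 → F)) p) :=
  LieSuperalgebra.Rep.ofLie p
    { toFun := fun x =>
        TensorProduct.map (Matrix.toLin' (slVal F 3 x.2)) LinearMap.id +
        TensorProduct.map LinearMap.id (Matrix.toLin' (slVal F 2 x.1))
      map_add' := fun x y => by
        simp only [Prod.fst_add, Prod.snd_add, map_add, TensorProduct.map_add_left,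
          TensorProduct.map_add_right]
        abel
      map_smul' := fun c x => by
        simp only [Prod.smul_fst, Prod.smul_snd, map_smul, TensorProduct.map_smul_left,
          TensorProduct.map_smul_right, RingHom.id_apply, smul_add] }
    (by
      intro x y
      apply TensorProduct.ext'
      intro v w
      simp only [LieAlgebra.Prod.bracket_apply, slVal_lie, map_sub,
        Matrix.toLin'_mul, LinearMap.coe_mk, AddHom.coe_mk, LinearMap.add_apply,
        LinearMap.sub_apply, TensorProduct.map_tmul, LinearMap.id_apply, Module.End.mul_apply,
        map_add, LinearMap.comp_apply, TensorProduct.sub_tmul, TensorProduct.tmul_sub]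
      abel)

/-- `SL_2 × SL_3` acting on `F³ ⊠ F²`. -/
def sl2sl3Box : Matrix.SpecialLinearGroup (Fin 2) F × Matrix.SpecialLinearGroup (Fin 3) F →*
    LinearMap.GeneralLinearGroup F ((Fin 3 → F) ⊗[F] (Fin 2 → F)) :=
  MonoidHom.toHomUnits
    { toFun := fun A => TensorProduct.map (Matrix.toLin' (A.2 : Matrix (Fin 3) (Fin 3) F))
        (Matrix.toLin' (A.1 : Matrix (Fin 2) (Fin 2) F))
      map_one' := by simp [Module.End.one_eq_id]
      map_mul' := fun A B => by
        apply TensorProduct.ext'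
        intro v w
        simp }

end Box

/-! ### `sl_5` on `Λ² F⁵` -/

section ExteriorSquare

variable (F : Type*) [Field F]

variable {F} in
/-- The wedge product `v ∧ w` of two vectors. -/
def wedge {W : Type*} [AddCommGroup W] [Module F W] (v w : W) : ⋀[F]^2 W :=
  exteriorPower.ιMulti F 2 ![v, w]

section

variable {W : Type*} [AddCommGroup W] [Module F W]

theorem wedge_add_left (v v' w : W) : wedge (F := F) (v + v') w = wedge v w + wedge v' w := by
  have h := (exteriorPower.ιMulti F 2).map_update_add ![v, w] 0 v v'
  have e : ∀ a, Function.update ![v, w] 0 a = ![a, w] := fun a => by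
    funext i; fin_cases i <;> simp
  rwa [e, e, e] at h

theorem wedge_add_right (v w w' : W) : wedge (F := F) v (w + w') = wedge v w + wedge v w' := by
  have h := (exteriorPower.ιMulti F 2).map_update_add ![v, w] 1 w w'
  have e : ∀ a, Function.update ![v, w] 1 a = ![v, a] := fun a => by
    funext i; fin_cases i <;> simp
  rwa [e, e, e] at h

theorem wedge_smul_left (c : F) (v w : W) : wedge (F := F) (c • v) w = c • wedge v w := by
  have h := (exteriorPower.ιMulti F 2).map_update_smul ![v, w] 0 c v
  have e : ∀ a, Function.update ![v, w] 0 a = ![a, w] := fun a => by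
    funext i; fin_cases i <;> simp
  rwa [e, e] at h

theorem wedge_smul_right (c : F) (v w : W) : wedge (F := F) v (c • w) = c • wedge v w := by
  have h := (exteriorPower.ιMulti F 2).map_update_smul ![v, w] 1 c w
  have e : ∀ a, Function.update ![v, w] 1 a = ![v, a] := fun a => by
    funext i; fin_cases i <;> simp
  rwa [e, e] at h

theorem wedge_sub_left (v v' w : W) : wedge (F := F) (v - v') w = wedge v w - wedge v' w := by
  rw [eq_sub_iff_add_eq, ← wedge_add_left, sub_add_cancel]

theorem wedge_sub_right (v w w' : W) : wedge (F := F) v (w - w') = wedge v w - wedge v w' := by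
  rw [eq_sub_iff_add_eq, ← wedge_add_right, sub_add_cancel]

theorem wedge_swap (v w : W) : wedge (F := F) v w + wedge w v = 0 := by
  have h := (exteriorPower.ιMulti F 2).map_add_swap ![v, w] (i := 0) (j := 1) (by decide)
  have e : (![v, w] ∘ Equiv.swap (0 : Fin 2) 1) = ![w, v] := by
    funext i; fin_cases i <;> simp
  rwa [e] at h

theorem extSquare_hom_ext {N : Type*} [AddCommGroup N] [Module F N] {f g : ⋀[F]^2 W →ₗ[F] N}
    (h : ∀ v w, f (wedge v w) = g (wedge v w)) : f = g := by
  apply exteriorPower.linearMap_ext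
  ext v
  have e : v = ![v 0, v 1] := by funext i; fin_cases i <;> rfl
  have h1 := h (v 0) (v 1)
  simp only [wedge, ← e] at h1
  exact h1

/-- The derivation `v ∧ w ↦ x v ∧ w + v ∧ x w` of the exterior square. -/
def extSquareDerivAux (x : Module.End F W) : Module.End F (⋀[F]^2 W) :=
  exteriorPower.alternatingMapLinearEquiv
    { toFun := fun v => wedge (x (v 0)) (v 1) + wedge (v 0) (x (v 1))
      map_update_add' := by
        intro _ v i a b
        fin_cases i <;> simp [wedge_add_left, wedge_add_right] <;> abel
      map_update_smul' := by
        intro _ v i c a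
        fin_cases i <;> simp [wedge_smul_left, wedge_smul_right]
      map_eq_zero_of_eq' := by
        intro v i j hv hij
        have h01 : v 0 = v 1 := by
          fin_cases i <;> fin_cases j <;> simp_all
        rw [h01]
        exact wedge_swap F _ _ }

theorem extSquareDerivAux_wedge (x : Module.End F W) (v w : W) :
    extSquareDerivAux F x (wedge v w) = wedge (x v) w + wedge v (x w) := by
  simp [extSquareDerivAux, wedge, exteriorPower.alternatingMapLinearEquiv_apply_ιMulti]

/-- The action of the endomorphisms of `W` on `Λ² W` by derivations. -/
def extSquareDeriv : Module.End F W →ₗ[F] Module.End F (⋀[F]^2 W) where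
  toFun x := extSquareDerivAux F x
  map_add' x y := by
    apply extSquare_hom_ext
    intro v w
    simp only [extSquareDerivAux_wedge, LinearMap.add_apply, wedge_add_left, wedge_add_right]
    abel
  map_smul' c x := by
    apply extSquare_hom_ext
    intro v w
    simp only [extSquareDerivAux_wedge, LinearMap.smul_apply, wedge_smul_left, wedge_smul_right,
      RingHom.id_apply, smul_add]

end

/-- The representation of `sl_5` in `Λ² F⁵`, in parity `p`. -/
def slExtSquare (p : ZMod 2) :
    (LieSuperalgebra.ofLie F (LieAlgebra.SpecialLinear.sl (Fin 5) F)).Rep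
      (Superspace.pure F (⋀[F]^2 (Fin 5 → F)) p) :=
  LieSuperalgebra.Rep.ofLie p
    (extSquareDeriv F ∘ₗ (Matrix.toLin' : Matrix (Fin 5) (Fin 5) F ≃ₗ[F] _).toLinearMap ∘ₗ
      slVal F 5) (by
    intro x y
    apply extSquare_hom_ext
    intro v w
    have key : ∀ z : Module.End F (Fin 5 → F), extSquareDeriv F z = extSquareDerivAux F z :=
      fun _ => rfl
    simp only [LinearMap.comp_apply, slVal_lie, LinearEquiv.coe_coe, map_sub, Matrix.toLin'_mul,
      LinearMap.sub_apply, key, Module.End.mul_apply, extSquareDerivAux_wedge, map_add,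
      wedge_sub_left, wedge_sub_right]
    abel)

/-- `GL_5` acting on `Λ² F⁵`. -/
def glExtSquare : GL (Fin 5) F →* LinearMap.GeneralLinearGroup F (⋀[F]^2 (Fin 5 → F)) :=
  MonoidHom.toHomUnits
    { toFun := fun A => exteriorPower.map 2 (Matrix.toLin' (A : Matrix (Fin 5) (Fin 5) F))
      map_one' := by simp [Module.End.one_eq_id]
      map_mul' := fun A B => by
        simp [Matrix.toLin'_mul, Module.End.mul_eq_comp, exteriorPower.map_comp] }

/-- `SL_5` acting on `Λ² F⁵`. -/
def slGroupExtSquare : Matrix.SpecialLinearGroup (Fin 5) F →*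
    LinearMap.GeneralLinearGroup F (⋀[F]^2 (Fin 5 → F)) :=
  (glExtSquare F).comp Matrix.SpecialLinearGroup.toGL

end ExteriorSquare

/-! ### Lie superalgebras of block matrices -/

section Block

variable {F : Type*} [Field F] {ι κ : Type*}

/-- The even part `diag(a, d)` of a block matrix `(a, b; c, d)`. -/
def evenBlock : Matrix (ι ⊕ κ) (ι ⊕ κ) F →ₗ[F] Matrix (ι ⊕ κ) (ι ⊕ κ) F where
  toFun x := Matrix.fromBlocks x.toBlocks₁₁ 0 0 x.toBlocks₂₂
  map_add' x y := by ext (i | i) (j | j) <;> simp [Matrix.toBlocks₁₁, Matrix.toBlocks₂₂]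
  map_smul' c x := by ext (i | i) (j | j) <;> simp [Matrix.toBlocks₁₁, Matrix.toBlocks₂₂]

/-- The odd part `(0, b; c, 0)` of a block matrix `(a, b; c, d)`. -/
def oddBlock : Matrix (ι ⊕ κ) (ι ⊕ κ) F →ₗ[F] Matrix (ι ⊕ κ) (ι ⊕ κ) F where
  toFun x := Matrix.fromBlocks 0 x.toBlocks₁₂ x.toBlocks₂₁ 0
  map_add' x y := by ext (i | i) (j | j) <;> simp [Matrix.toBlocks₁₂, Matrix.toBlocks₂₁]
  map_smul' c x := by ext (i | i) (j | j) <;> simp [Matrix.toBlocks₁₂, Matrix.toBlocks₂₁]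

theorem evenBlock_add_oddBlock (x : Matrix (ι ⊕ κ) (ι ⊕ κ) F) : evenBlock x + oddBlock x = x := by
  ext (i | i) (j | j) <;>
    simp [evenBlock, oddBlock, Matrix.toBlocks₁₁, Matrix.toBlocks₁₂, Matrix.toBlocks₂₁,
      Matrix.toBlocks₂₂]

theorem oddBlock_evenBlock (x : Matrix (ι ⊕ κ) (ι ⊕ κ) F) : oddBlock (evenBlock x) = 0 := by
  ext (i | i) (j | j) <;> simp [evenBlock, oddBlock]

theorem evenBlock_oddBlock (x : Matrix (ι ⊕ κ) (ι ⊕ κ) F) : evenBlock (oddBlock x) = 0 := by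
  ext (i | i) (j | j) <;> simp [evenBlock, oddBlock]

variable (F ι κ) in
/-- The even (`i = 0`) and odd (`i = 1`) block matrices. -/
def blockPart (i : ZMod 2) : Submodule F (Matrix (ι ⊕ κ) (ι ⊕ κ) F) :=
  if i = 0 then LinearMap.ker oddBlock else LinearMap.ker evenBlock

theorem mem_blockPart_zero {x : Matrix (ι ⊕ κ) (ι ⊕ κ) F} :
    x ∈ blockPart F ι κ 0 ↔ evenBlock x = x ∧ oddBlock x = 0 := by
  simp only [blockPart, if_true, LinearMap.mem_ker]
  refine ⟨fun h => ⟨?_, h⟩, fun h => h.2⟩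
  have e := evenBlock_add_oddBlock x
  rwa [h, add_zero] at e

theorem mem_blockPart_one {x : Matrix (ι ⊕ κ) (ι ⊕ κ) F} :
    x ∈ blockPart F ι κ 1 ↔ evenBlock x = 0 ∧ oddBlock x = x := by
  simp only [blockPart, one_ne_zero, if_false, LinearMap.mem_ker]
  refine ⟨fun h => ⟨h, ?_⟩, fun h => h.1⟩
  have e := evenBlock_add_oddBlock x
  rwa [h, zero_add] at e

variable [Fintype ι] [Fintype κ]

/-- The bracket `[x, y] = xy - (-1)^{ij} yx` for `x`, `y` of parities `i`, `j`, extended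
bilinearly. -/
def superBracket (x y : Matrix (ι ⊕ κ) (ι ⊕ κ) F) : Matrix (ι ⊕ κ) (ι ⊕ κ) F :=
  x * y - evenBlock y * x - oddBlock y * evenBlock x + oddBlock y * oddBlock x

theorem superBracket_eq {i j : ZMod 2} {x y : Matrix (ι ⊕ κ) (ι ⊕ κ) F}
    (hx : x ∈ blockPart F ι κ i) (hy : y ∈ blockPart F ι κ j) :
    superBracket x y = x * y - superSign F i j • (y * x) := by
  have key : ∀ k : ZMod 2, k = 0 ∨ k = 1 := by decide
  rcases key i with rfl | rfl <;> rcases key j with rfl | rfl <;>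
    simp only [mem_blockPart_zero, mem_blockPart_one] at hx hy <;>
    simp [superBracket, superSign, hx, hy, ZMod.val_one]

theorem superBracket_fromBlocks (a a' : Matrix ι ι F) (b b' : Matrix ι κ F) (c c' : Matrix κ ι F)
    (d d' : Matrix κ κ F) :
    superBracket (Matrix.fromBlocks a b c d) (Matrix.fromBlocks a' b' c' d') =
      Matrix.fromBlocks (a * a' + b * c' - a' * a + b' * c) (a * b' + b * d' - a' * b - b' * d)
        (c * a' + d * c' - d' * c - c' * a) (c * b' + d * d' - d' * d + c' * b) := by
  simp only [superBracket, evenBlock, oddBlock, LinearMap.coe_mk, AddHom.coe_mk,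
    Matrix.toBlocks_fromBlocks₁₁, Matrix.toBlocks_fromBlocks₁₂, Matrix.toBlocks_fromBlocks₂₁,
    Matrix.toBlocks_fromBlocks₂₂, Matrix.fromBlocks_multiply, sub_eq_add_neg,
    Matrix.fromBlocks_neg, Matrix.fromBlocks_add]
  simp

theorem superBracket_add_right (x y z : Matrix (ι ⊕ κ) (ι ⊕ κ) F) :
    superBracket x (y + z) = superBracket x y + superBracket x z := by
  simp [superBracket]; noncomm_ring

theorem mul_mem_blockPart {i j : ZMod 2} {x y : Matrix (ι ⊕ κ) (ι ⊕ κ) F}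
    (hx : x ∈ blockPart F ι κ i) (hy : y ∈ blockPart F ι κ j) :
    x * y ∈ blockPart F ι κ (i + j) := by
  have key : ∀ k : ZMod 2, k = 0 ∨ k = 1 := by decide
  have h11 : (1 + 1 : ZMod 2) = 0 := by decide
  rcases key i with rfl | rfl <;> rcases key j with rfl | rfl <;>
    simp only [h11, add_zero, zero_add] <;>
    simp only [mem_blockPart_zero, mem_blockPart_one] at hx hy
  · obtain ⟨⟨hx, -⟩, ⟨hy, -⟩⟩ := And.intro hx hy
    rw [← hx, ← hy]
    simp [blockPart, evenBlock, oddBlock, Matrix.fromBlocks_multiply]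
  · obtain ⟨⟨hx, -⟩, ⟨-, hy⟩⟩ := And.intro hx hy
    rw [← hx, ← hy]
    simp [blockPart, evenBlock, oddBlock, Matrix.fromBlocks_multiply]
  · obtain ⟨⟨-, hx⟩, ⟨hy, -⟩⟩ := And.intro hx hy
    rw [← hx, ← hy]
    simp [blockPart, evenBlock, oddBlock, Matrix.fromBlocks_multiply]
  · obtain ⟨⟨-, hx⟩, ⟨-, hy⟩⟩ := And.intro hx hy
    rw [← hx, ← hy]
    simp [blockPart, evenBlock, oddBlock, Matrix.fromBlocks_multiply]

theorem superBracket_mem_blockPart {i j : ZMod 2} {x y : Matrix (ι ⊕ κ) (ι ⊕ κ) F}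
    (hx : x ∈ blockPart F ι κ i) (hy : y ∈ blockPart F ι κ j) :
    superBracket x y ∈ blockPart F ι κ (i + j) := by
  rw [superBracket_eq hx hy]
  refine Submodule.sub_mem _ (mul_mem_blockPart hx hy) (Submodule.smul_mem _ _ ?_)
  rw [add_comm]
  exact mul_mem_blockPart hy hx

theorem superBracket_jacobi {i j k : ZMod 2} {x y z : Matrix (ι ⊕ κ) (ι ⊕ κ) F}
    (hx : x ∈ blockPart F ι κ i) (hy : y ∈ blockPart F ι κ j) (hz : z ∈ blockPart F ι κ k) :
    superBracket x (superBracket y z) =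
      superBracket (superBracket x y) z + superSign F i j • superBracket y (superBracket x z) := by
  rw [superBracket_eq hx (superBracket_mem_blockPart hy hz),
    superBracket_eq (superBracket_mem_blockPart hx hy) hz,
    superBracket_eq hy (superBracket_mem_blockPart hx hz),
    superBracket_eq hx hy, superBracket_eq hy hz, superBracket_eq hx hz]
  have key : ∀ k : ZMod 2, k = 0 ∨ k = 1 := by decide
  have h11 : (1 + 1 : ZMod 2) = 0 := by decide
  rcases key i with rfl | rfl <;> rcases key j with rfl | rfl <;> rcases key k with rfl | rfl <;>
    simp [superSign, h11, ZMod.val_one] <;> noncomm_ring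

/-- A graded subspace of block matrices closed under the superbracket, as a Lie superalgebra. -/
def LieSuperalgebra.ofBlocks (g : Submodule F (Matrix (ι ⊕ κ) (ι ⊕ κ) F))
    (hgr : ∀ x ∈ g, evenBlock x ∈ g) (hbr : ∀ x ∈ g, ∀ y ∈ g, superBracket x y ∈ g) :
    LieSuperalgebra F g where
  part i := (blockPart F ι κ i).comap g.subtype
  isCompl := by
    constructor
    · rw [Submodule.disjoint_def]
      intro x h0 h1
      simp only [Submodule.mem_comap, Submodule.subtype_apply, mem_blockPart_zero,
        mem_blockPart_one] at h0 h1
      exact Subtype.ext (h0.1.symm.trans h1.1)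
    · rw [codisjoint_iff, Submodule.eq_top_iff']
      intro x
      have hodd : oddBlock x.1 ∈ g := by
        have e : oddBlock x.1 = x.1 - evenBlock x.1 :=
          eq_sub_of_add_eq' (evenBlock_add_oddBlock x.1)
        rw [e]
        exact g.sub_mem x.2 (hgr _ x.2)
      refine Submodule.mem_sup.2 ⟨⟨evenBlock x.1, hgr _ x.2⟩, ?_, ⟨oddBlock x.1, hodd⟩, ?_,
        Subtype.ext (evenBlock_add_oddBlock x.1)⟩
      · simp [blockPart, oddBlock_evenBlock]
      · simp [blockPart, evenBlock_oddBlock]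
  bracket := LinearMap.mk₂ F (fun x y => ⟨superBracket x.1 y.1, hbr _ x.2 _ y.2⟩)
    (fun x y z => Subtype.ext (by simp [superBracket]; noncomm_ring))
    (fun c x y => Subtype.ext (by simp [superBracket, smul_sub, smul_add]))
    (fun x y z => Subtype.ext (by simp [superBracket]; noncomm_ring))
    (fun c x y => Subtype.ext (by simp [superBracket, smul_sub, smul_add]))
  bracket_mem := fun hx hy => superBracket_mem_blockPart hx hy
  skew := by
    intro i j x y hx hy
    replace hx : x.1 ∈ blockPart F ι κ i := hx
    replace hy : y.1 ∈ blockPart F ι κ j := hy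
    apply Subtype.ext
    simp only [LinearMap.mk₂_apply, Submodule.coe_neg, Submodule.coe_smul]
    rw [superBracket_eq hx hy, superBracket_eq hy hx]
    have key : ∀ k : ZMod 2, k = 0 ∨ k = 1 := by decide
    rcases key i with rfl | rfl <;> rcases key j with rfl | rfl <;>
      simp [superSign, ZMod.val_one, add_comm]
  jacobi := by
    intro i j x y z hx hy
    replace hx : x.1 ∈ blockPart F ι κ i := hx
    replace hy : y.1 ∈ blockPart F ι κ j := hy
    apply Subtype.ext
    simp only [LinearMap.mk₂_apply, Submodule.coe_add, Submodule.coe_smul]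
    have h0 : evenBlock z.1 ∈ blockPart F ι κ 0 := by simp [blockPart, oddBlock_evenBlock]
    have h1 : oddBlock z.1 ∈ blockPart F ι κ 1 := by simp [blockPart, evenBlock_oddBlock]
    rw [← evenBlock_add_oddBlock z.1]
    simp only [superBracket_add_right, smul_add, superBracket_jacobi hx hy h0,
      superBracket_jacobi hx hy h1]
    abel

variable [DecidableEq ι] [DecidableEq κ]

variable (F ι κ) in
/-- The superspace `F^ι ⊕ F^κ`, where `F^ι` has parity `p` and `F^κ` has parity `p + 1`. -/
def blockSpace (p : ZMod 2) : Superspace F (ι ⊕ κ → F) where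
  part i := if i = p then LinearMap.ker (LinearMap.funLeft F F (Sum.inr : κ → ι ⊕ κ))
    else LinearMap.ker (LinearMap.funLeft F F (Sum.inl : ι → ι ⊕ κ))
  isCompl := by
    have key : IsCompl (LinearMap.ker (LinearMap.funLeft F F (Sum.inr : κ → ι ⊕ κ)))
        (LinearMap.ker (LinearMap.funLeft F F (Sum.inl : ι → ι ⊕ κ))) := by
      constructor
      · rw [Submodule.disjoint_def]
        intro v h0 h1
        funext i
        rcases i with i | i
        · exact congrFun h1 i
        · exact congrFun h0 i
      · rw [codisjoint_iff, Submodule.eq_top_iff']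
        intro v
        refine Submodule.mem_sup.2 ⟨Sum.elim (v ∘ Sum.inl) 0, ?_, Sum.elim 0 (v ∘ Sum.inr), ?_, ?_⟩
        · ext i; rfl
        · ext i; rfl
        · ext (i | i) <;> simp
    have h : p = 0 ∨ p = 1 := by revert p; decide
    rcases h with rfl | rfl
    · simpa using key
    · simpa using key.symm

/-- The tautological representation of a Lie superalgebra of block matrices. -/
def LieSuperalgebra.Rep.ofBlocks (p : ZMod 2) (g : Submodule F (Matrix (ι ⊕ κ) (ι ⊕ κ) F))
    (hgr : ∀ x ∈ g, evenBlock x ∈ g) (hbr : ∀ x ∈ g, ∀ y ∈ g, superBracket x y ∈ g) :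
    (LieSuperalgebra.ofBlocks g hgr hbr).Rep (blockSpace F ι κ p) where
  ρ := (Matrix.toLin' : Matrix (ι ⊕ κ) (ι ⊕ κ) F ≃ₗ[F] _).toLinearMap ∘ₗ g.subtype
  map_part := by
    intro i j x v hx hv
    replace hx : x.1 ∈ blockPart F ι κ i := hx
    change Matrix.mulVec x.1 v ∈ _
    have key : ∀ k : ZMod 2, k = 0 ∨ k = 1 := by decide
    have h11 : (1 + 1 : ZMod 2) = 0 := by decide
    have hl : ∀ {w : ι ⊕ κ → F}, w ∈ LinearMap.ker (LinearMap.funLeft F F (Sum.inr : κ → ι ⊕ κ)) ↔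
        ∀ k, w (Sum.inr k) = 0 := fun {w} => ⟨fun h k => congrFun h k, fun h => funext h⟩
    have hr : ∀ {w : ι ⊕ κ → F}, w ∈ LinearMap.ker (LinearMap.funLeft F F (Sum.inl : ι → ι ⊕ κ)) ↔
        ∀ k, w (Sum.inl k) = 0 := fun {w} => ⟨fun h k => congrFun h k, fun h => funext h⟩
    rcases key i with rfl | rfl
    · rw [mem_blockPart_zero] at hx
      rw [← hx.1, zero_add]
      by_cases hj : j = p
      · simp only [blockSpace, hj, if_true, hl] at hv ⊢
        intro k
        simp [evenBlock, Matrix.mulVec, dotProduct, hv]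
      · simp only [blockSpace, hj, if_false, hr] at hv ⊢
        intro k
        simp [evenBlock, Matrix.mulVec, dotProduct, hv]
    · rw [mem_blockPart_one] at hx
      rw [← hx.2]
      by_cases hj : j = p
      · have hj' : ¬ (1 + j = p) := by subst hj; simp
        simp only [blockSpace, if_pos hj, if_neg hj', hl, hr] at hv ⊢
        intro k
        simp [oddBlock, Matrix.mulVec, dotProduct, hv]
      · have hj' : 1 + j = p := by
          clear hv
          revert hj; revert j p; decide
        simp only [blockSpace, if_neg hj, if_pos hj', hl, hr] at hv ⊢
        intro k
        simp [oddBlock, Matrix.mulVec, dotProduct, hv]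
  map_bracket := by
    intro i j x y hx hy
    replace hx : x.1 ∈ blockPart F ι κ i := hx
    replace hy : y.1 ∈ blockPart F ι κ j := hy
    simp only [LieSuperalgebra.ofBlocks, LinearMap.mk₂_apply, LinearMap.comp_apply,
      Submodule.subtype_apply, LinearEquiv.coe_coe]
    rw [superBracket_eq hx hy]
    simp [Matrix.toLin'_mul, Module.End.mul_eq_comp]

variable (F ι κ) in
/-- `GL(F^ι) × GL(F^κ)` acting on `F^ι ⊕ F^κ`. -/
def glBlock : GL ι F × GL κ F →* LinearMap.GeneralLinearGroup F (ι ⊕ κ → F) :=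
  MonoidHom.toHomUnits
    { toFun := fun A => Matrix.toLin' (Matrix.fromBlocks (A.1 : Matrix ι ι F) 0 0 A.2)
      map_one' := by simp [Module.End.one_eq_id]
      map_mul' := fun A B => by
        rw [Module.End.mul_eq_comp, ← Matrix.toLin'_mul, Matrix.fromBlocks_multiply]
        simp }

end Block

/-! ### `sl(m, n)` -/

section SL

variable (F : Type*) [Field F] (m n : ℕ)

/-- The matrices `(a, b; c, d)` with supertrace `tr a - tr d` equal to zero. -/
def slSuperSubmodule : Submodule F (Matrix (Fin m ⊕ Fin n) (Fin m ⊕ Fin n) F) where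
  carrier := {x | x.toBlocks₁₁.trace - x.toBlocks₂₂.trace = 0}
  zero_mem' := by simp [Matrix.toBlocks₁₁, Matrix.toBlocks₂₂, Matrix.trace]
  add_mem' := by
    intro x y hx hy
    simp only [Set.mem_ofPred_eq, Matrix.toBlocks₁₁, Matrix.toBlocks₂₂, Matrix.trace,
      Matrix.diag_apply, Matrix.of_apply, Matrix.add_apply, Finset.sum_add_distrib] at *
    linear_combination hx + hy
  smul_mem' := by
    intro c x hx
    simp only [Set.mem_ofPred_eq, Matrix.toBlocks₁₁, Matrix.toBlocks₂₂, Matrix.trace,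
      Matrix.diag_apply, Matrix.of_apply, Matrix.smul_apply, smul_eq_mul,
      ← Finset.mul_sum] at *
    linear_combination c * hx

theorem evenBlock_mem_slSuper : ∀ x ∈ slSuperSubmodule F m n, evenBlock x ∈ slSuperSubmodule F m n :=
  fun _ hx => hx

theorem superBracket_mem_slSuper : ∀ x ∈ slSuperSubmodule F m n, ∀ y ∈ slSuperSubmodule F m n,
    superBracket x y ∈ slSuperSubmodule F m n := by
  intro x _ y _
  rw [← Matrix.fromBlocks_toBlocks x, ← Matrix.fromBlocks_toBlocks y, superBracket_fromBlocks]
  change Matrix.trace _ - Matrix.trace _ = 0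
  simp only [Matrix.toBlocks_fromBlocks₁₁, Matrix.toBlocks_fromBlocks₂₂, Matrix.trace_add,
    Matrix.trace_sub]
  rw [Matrix.trace_mul_comm y.toBlocks₁₁, Matrix.trace_mul_comm y.toBlocks₂₂,
    Matrix.trace_mul_comm x.toBlocks₁₂, Matrix.trace_mul_comm y.toBlocks₁₂]
  ring

/-- The standard representation of `sl(m, n)` in `F^{m|n}`. -/
def slSuper : (LieSuperalgebra.ofBlocks (slSuperSubmodule F m n) (evenBlock_mem_slSuper F m n)
    (superBracket_mem_slSuper F m n)).Rep (blockSpace F (Fin m) (Fin n) 0) :=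
  LieSuperalgebra.Rep.ofBlocks 0 _ _ _

end SL

/-! ### `spo(2k, n)` -/

section SPO

variable (F : Type*) [Field F] (k n : ℕ)

/-- The matrices `(a, b; c, d)` preserving, in the super sense, the even form on `F^{2k|n}` which is
the symplectic form with matrix `J` on `F^{2k}` and the symmetric form with matrix `1` on `Fⁿ`:
`a ∈ sp_{2k}`, `d ∈ so_n` and `c = bᵀ J`. -/
def spoSubmodule :
    Submodule F (Matrix ((Fin k ⊕ Fin k) ⊕ Fin n) ((Fin k ⊕ Fin k) ⊕ Fin n) F) where
  carrier := {x | ∃ a ∈ LieAlgebra.Symplectic.sp (Fin k) F, ∃ d ∈ LieAlgebra.Orthogonal.so (Fin n) F,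
    ∃ b : Matrix (Fin k ⊕ Fin k) (Fin n) F,
      x = Matrix.fromBlocks a b (b.transpose * Matrix.J (Fin k) F) d}
  zero_mem' := ⟨0, zero_mem _, 0, zero_mem _, 0, by simp⟩
  add_mem' := by
    rintro _ _ ⟨a, ha, d, hd, b, rfl⟩ ⟨a', ha', d', hd', b', rfl⟩
    exact ⟨a + a', add_mem ha ha', d + d', add_mem hd hd', b + b', by
      simp [Matrix.fromBlocks_add, Matrix.add_mul]⟩
  smul_mem' := by
    rintro t _ ⟨a, ha, d, hd, b, rfl⟩
    exact ⟨t • a, Submodule.smul_mem (LieSubalgebra.toSubmodule _) t ha, t • d,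
      Submodule.smul_mem (LieSubalgebra.toSubmodule _) t hd, t • b, by
      simp [Matrix.fromBlocks_smul]⟩

theorem mem_sp_iff {a : Matrix (Fin k ⊕ Fin k) (Fin k ⊕ Fin k) F} :
    a ∈ LieAlgebra.Symplectic.sp (Fin k) F ↔
      a.transpose * Matrix.J (Fin k) F = -(Matrix.J (Fin k) F * a) := by
  simp [LieAlgebra.Symplectic.sp, Matrix.IsSkewAdjoint, Matrix.IsAdjointPair]

theorem evenBlock_mem_spo : ∀ x ∈ spoSubmodule F k n, evenBlock x ∈ spoSubmodule F k n := by
  rintro _ ⟨a, ha, d, hd, b, rfl⟩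
  exact ⟨a, ha, d, hd, 0, by simp [evenBlock]⟩

theorem superBracket_mem_spo : ∀ x ∈ spoSubmodule F k n, ∀ y ∈ spoSubmodule F k n,
    superBracket x y ∈ spoSubmodule F k n := by
  rintro _ ⟨a, ha, d, hd, b, rfl⟩ _ ⟨a', ha', d', hd', b', rfl⟩
  rw [superBracket_fromBlocks]
  refine ⟨_, ?_, _, ?_, _, congrArg₂ (fun c d => Matrix.fromBlocks _ _ c d) ?_ rfl⟩
  · rw [mem_sp_iff] at *
    simp only [Matrix.transpose_add, Matrix.transpose_sub, Matrix.transpose_mul,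
      Matrix.transpose_transpose, Matrix.J_transpose, Matrix.add_mul, Matrix.sub_mul,
      Matrix.mul_add, Matrix.mul_sub, Matrix.mul_assoc, Matrix.neg_mul, Matrix.mul_neg, ha, ha']
    simp only [← Matrix.mul_assoc, ha, ha']
    noncomm_ring
  · rw [LieAlgebra.Orthogonal.mem_so] at *
    simp only [Matrix.transpose_add, Matrix.transpose_sub, Matrix.transpose_mul,
      Matrix.transpose_transpose, Matrix.J_transpose, Matrix.mul_assoc, Matrix.neg_mul,
      Matrix.mul_neg, hd, hd']
    noncomm_ring
  · rw [LieAlgebra.Orthogonal.mem_so] at hd hd'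
    rw [mem_sp_iff] at ha ha'
    simp only [Matrix.transpose_add, Matrix.transpose_sub, Matrix.transpose_mul, Matrix.add_mul,
      Matrix.sub_mul, Matrix.mul_assoc, ha, ha', hd, hd', Matrix.neg_mul, Matrix.mul_neg]
    abel

/-- The standard representation of `spo(2k, n)` in `F^{2k|n}`. -/
def spo : (LieSuperalgebra.ofBlocks (spoSubmodule F k n) (evenBlock_mem_spo F k n)
    (superBracket_mem_spo F k n)).Rep (blockSpace F (Fin k ⊕ Fin k) (Fin n) 0) :=
  LieSuperalgebra.Rep.ofBlocks 0 _ _ _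

attribute [local instance] starRingOfComm in
/-- `Sp_{2k} × O_n` acting on `F^{2k|n}`. -/
def spoGroup : Matrix.symplecticGroup (Fin k) F × Matrix.orthogonalGroup (Fin n) F →*
    LinearMap.GeneralLinearGroup F ((Fin k ⊕ Fin k) ⊕ Fin n → F) :=
  (glBlock F (Fin k ⊕ Fin k) (Fin n)).comp
    (MonoidHom.prodMap (Matrix.symplecticGroup (Fin k) F).subtype.toHomUnits
      (Matrix.orthogonalGroup (Fin n) F).subtype.toHomUnits)

end SPO

/-! ### `P_n` and `P̂_4` -/

section Periplectic

variable (F : Type*) [Field F] (n : ℕ)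

/-- The matrices `(a, b; c, -aᵀ)` with `tr a = 0`, `b` symmetric and `c` skew-symmetric. -/
def pSubmodule : Submodule F (Matrix (Fin n ⊕ Fin n) (Fin n ⊕ Fin n) F) where
  carrier := {x | ∃ a b c : Matrix (Fin n) (Fin n) F, a.trace = 0 ∧ b.transpose = b ∧
    c.transpose = -c ∧ x = Matrix.fromBlocks a b c (-a.transpose)}
  zero_mem' := ⟨0, 0, 0, by simp, by simp, by simp, by simp⟩
  add_mem' := by
    rintro _ _ ⟨a, b, c, ha, hb, hc, rfl⟩ ⟨a', b', c', ha', hb', hc', rfl⟩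
    exact ⟨a + a', b + b', c + c', by simp [ha, ha'], by simp [hb, hb'],
      by simp [hc, hc', add_comm], by simp [Matrix.fromBlocks_add, add_comm]⟩
  smul_mem' := by
    rintro t _ ⟨a, b, c, ha, hb, hc, rfl⟩
    exact ⟨t • a, t • b, t • c, by simp [ha], by simp [hb], by simp [hc],
      by simp [Matrix.fromBlocks_smul]⟩

theorem evenBlock_mem_p : ∀ x ∈ pSubmodule F n, evenBlock x ∈ pSubmodule F n := by
  rintro _ ⟨a, b, c, ha, hb, hc, rfl⟩
  exact ⟨a, 0, 0, ha, by simp, by simp, by simp [evenBlock]⟩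

variable {F n} in
theorem trace_sym_mul_skew [CharZero F] {b c : Matrix (Fin n) (Fin n) F} (hb : b.transpose = b)
    (hc : c.transpose = -c) : (b * c).trace = 0 := by
  have h := Matrix.trace_transpose (b * c)
  rw [Matrix.transpose_mul, hb, hc, Matrix.neg_mul, Matrix.trace_neg, Matrix.trace_mul_comm] at h
  have h2 : (2 : F) * (b * c).trace = 0 := by linear_combination -h
  simpa using h2

theorem superBracket_mem_p [CharZero F] : ∀ x ∈ pSubmodule F n, ∀ y ∈ pSubmodule F n,
    superBracket x y ∈ pSubmodule F n := by
  rintro _ ⟨a, b, c, ha, hb, hc, rfl⟩ _ ⟨a', b', c', ha', hb', hc', rfl⟩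
  rw [superBracket_fromBlocks]
  refine ⟨a * a' + b * c' - a' * a + b' * c,
    a * b' + b * -a'.transpose - a' * b - b' * -a.transpose,
    c * a' + -a.transpose * c' - -a'.transpose * c - c' * a, ?_, ?_, ?_,
    congrArg (Matrix.fromBlocks _ _ _) ?_⟩
  · rw [Matrix.trace_add, Matrix.trace_sub, Matrix.trace_add, trace_sym_mul_skew hb hc',
      trace_sym_mul_skew hb' hc, Matrix.trace_mul_comm a]
    ring
  · simp only [Matrix.transpose_add, Matrix.transpose_sub, Matrix.transpose_mul,
      Matrix.transpose_transpose, hb, hb', hc, hc', Matrix.transpose_neg]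
    noncomm_ring
  · simp only [Matrix.transpose_add, Matrix.transpose_sub, Matrix.transpose_mul,
      Matrix.transpose_transpose, hb, hb', hc, hc', Matrix.transpose_neg]
    noncomm_ring
  · simp only [Matrix.transpose_add, Matrix.transpose_sub, Matrix.transpose_mul,
      Matrix.transpose_transpose, hb, hb', hc, hc', Matrix.transpose_neg]
    noncomm_ring

/-- The standard representation of `P_n` in `Fⁿ ⊕ Fⁿ*`, where `Fⁿ` has parity `p` and `Fⁿ*` has
the other parity. -/
def periplectic [CharZero F] (p : ZMod 2) :
    (LieSuperalgebra.ofBlocks (pSubmodule F n) (evenBlock_mem_p F n)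
      (superBracket_mem_p F n)).Rep (blockSpace F (Fin n) (Fin n) p) :=
  LieSuperalgebra.Rep.ofBlocks p _ _ _

/-- `GL_n` acting on `Fⁿ ⊕ Fⁿ*`. -/
def glDual : GL (Fin n) F →* LinearMap.GeneralLinearGroup F (Fin n ⊕ Fin n → F) :=
  MonoidHom.toHomUnits
    { toFun := fun A => Matrix.toLin' (Matrix.fromBlocks (A : Matrix (Fin n) (Fin n) F) 0 0
        ((A⁻¹ : GL (Fin n) F) : Matrix (Fin n) (Fin n) F).transpose)
      map_one' := by simp [Module.End.one_eq_id]
      map_mul' := fun A B => by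
        rw [Module.End.mul_eq_comp, ← Matrix.toLin'_mul, Matrix.fromBlocks_multiply, mul_inv_rev,
          Units.val_mul, Units.val_mul, Matrix.transpose_mul]
        simp }

/-- `SL_n` acting on `Fⁿ ⊕ Fⁿ*`. -/
def slDual : Matrix.SpecialLinearGroup (Fin n) F →*
    LinearMap.GeneralLinearGroup F (Fin n ⊕ Fin n → F) :=
  (glDual F n).comp Matrix.SpecialLinearGroup.toGL

/-- The Hodge dual `c*` of a skew-symmetric `4 × 4` matrix: `(c*)_{ij} = c_{kl}` whenever
`(i, j, k, l)` is an even permutation of the four indices. -/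
def hodge : Matrix (Fin 4) (Fin 4) F →ₗ[F] Matrix (Fin 4) (Fin 4) F where
  toFun c := !![0, c 2 3, -c 1 3, c 1 2;
    -c 2 3, 0, c 0 3, -c 0 2;
    c 1 3, -c 0 3, 0, c 0 1;
    -c 1 2, c 0 2, -c 0 1, 0]
  map_add' c c' := by ext i j; fin_cases i <;> fin_cases j <;> simp [add_comm]
  map_smul' t c := by ext i j; fin_cases i <;> fin_cases j <;> simp

/-- The Lie superalgebra `P̂_4`, the non-trivial central extension of `P_4` by a one-dimensional even
center, in its standard representation: the element `(a, b; c, -aᵀ) + z` acts by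
`(a, b - c*; c, -aᵀ) + z • 1`. -/
def pHatSubmodule : Submodule F (Matrix (Fin 4 ⊕ Fin 4) (Fin 4 ⊕ Fin 4) F) where
  carrier := {x | ∃ (a b c : Matrix (Fin 4) (Fin 4) F) (z : F), a.trace = 0 ∧ b.transpose = b ∧
    c.transpose = -c ∧
    x = Matrix.fromBlocks (a + z • 1) (b - hodge F c) c (-a.transpose + z • 1)}
  zero_mem' := ⟨0, 0, 0, 0, by simp, by simp, by simp, by simp⟩
  add_mem' := by
    rintro _ _ ⟨a, b, c, z, ha, hb, hc, rfl⟩ ⟨a', b', c', z', ha', hb', hc', rfl⟩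
    refine ⟨a + a', b + b', c + c', z + z', by simp [ha, ha'], by simp [hb, hb'],
      by simp [hc, hc', add_comm], ?_⟩
    rw [Matrix.fromBlocks_add]
    congr 1
    · rw [add_smul]; abel
    · rw [map_add]; abel
    · rw [add_smul, Matrix.transpose_add]; abel
  smul_mem' := by
    rintro t _ ⟨a, b, c, z, ha, hb, hc, rfl⟩
    refine ⟨t • a, t • b, t • c, t * z, by simp [ha], by simp [hb], by simp [hc], ?_⟩
    rw [Matrix.fromBlocks_smul]
    congr 1
    · rw [smul_add, smul_smul]
    · rw [map_smul, smul_sub]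
    · rw [smul_add, smul_smul, Matrix.transpose_smul, smul_neg]

theorem evenBlock_mem_pHat : ∀ x ∈ pHatSubmodule F, evenBlock x ∈ pHatSubmodule F := by
  rintro _ ⟨a, b, c, z, ha, hb, hc, rfl⟩
  exact ⟨a, 0, 0, z, ha, by simp, by simp, by simp [evenBlock]⟩

variable {F} in
theorem skew_apply {c : Matrix (Fin 4) (Fin 4) F} (hc : c.transpose = -c) (i j : Fin 4) :
    c i j = -c j i := by
  simpa using congrFun (congrFun hc j) i

variable {F} in
theorem skew_diag [CharZero F] {c : Matrix (Fin 4) (Fin 4) F} (hc : c.transpose = -c) (i : Fin 4) :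
    c i i = 0 := by
  have h := skew_apply hc i i
  have h2 : (2 : F) * c i i = 0 := by linear_combination h
  simpa using h2

theorem skew_eq [CharZero F] {c : Matrix (Fin 4) (Fin 4) F} (hc : c.transpose = -c) :
    c = !![0, c 0 1, c 0 2, c 0 3; -c 0 1, 0, c 1 2, c 1 3; -c 0 2, -c 1 2, 0, c 2 3;
      -c 0 3, -c 1 3, -c 2 3, 0] := by
  ext i j
  fin_cases i <;> fin_cases j <;> simp [skew_diag hc] <;> exact skew_apply hc _ _

/-- The symmetric bilinear form on skew-symmetric matrices polarizing the Pfaffian. -/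
def pfForm (c c' : Matrix (Fin 4) (Fin 4) F) : F :=
  -(c 0 1 * c' 2 3 - c 0 2 * c' 1 3 + c 0 3 * c' 1 2 + c 2 3 * c' 0 1 - c 1 3 * c' 0 2 +
    c 1 2 * c' 0 3)

theorem hodge_mul [CharZero F] {c c' : Matrix (Fin 4) (Fin 4) F} (hc : c.transpose = -c)
    (hc' : c'.transpose = -c') :
    hodge F c * c' + hodge F c' * c = pfForm F c c' • 1 := by
  rw [skew_eq F hc, skew_eq F hc']
  ext i j
  fin_cases i <;> fin_cases j <;>
    simp [hodge, pfForm] <;> ring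

theorem mul_hodge [CharZero F] {c c' : Matrix (Fin 4) (Fin 4) F} (hc : c.transpose = -c)
    (hc' : c'.transpose = -c') :
    c * hodge F c' + c' * hodge F c = pfForm F c c' • 1 := by
  rw [skew_eq F hc, skew_eq F hc']
  ext i j
  fin_cases i <;> fin_cases j <;>
    simp [hodge, pfForm] <;> ring

set_option maxHeartbeats 2000000 in
theorem hodge_deriv [CharZero F] {a c : Matrix (Fin 4) (Fin 4) F} (ha : a.trace = 0)
    (hc : c.transpose = -c) :
    hodge F (a.transpose * c + c * a) = -(a * hodge F c + hodge F c * a.transpose) := by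
  rw [skew_eq F hc]
  simp only [Matrix.trace, Matrix.diag_apply, Fin.sum_univ_four] at ha
  have h33 : a 3 3 = -(a 0 0 + a 1 1 + a 2 2) := by linear_combination ha
  ext i j
  fin_cases i <;> fin_cases j <;>
    simp [hodge, Matrix.mul_apply, Matrix.vecMul, dotProduct, Fin.sum_univ_four, h33] <;> ring

theorem superBracket_mem_pHat [CharZero F] : ∀ x ∈ pHatSubmodule F, ∀ y ∈ pHatSubmodule F,
    superBracket x y ∈ pHatSubmodule F := by
  rintro _ ⟨a, b, c, z, ha, hb, hc, rfl⟩ _ ⟨a', b', c', z', ha', hb', hc', rfl⟩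
  rw [superBracket_fromBlocks]
  have e1 := hodge_mul F hc hc'
  have e2 := mul_hodge F hc hc'
  refine ⟨a * a' - a' * a + (b * c' + b' * c),
    (a * b' + b' * a.transpose) - (a' * b + b * a'.transpose),
    (a'.transpose * c + c * a') - (a.transpose * c' + c' * a), -pfForm F c c', ?_, ?_, ?_, ?_⟩
  · rw [Matrix.trace_add, Matrix.trace_sub, Matrix.trace_add, trace_sym_mul_skew hb hc',
      trace_sym_mul_skew hb' hc, Matrix.trace_mul_comm a]
    ring
  · simp only [Matrix.transpose_add, Matrix.transpose_sub, Matrix.transpose_mul,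
      Matrix.transpose_transpose, hb, hb']
    noncomm_ring
  · simp only [Matrix.transpose_add, Matrix.transpose_sub, Matrix.transpose_mul,
      Matrix.transpose_transpose, hc, hc']
    noncomm_ring
  · congr 1
    · rw [neg_smul, ← e1]
      simp only [Matrix.add_mul, Matrix.mul_add, Matrix.sub_mul, Matrix.smul_mul, Matrix.mul_smul,
        Matrix.one_mul, Matrix.mul_one, smul_add, smul_smul, mul_comm z' z]
      abel
    · rw [map_sub, hodge_deriv F ha' hc, hodge_deriv F ha hc']
      simp only [Matrix.add_mul, Matrix.mul_add, Matrix.sub_mul, Matrix.mul_sub, Matrix.smul_mul,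
        Matrix.mul_smul, Matrix.one_mul, Matrix.mul_one, Matrix.mul_neg, smul_sub]
      abel
    · simp only [Matrix.add_mul, Matrix.mul_add, Matrix.neg_mul, Matrix.smul_mul, Matrix.mul_smul,
        Matrix.one_mul, Matrix.mul_one]
      abel
    · rw [neg_smul, ← e2]
      simp only [Matrix.transpose_add, Matrix.transpose_sub, Matrix.transpose_mul, hb, hb', hc, hc',
        Matrix.add_mul, Matrix.mul_add, Matrix.mul_sub, Matrix.smul_mul,
        Matrix.mul_smul, Matrix.one_mul, Matrix.mul_one, Matrix.mul_neg, Matrix.neg_mul, smul_add,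
        smul_neg, smul_smul, mul_comm z' z]
      abel

/-- The standard representation of `P̂_4` in `F⁴ ⊕ F⁴*`, where `F⁴` has parity `p` and `F⁴*` has
the other parity. -/
def periplecticHat [CharZero F] (p : ZMod 2) :
    (LieSuperalgebra.ofBlocks (pHatSubmodule F) (evenBlock_mem_pHat F)
      (superBracket_mem_pHat F)).Rep (blockSpace F (Fin 4) (Fin 4) p) :=
  LieSuperalgebra.Rep.ofBlocks p _ _ _

end Periplectic

end

noncomputable section

open scoped TensorProduct

attribute [local instance] LieRing.ofAssociativeRing


/-! ### Conjugation and invariant subspaces -/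

section Conjugation

variable {F V : Type*} [Field F] [AddCommGroup V] [Module F V]

/-! One group settles the existence of a maximum in every case: the parity-preserving elements of
`GL(V)` whose conjugation, together with that of the inverse, preserves the subspace `ρ(𝔤)` of
`End(V)`. In finite dimension every admissible group lies in it, straight from the definition. If
moreover `ρ` is injective, it is itself admissible: conjugation transports to an automorphism of
`𝔤`, which respects the grading because an operator that is both even and odd vanishes; and
conjugation by `exp a` or `t ^ a` is `exp (ad a)` or `t ^ (ad a)`, which preserves every subspace
stable under `ad a`. This is `isMaximalGroup_normalizer`. What remains is to compute the normalizer
case by case.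

For an ordinary Lie algebra, the aim is to find a matrix algebra normalized by `h`, apply
Skolem–Noether (`exists_conj_of_algHom`), and divide `h` by the resulting inner action; the quotient
lies in a commutant that is known explicitly. On two copies of `F^n`, the algebra is spanned by
`sl_n` and the scalars, and its commutant is `M_2`. On `F³ ⊠ F²`, the summand `sl_2` is recognized
as the radical of the cubic trace form `tr ρ(x)ρ(z)²` (`slBox_snd_eq_zero`), so `1 ⊗ M_2` is
normalized, with commutant `M_3 ⊗ 1`. On `Λ²F⁵` the image of `M_5` is not an associative subalgebra;
instead the traces on `Λ²` of products of up to three operators determine `tr(xyz)` on `M_5`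
(`trace_of_conj_wedgeDeriv`), so the induced linear map of `M_5` is multiplicative, and the
commutant consists of scalars.

For `n = 2` the two copies of `F²` are the `2 × 2` matrices with the determinant as quadratic form.
The image of `sl_2` is one of the two ideals of `so_4`, cut out by a self-duality condition that
`SO_4` preserves, while `SL_2 × SL_2` lies in `SO_4`; hence both groups give the normalizer after
adjoining scalars.

For block matrices, parity makes `h = diag(A, D)`. The supertrace is invariant under all of these.
For `spo`, the diagonal blocks force `A` and `D` to be similitudes and the odd blocks force equal
multipliers (`exists_common_multiplier`). For `P_n`, the even part alone forces `D = μ (A⁻¹)ᵀ`, and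
every nonzero `μ` works. For `P̂_4`, the Hodge star scales by `det A` under change of basis
(`mul_hodge_conj_mul`), which adds the condition `μ² = det A`.

In each almost direct product the factors commute, so only injectivity, generation and finiteness of
the intersection need proof (`IsAlmostDirectProduct.of_commute`). Algebraic closedness supplies the
roots that split off scalars, and the intersections consist of roots of unity. -/

/-- Conjugation by an element of `GL(V)`, as a linear automorphism of `End(V)`. -/
def conjEquiv (h : LinearMap.GeneralLinearGroup F V) : Module.End F V ≃ₗ[F] Module.End F V where
  toFun T := (h : Module.End F V) * T * ((h⁻¹ : LinearMap.GeneralLinearGroup F V) : Module.End F V)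
  map_add' x y := by rw [mul_add, add_mul]
  map_smul' c x := by simp
  invFun T := ((h⁻¹ : LinearMap.GeneralLinearGroup F V) : Module.End F V) * T * (h : Module.End F V)
  left_inv T := by simp [mul_assoc]
  right_inv T := by simp [mul_assoc]

theorem conjEquiv_apply (h : LinearMap.GeneralLinearGroup F V) (T : Module.End F V) :
    conjEquiv h T = (h : Module.End F V) * T *
      ((h⁻¹ : LinearMap.GeneralLinearGroup F V) : Module.End F V) := rfl

theorem conjEquiv_symm_apply (h : LinearMap.GeneralLinearGroup F V) (T : Module.End F V) :
    (conjEquiv h).symm T = ((h⁻¹ : LinearMap.GeneralLinearGroup F V) : Module.End F V) * T *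
      (h : Module.End F V) := rfl

theorem conjEquiv_mul_apply (h : LinearMap.GeneralLinearGroup F V) (S T : Module.End F V) :
    conjEquiv h (S * T) = conjEquiv h S * conjEquiv h T := by
  simp [conjEquiv_apply, mul_assoc]

theorem conjEquiv_one_apply (h : LinearMap.GeneralLinearGroup F V) :
    conjEquiv h (1 : Module.End F V) = 1 := by
  simp [conjEquiv_apply]

theorem conjEquiv_mem_iff {h : LinearMap.GeneralLinearGroup F V} {S T : Module.End F V} :
    conjEquiv h S = T ↔ (h : Module.End F V) * S = T * (h : Module.End F V) := by
  rw [conjEquiv_apply, Units.mul_inv_eq_iff_eq_mul]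

/-- An injective linear map of a finite-dimensional subspace into itself is onto. This is what later
makes the conditions on inverses automatic. -/
theorem map_eq_of_map_le [FiniteDimensional F V] (e : V ≃ₗ[F] V) {S : Submodule F V}
    (h : ∀ v ∈ S, e v ∈ S) : S.map (e : V →ₗ[F] V) = S :=
  Submodule.eq_of_le_of_finrank_eq (Submodule.map_le_iff_le_comap.2 h) (LinearEquiv.finrank_map_eq e S)

theorem symm_mem_of_forall_mem [FiniteDimensional F V] (e : V ≃ₗ[F] V) {S : Submodule F V}
    (h : ∀ v ∈ S, e v ∈ S) : ∀ v ∈ S, e.symm v ∈ S := by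
  intro v hv
  rw [← map_eq_of_map_le e h] at hv
  obtain ⟨w, hw, rfl⟩ := hv
  simpa using hw

theorem nilExp_mem {a : Module.End F V} {S : Submodule F V} (hS : ∀ v ∈ S, a v ∈ S) :
    ∀ v ∈ S, nilExp a v ∈ S := by
  intro v hv
  have h : ∀ i : ℕ, (a ^ i) v ∈ S := by
    intro i
    induction i with
    | zero => simpa using hv
    | succ i ih => rw [pow_succ']; exact hS _ ih
  simp only [nilExp, LinearMap.sum_apply, LinearMap.smul_apply]
  exact Submodule.sum_mem _ fun i _ => S.smul_mem _ (h i)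

/-- A subspace stable under a diagonalizable operator is the sum of its intersections with the
eigenspaces, and `u` is a scalar on each of these. -/
theorem IsTorusPower.mem [FiniteDimensional F V] {u a : Module.End F V} {t : Fˣ}
    (h : IsTorusPower u a t) {S : Submodule F V} (hS : ∀ v ∈ S, a v ∈ S) : ∀ v ∈ S, u v ∈ S := by
  have key : ∀ μ : F, S ⊓ a.eigenspace μ ≤ S.comap u := by
    rintro μ v ⟨hv, hμ⟩
    by_cases hk : ∃ k : ℤ, (k : F) = μ
    · obtain ⟨k, rfl⟩ := hk
      rw [Submodule.mem_comap, h.2 k v hμ]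
      exact S.smul_mem _ hv
    -- The integer eigenspaces already fill `V` and are independent of the one for `μ`, which is
    -- therefore zero.
    · have hd := a.eigenspaces_iSupIndep μ
      have htop : (⨆ (ν : F) (_ : ν ≠ μ), a.eigenspace ν) = ⊤ := by
        rw [eq_top_iff, ← h.1]
        exact iSup_le fun k => le_iSup₂_of_le (k : F) (fun e => hk ⟨k, e⟩) le_rfl
      rw [htop, disjoint_top] at hd
      rw [hd] at hμ
      rw [(Submodule.mem_bot F).1 hμ]
      exact zero_mem _
  have htop : (⨆ μ : F, a.genEigenspace μ 1) = ⊤ := by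
    rw [eq_top_iff, ← h.1]
    exact iSup_le fun k => le_iSup (fun μ : F => a.eigenspace μ) (k : F)
  have hle := Submodule.inf_iSup_genEigenspace (p := S) (f := a) hS 1
  rw [htop, inf_top_eq] at hle
  intro v hv
  rw [hle] at hv
  exact iSup_le key hv

/-- The operator `ad a` on `End(V)`. -/
def adEnd (a : Module.End F V) : Module.End F (Module.End F V) :=
  LinearMap.mulLeft F a - LinearMap.mulRight F a

theorem adEnd_apply (a x : Module.End F V) : adEnd a x = a * x - x * a := rfl


theorem exists_eigenbasis [FiniteDimensional F V] [CharZero F] {a : Module.End F V}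
    (h : (⨆ k : ℤ, a.eigenspace (k : F)) = ⊤) :
    ∃ (ι : Type) (_ : Fintype ι) (b : Module.Basis ι F V) (k : ι → ℤ),
      ∀ i, b i ∈ a.eigenspace (k i : F) := by
  classical
  have hind : iSupIndep fun k : ℤ => a.eigenspace (k : F) :=
    a.eigenspaces_iSupIndep.comp Int.cast_injective
  have hint := DirectSum.isInternal_submodule_of_iSupIndep_of_iSup_eq_top hind h
  let b := hint.collectedBasis fun k => Module.finBasis F (a.eigenspace (k : F))
  have := Module.Finite.finite_basis b
  exact ⟨_, Fintype.ofFinite _, b, fun i => i.1, fun i => hint.collectedBasis_mem _ i⟩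

/-- In an eigenbasis of `a` with eigenvalues `k i`, the matrix unit at `(i, j)` is an eigenvector of
`ad a` of weight `k i - k j`, and conjugation by `u` multiplies it by `t ^ (k i - k j)`. -/
theorem IsTorusPower.conj [FiniteDimensional F V] [CharZero F]
    {u : LinearMap.GeneralLinearGroup F V} {a : Module.End F V} {t : Fˣ}
    (h : IsTorusPower (u : Module.End F V) a t) :
    IsTorusPower (conjEquiv u : Module.End F (Module.End F V)) (adEnd a) t := by
  classical
  obtain ⟨ι, _, b, k, hb⟩ := exists_eigenbasis h.1
  have hab : ∀ i, a (b i) = (k i : F) • b i := fun i => Module.End.mem_eigenspace_iff.1 (hb i)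
  have hub : ∀ i, (u : Module.End F V) (b i) = ((t ^ k i : Fˣ) : F) • b i := fun i => h.2 _ _ (hb i)
  have hE : ∀ ij : ι × ι, b.end ij ∈ (adEnd a).eigenspace ((k ij.1 - k ij.2 : ℤ) : F) := by
    rintro ⟨i, j⟩
    rw [Module.End.mem_eigenspace_iff]
    have := Module.Basis.lie_end_of_apply_eq_smul b (fun i => (k i : F)) a hab i j
    rw [Ring.lie_def] at this
    rw [adEnd_apply, this]
    push_cast
    rfl
  have hcE : ∀ ij : ι × ι, conjEquiv u (b.end ij) = ((t ^ (k ij.1 - k ij.2) : Fˣ) : F) • b.end ij := by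
    rintro ⟨i, j⟩
    rw [conjEquiv_mem_iff]
    refine b.ext fun l => ?_
    simp only [Module.End.mul_apply, Module.Basis.end_apply_apply, LinearMap.smul_apply, hub,
      map_smul]
    split_ifs with hjl
    · subst hjl
      rw [hub, smul_smul, ← Units.val_mul, ← zpow_add]
      congr 3
      ring
    · simp
  refine ⟨?_, ?_⟩
  · rw [eq_top_iff, ← b.end.span_eq, Submodule.span_le]
    rintro _ ⟨ij, rfl⟩
    exact Submodule.mem_iSup_of_mem _ (hE ij)
  · intro m T hT
    rw [Module.End.mem_eigenspace_iff] at hT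
    -- An eigenvector of weight `m` involves only matrix units of weight `m`; characteristic zero
    -- lets weights be compared as integers.
    have hco : ∀ ij : ι × ι, b.end.repr T ij ≠ 0 → k ij.1 - k ij.2 = m := by
      intro ij hij
      have e := congrArg (fun X => b.end.repr X ij) hT
      have e2 : b.end.repr (adEnd a T) ij = ((k ij.1 - k ij.2 : ℤ) : F) * b.end.repr T ij := by
        have hlin : (b.end.coord ij) ∘ₗ adEnd a = ((k ij.1 - k ij.2 : ℤ) : F) • b.end.coord ij := by
          refine b.end.ext fun pq => ?_
          have := Module.End.mem_eigenspace_iff.1 (hE pq)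
          rw [LinearMap.comp_apply, this, map_smul, LinearMap.smul_apply, Module.Basis.coord_apply,
            Module.Basis.repr_self, Finsupp.single_apply]
          split_ifs with hpq
          · rw [hpq]
          · simp
        exact LinearMap.congr_fun hlin T
      simp only [map_smul, Finsupp.smul_apply, smul_eq_mul, e2] at e
      exact_mod_cast mul_right_cancel₀ hij e
    have hT' := b.end.sum_repr T
    rw [← hT', LinearEquiv.coe_coe, map_sum, Finset.smul_sum]
    refine Finset.sum_congr rfl fun ij _ => ?_
    rw [map_smul, hcE, smul_comm]
    by_cases hz : b.end.repr T ij = 0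
    · rw [hz, zero_smul, smul_zero, smul_zero]
    · rw [hco ij hz]

/-! ### Conjugation by the exponential of a nilpotent operator. -/

section Exp

theorem nilExp_eq_exp [Module ℚ V] [SMulCommClass F ℚ V] (a : Module.End F V) :
    nilExp a = IsNilpotent.exp a := by
  simp only [nilExp, IsNilpotent.exp]
  exact Finset.sum_congr rfl fun i _ => inv_natCast_smul_eq _ _ _ _

/-- `ad a` is the sum of the commuting nilpotents `L_a` and `R_{-a}`, so its exponential is left
multiplication by `exp a` composed with right multiplication by `exp (-a)`, and the latter is `u⁻¹`.
-/
theorem conj_nilExp [CharZero F] (u : LinearMap.GeneralLinearGroup F V) {a : Module.End F V}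
    (ha : IsNilpotent a) (hu : (u : Module.End F V) = nilExp a) :
    (conjEquiv u : Module.End F (Module.End F V)) = nilExp (adEnd a) := by
  -- `IsNilpotent.exp` has rational coefficients, so `V` is given the `ℚ`-structure restricted from
  -- `F`.
  let _ : Module ℚ V := Module.compHom V (algebraMap ℚ F)
  have : SMulCommClass F ℚ V := ⟨fun c q v => smul_comm c (algebraMap ℚ F q) v⟩
  rw [nilExp_eq_exp] at hu
  have hinv : ((u⁻¹ : LinearMap.GeneralLinearGroup F V) : Module.End F V) = IsNilpotent.exp (-a) := by
    refine (Units.inv_eq_of_mul_eq_one_right ?_)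
    rw [hu, IsNilpotent.exp_mul_exp_neg_self ha]
  have hl : IsNilpotent (LinearMap.mulLeft F a) := by
    obtain ⟨n, hn⟩ := ha
    exact ⟨n, by rw [LinearMap.pow_mulLeft, hn, LinearMap.mulLeft_zero_eq_zero]⟩
  have hr : IsNilpotent (-LinearMap.mulRight F a) := by
    obtain ⟨n, hn⟩ := ha
    exact (show IsNilpotent (LinearMap.mulRight F a) from
      ⟨n, by rw [LinearMap.pow_mulRight, hn, LinearMap.mulRight_zero_eq_zero]⟩).neg
  have hc : Commute (LinearMap.mulLeft F a) (-LinearMap.mulRight F a) :=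
    (show Commute (LinearMap.mulLeft F a) (LinearMap.mulRight F a) from
      LinearMap.commute_mulLeft_right a a).neg_right
  rw [nilExp_eq_exp, adEnd, sub_eq_add_neg, IsNilpotent.exp_add_of_commute hc hl hr]
  refine LinearMap.ext fun T => ?_
  obtain ⟨n, hn⟩ := ha
  have hl' : LinearMap.mulLeft F a ^ n = 0 := by
    rw [LinearMap.pow_mulLeft, hn, LinearMap.mulLeft_zero_eq_zero]
  have hr' : (LinearMap.mulRight F (-a)) ^ n = 0 := by
    rw [LinearMap.pow_mulRight, neg_pow, hn, mul_zero, LinearMap.mulRight_zero_eq_zero]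
  have hneg : -LinearMap.mulRight F a = LinearMap.mulRight F (-a) := by
    ext; simp
  have hn' : (-a) ^ n = 0 := by rw [neg_pow, hn, mul_zero]
  rw [hneg, IsNilpotent.exp_eq_sum hl', IsNilpotent.exp_eq_sum hr', LinearEquiv.coe_coe,
    conjEquiv_apply, hinv, hu, IsNilpotent.exp_eq_sum hn, IsNilpotent.exp_eq_sum hn']
  have h1 : ∀ S : Module.End F V, (∑ i ∈ Finset.range n, ((i.factorial : ℚ)⁻¹) •
      LinearMap.mulLeft F a ^ i) S = (∑ i ∈ Finset.range n, ((i.factorial : ℚ)⁻¹) • a ^ i) * S := by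
    intro S
    simp only [LinearMap.sum_apply, Finset.sum_mul, LinearMap.pow_mulLeft,
      inv_natCast_smul_eq ℚ F, LinearMap.smul_apply, LinearMap.mulLeft_apply, smul_mul_assoc]
  have h2 : ∀ S : Module.End F V, (∑ i ∈ Finset.range n, ((i.factorial : ℚ)⁻¹) •
      LinearMap.mulRight F (-a) ^ i) S = S * (∑ i ∈ Finset.range n, ((i.factorial : ℚ)⁻¹) • (-a) ^ i) := by
    intro S
    simp only [LinearMap.sum_apply, Finset.mul_sum, LinearMap.pow_mulRight,
      inv_natCast_smul_eq ℚ F, LinearMap.smul_apply, LinearMap.mulRight_apply, mul_smul_comm]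
  rw [Module.End.mul_apply, h2, h1, mul_assoc]

end Exp

end Conjugation


/-! ### The even normalizer of a faithful representation -/

section Normalizer

variable {F L V : Type*} [Field F] [AddCommGroup L] [Module F L] [AddCommGroup V] [Module F V]

theorem Superspace.exists_eq_add (𝒱 : Superspace F V) (v : V) :
    ∃ v₀ ∈ 𝒱.part 0, ∃ v₁ ∈ 𝒱.part 1, v₀ + v₁ = v :=
  Submodule.mem_sup.1 (𝒱.isCompl.sup_eq_top ▸ Submodule.mem_top)

theorem Superspace.eq_zero_of_mem (𝒱 : Superspace F V) {i : ZMod 2} {v : V} (h : v ∈ 𝒱.part i)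
    (h' : v ∈ 𝒱.part (i + 1)) : v = 0 := by
  have hd := Submodule.disjoint_def.1 𝒱.isCompl.disjoint v
  have key : i = 0 ∨ i = 1 := by clear h h'; revert i; decide
  rcases key with rfl | rfl
  · exact hd h h'
  · exact hd h' h

variable {𝔤 : LieSuperalgebra F L} {𝒱 : Superspace F V}

namespace LieSuperalgebra.Rep

/-- The even elements of `GL(V)` that normalize the image of the representation. -/
def normalizer (R : 𝔤.Rep 𝒱) : Subgroup (LinearMap.GeneralLinearGroup F V) where
  carrier := {h | (∀ i, ∀ v ∈ 𝒱.part i, (h : Module.End F V) v ∈ 𝒱.part i ∧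
      ((h⁻¹ : LinearMap.GeneralLinearGroup F V) : Module.End F V) v ∈ 𝒱.part i) ∧
    ∀ T ∈ LinearMap.range R.ρ, conjEquiv h T ∈ LinearMap.range R.ρ ∧
      conjEquiv h⁻¹ T ∈ LinearMap.range R.ρ}
  one_mem' := by simp [conjEquiv_apply]
  mul_mem' := by
    rintro a b ⟨ha, ha'⟩ ⟨hb, hb'⟩
    refine ⟨fun i v hv => ⟨?_, ?_⟩, fun T hT => ⟨?_, ?_⟩⟩
    · simpa using (ha i _ (hb i v hv).1).1
    · simpa using (hb i _ (ha i v hv).2).2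
    · simpa [conjEquiv_apply, mul_assoc] using (ha' _ (hb' T hT).1).1
    · simpa [conjEquiv_apply, mul_assoc] using (hb' _ (ha' T hT).2).2
  inv_mem' := by
    rintro a ⟨ha, ha'⟩
    exact ⟨fun i v hv => ⟨(ha i v hv).2, by simpa using (ha i v hv).1⟩,
      fun T hT => ⟨(ha' T hT).2, by simpa using (ha' T hT).1⟩⟩

/-- The conditions on `h⁻¹`, built into `normalizer` so that it is a group in any dimension, follow
from those on `h` by counting dimensions. -/
theorem mem_normalizer_iff [FiniteDimensional F V] {R : 𝔤.Rep 𝒱}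
    {h : LinearMap.GeneralLinearGroup F V} :
    h ∈ R.normalizer ↔ (∀ i, ∀ v ∈ 𝒱.part i, (h : Module.End F V) v ∈ 𝒱.part i) ∧
      ∀ x, conjEquiv h (R.ρ x) ∈ LinearMap.range R.ρ := by
  refine ⟨fun H => ⟨fun i v hv => (H.1 i v hv).1, fun x => (H.2 _ ⟨x, rfl⟩).1⟩, fun H => ?_⟩
  have hT : ∀ T ∈ LinearMap.range R.ρ, conjEquiv h T ∈ LinearMap.range R.ρ := by
    rintro _ ⟨x, rfl⟩
    exact H.2 x
  refine ⟨fun i v hv => ⟨H.1 i v hv, ?_⟩, fun T hT' => ⟨hT T hT', ?_⟩⟩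
  · exact symm_mem_of_forall_mem (LinearMap.GeneralLinearGroup.generalLinearEquiv F V h)
      (S := 𝒱.part i) (H.1 i) v hv
  · have := symm_mem_of_forall_mem (conjEquiv h) hT T hT'
    simpa [conjEquiv_symm_apply, conjEquiv_apply] using this

/-- The superbracket with an even element carries no sign, so it is represented by the ordinary
commutator. -/
theorem adEnd_mem_range (R : 𝔤.Rep 𝒱) {x : L} (hx : x ∈ 𝔤.part 0) :
    ∀ T ∈ LinearMap.range R.ρ, adEnd (R.ρ x) T ∈ LinearMap.range R.ρ := by
  rintro _ ⟨y, rfl⟩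
  obtain ⟨y₀, h₀, y₁, h₁, rfl⟩ := 𝔤.toSuperspace.exists_eq_add y
  refine ⟨𝔤.bracket x y₀ + 𝔤.bracket x y₁, ?_⟩
  rw [map_add, R.map_bracket hx h₀, R.map_bracket hx h₁, adEnd_apply, map_add]
  simp only [superSign, ZMod.val_zero, zero_mul, pow_zero, one_smul, mul_add, add_mul]
  abel

theorem expEven_le_normalizer [FiniteDimensional F V] [CharZero F] (R : 𝔤.Rep 𝒱) :
    R.expEven ≤ R.normalizer := by
  refine (Subgroup.closure_le _).2 ?_
  have hpar : ∀ {x : L}, x ∈ 𝔤.part 0 → ∀ i, ∀ v ∈ 𝒱.part i, R.ρ x v ∈ 𝒱.part i := by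
    intro x hx i v hv
    simpa using R.map_part hx hv
  rintro u (⟨x, hx, hnil, hu⟩ | ⟨x, hx, t, hu⟩)
  · refine mem_normalizer_iff.2 ⟨fun i => ?_, fun y => ?_⟩
    · rw [hu]
      exact nilExp_mem (hpar hx i)
    · have := nilExp_mem (R.adEnd_mem_range hx) (R.ρ y) ⟨y, rfl⟩
      rwa [← conj_nilExp u hnil hu] at this
  · exact mem_normalizer_iff.2 ⟨fun i => hu.mem (hpar hx i),
      fun y => hu.conj.mem (R.adEnd_mem_range hx) (R.ρ y) ⟨y, rfl⟩⟩

/-- The automorphism is `ρ⁻¹ ∘ Ad h ∘ ρ`. Bracket compatibility can be tested after applying the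
injective `ρ`, on homogeneous elements; preservation of the grading comes first, since the sign in
the bracket depends on it. -/
theorem exists_automorphism [FiniteDimensional F V] {R : 𝔤.Rep 𝒱} (hR : Function.Injective R.ρ)
    {h : LinearMap.GeneralLinearGroup F V} (hh : h ∈ R.normalizer) :
    ∃ σ : L ≃ₗ[F] L, 𝔤.IsAutomorphism σ ∧ ∀ x, conjEquiv h (R.ρ x) = R.ρ (σ x) := by
  have hmap := map_eq_of_map_le (conjEquiv h) fun T hT => (hh.2 T hT).1
  let e := LinearEquiv.ofInjective R.ρ hR
  let σ : L ≃ₗ[F] L := e.trans ((((conjEquiv h).submoduleMap (LinearMap.range R.ρ)).trans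
    (LinearEquiv.ofEq _ _ hmap)).trans e.symm)
  have hσ : ∀ x, conjEquiv h (R.ρ x) = R.ρ (σ x) := by
    intro x
    have h1 : e (σ x) = (LinearEquiv.ofEq _ _ hmap)
        ((conjEquiv h).submoduleMap (LinearMap.range R.ρ) (e x)) := e.apply_symm_apply _
    exact (congrArg Subtype.val h1).symm
  have hpart : ∀ i, ∀ x ∈ 𝔤.part i, σ x ∈ 𝔤.part i := by
    intro i x hx
    have hx' : ∀ j, ∀ v ∈ 𝒱.part j, R.ρ (σ x) v ∈ 𝒱.part (i + j) := by
      intro j v hv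
      rw [← hσ, conjEquiv_apply]
      exact (hh.1 _ _ (R.map_part hx (hh.1 j v hv).2)).1
    have key : ∃ y ∈ 𝔤.part i, ∃ z ∈ 𝔤.part (i + 1), y + z = σ x := by
      obtain ⟨y₀, h₀, y₁, h₁, e⟩ := 𝔤.toSuperspace.exists_eq_add (σ x)
      have hi : i = 0 ∨ i = 1 := by clear hx hx'; revert i; decide
      rcases hi with rfl | rfl
      · exact ⟨y₀, h₀, y₁, h₁, e⟩
      · exact ⟨y₁, h₁, y₀, h₀, by rw [add_comm, e]⟩
    obtain ⟨y, hy, z, hz, hyz⟩ := key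
    -- `z` is the component of `σ x` of the wrong parity. Its operator shifts parity both by `i` and
    -- by `i + 1`, hence vanishes.
    have hz0 : R.ρ z = 0 := by
      have h0 : ∀ j, ∀ v ∈ 𝒱.part j, R.ρ z v = 0 := by
        intro j v hv
        refine 𝒱.eq_zero_of_mem (i := i + j) ?_ ?_
        · have e : R.ρ z v = R.ρ (σ x) v - R.ρ y v := by
            rw [← hyz, map_add, LinearMap.add_apply, add_sub_cancel_left]
          rw [e]
          exact sub_mem (hx' j v hv) (R.map_part hy hv)
        · have := R.map_part hz hv
          rwa [add_right_comm] at this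
      refine LinearMap.ext fun v => ?_
      obtain ⟨v₀, h₀, v₁, h₁, rfl⟩ := 𝒱.exists_eq_add v
      rw [map_add, h0 0 v₀ h₀, h0 1 v₁ h₁]
      simp
    have : z = 0 := hR (by rw [hz0, map_zero])
    rw [← hyz, this, add_zero]
    exact hy
  refine ⟨σ, ⟨hpart, ?_⟩, hσ⟩
  have hhom : ∀ i j, ∀ x ∈ 𝔤.part i, ∀ y ∈ 𝔤.part j,
      σ (𝔤.bracket x y) = 𝔤.bracket (σ x) (σ y) := by
    intro i j x hx y hy
    apply hR
    rw [← hσ, R.map_bracket hx hy, R.map_bracket (hpart i x hx) (hpart j y hy), map_sub, map_smul,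
      conjEquiv_mul_apply, conjEquiv_mul_apply, hσ, hσ]
  intro x y
  obtain ⟨x₀, h₀, x₁, h₁, rfl⟩ := 𝔤.toSuperspace.exists_eq_add x
  obtain ⟨y₀, k₀, y₁, k₁, rfl⟩ := 𝔤.toSuperspace.exists_eq_add y
  simp only [map_add, LinearMap.add_apply, hhom _ _ _ h₀ _ k₀, hhom _ _ _ h₀ _ k₁,
    hhom _ _ _ h₁ _ k₀, hhom _ _ _ h₁ _ k₁]

theorem isMaximalGroup_normalizer [FiniteDimensional F V] [CharZero F] {R : 𝔤.Rep 𝒱}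
    (hR : Function.Injective R.ρ) : R.IsMaximalGroup R.normalizer := by
  refine ⟨⟨R.expEven_le_normalizer, fun h hh i v hv => (hh.1 i v hv).1,
    fun h hh => exists_automorphism hR hh⟩, fun H hH h hh => ?_⟩
  refine mem_normalizer_iff.2 ⟨hH.parity h hh, fun x => ?_⟩
  obtain ⟨σ, -, hσ⟩ := hH.conj h hh
  exact ⟨σ x, (hσ x).symm⟩

end LieSuperalgebra.Rep

end Normalizer

/-! ### Almost direct products of commuting groups -/

section AlmostDirect

/-- When the two images commute elementwise, normality and centrality are automatic. -/
theorem IsAlmostDirectProduct.of_commute {Γ H₁ H₂ : Type*} [Group Γ] [Group H₁] [Group H₂]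
    {G : Subgroup Γ} {f₁ : H₁ →* Γ} {f₂ : H₂ →* Γ} (h₁ : Function.Injective f₁)
    (h₂ : Function.Injective f₂) (hc : ∀ a b, Commute (f₁ a) (f₂ b))
    (hG : ∀ g, g ∈ G ↔ ∃ a b, f₁ a * f₂ b = g)
    (hfin : Set.Finite {a | ∃ b, f₁ a = f₂ b}) : IsAlmostDirectProduct G f₁ f₂ where
  injective_left := h₁
  injective_right := h₂
  sup_eq := by
    refine le_antisymm (sup_le ?_ ?_) fun g hg => ?_
    · rintro _ ⟨a, rfl⟩
      exact (hG _).2 ⟨a, 1, by simp⟩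
    · rintro _ ⟨b, rfl⟩
      exact (hG _).2 ⟨1, b, by simp⟩
    · obtain ⟨a, b, rfl⟩ := (hG g).1 hg
      exact mul_mem (Subgroup.mem_sup_left ⟨a, rfl⟩) (Subgroup.mem_sup_right ⟨b, rfl⟩)
  normal_left := by
    rintro g hg _ ⟨x, rfl⟩
    obtain ⟨a, b, rfl⟩ := (hG g).1 hg
    refine ⟨a * x * a⁻¹, ?_⟩
    have := (hc x b).eq
    simp only [map_mul, map_inv, mul_inv_rev, mul_assoc]
    rw [← mul_assoc (f₂ b), ← this]
    simp
  normal_right := by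
    rintro g hg _ ⟨x, rfl⟩
    obtain ⟨a, b, rfl⟩ := (hG g).1 hg
    refine ⟨b * x * b⁻¹, ?_⟩
    have := (hc a (b * x * b⁻¹)).eq
    rw [show f₁ a * f₂ b * f₂ x * (f₁ a * f₂ b)⁻¹ = f₁ a * f₂ (b * x * b⁻¹) * (f₁ a)⁻¹ by
      simp [mul_assoc], this]
    simp
  finite := by
    refine (hfin.image f₁).subset ?_
    rintro _ ⟨⟨a, rfl⟩, ⟨b, hb⟩⟩
    exact ⟨a, ⟨b, hb.symm⟩, rfl⟩
  central := by
    rintro _ ⟨⟨x, rfl⟩, ⟨y, hy⟩⟩ g hg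
    obtain ⟨a, b, rfl⟩ := (hG g).1 hg
    have h1 := (hc x b).eq
    have h2 := (hc a y).eq
    rw [hy] at h2
    rw [← mul_assoc, ← h2, mul_assoc, h1, mul_assoc]

theorem scalarHom_apply {F V : Type*} [Field F] [AddCommGroup V] [Module F V] (c : Fˣ) (v : V) :
    (scalarHom F V c : Module.End F V) v = (c : F) • v := rfl

theorem scalarHom_commute {F V : Type*} [Field F] [AddCommGroup V] [Module F V] (c : Fˣ)
    (g : LinearMap.GeneralLinearGroup F V) : Commute (scalarHom F V c) g := by
  refine Units.ext (LinearMap.ext fun v => ?_)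
  simp [scalarHom_apply]

theorem scalarHom_injective {F V : Type*} [Field F] [AddCommGroup V] [Module F V] [Nontrivial V] :
    Function.Injective (scalarHom F V) := by
  intro a b hab
  obtain ⟨v, hv⟩ := exists_ne (0 : V)
  have := congrArg (fun g : LinearMap.GeneralLinearGroup F V => (g : Module.End F V) v) hab
  exact Units.ext (smul_left_injective F hv this)

theorem finite_setOf_units_pow_eq_one {F : Type*} [Field F] {n : ℕ} (hn : 0 < n) :
    Set.Finite {a : Fˣ | (a : F) ^ n = 1} := by
  have : NeZero n := ⟨hn.ne'⟩
  have h : Set.Finite (rootsOfUnity n F : Set Fˣ) :=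
    Set.finite_coe_iff.1 (inferInstanceAs (Finite (rootsOfUnity n F)))
  refine h.subset fun a ha => ?_
  exact (mem_rootsOfUnity n a).2 (Units.ext (by simpa using ha))

end AlmostDirect


/-! ### Normalizers of Lie superalgebras of block matrices -/

section BlockNormalizer

variable {F : Type*} [Field F] {ι κ : Type*} [Fintype ι] [Fintype κ] [DecidableEq ι] [DecidableEq κ]

theorem coe_glBlock (A : GL ι F) (D : GL κ F) :
    (glBlock F ι κ (A, D) : Module.End F (ι ⊕ κ → F)) =
      Matrix.toLin' (Matrix.fromBlocks (A : Matrix ι ι F) 0 0 (D : Matrix κ κ F)) := rfl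

theorem glBlock_injective : Function.Injective (glBlock F ι κ) := by
  rintro ⟨A, D⟩ ⟨A', D'⟩ h
  have h1 := congrArg Units.val h
  rw [coe_glBlock, coe_glBlock] at h1
  have h2 := Matrix.fromBlocks_inj.1 (Matrix.toLin'.injective h1)
  exact Prod.ext (Units.ext h2.1) (Units.ext h2.2.2.2)

theorem conjEquiv_glBlock (A : GL ι F) (D : GL κ F) (a : Matrix ι ι F) (b : Matrix ι κ F)
    (c : Matrix κ ι F) (d : Matrix κ κ F) :
    conjEquiv (glBlock F ι κ (A, D)) (Matrix.toLin' (Matrix.fromBlocks a b c d)) =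
      Matrix.toLin' (Matrix.fromBlocks (A.val * a * A⁻¹.val) (A.val * b * D⁻¹.val)
        (D.val * c * A⁻¹.val) (D.val * d * D⁻¹.val)) := by
  rw [conjEquiv_apply, ← map_inv, Prod.inv_mk, coe_glBlock, coe_glBlock, Module.End.mul_eq_comp,
    Module.End.mul_eq_comp, ← Matrix.toLin'_mul, ← Matrix.toLin'_mul, Matrix.fromBlocks_multiply,
    Matrix.fromBlocks_multiply]
  simp

theorem mem_blockSpace_self {p : ZMod 2} {v : ι ⊕ κ → F} :
    v ∈ (blockSpace F ι κ p).part p ↔ ∀ k, v (Sum.inr k) = 0 := by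
  simp only [blockSpace, if_true]
  exact ⟨fun h k => congrFun h k, fun h => funext h⟩

theorem mem_blockSpace_add_one {p : ZMod 2} {v : ι ⊕ κ → F} :
    v ∈ (blockSpace F ι κ p).part (p + 1) ↔ ∀ k, v (Sum.inl k) = 0 := by
  have h : ¬ (p + 1 = p) := by simp
  simp only [blockSpace, if_neg h]
  exact ⟨fun h k => congrFun h k, fun h => funext h⟩

theorem eq_or_eq_add_one (i p : ZMod 2) : i = p ∨ i = p + 1 := by
  revert i p; decide

theorem toMatrix_eq_fromBlocks {p : ZMod 2} {T : Module.End F (ι ⊕ κ → F)}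
    (h : ∀ i, ∀ v ∈ (blockSpace F ι κ p).part i, T v ∈ (blockSpace F ι κ p).part i) :
    ∃ A D, T = Matrix.toLin' (Matrix.fromBlocks A 0 0 D) := by
  refine ⟨(LinearMap.toMatrix' T).toBlocks₁₁, (LinearMap.toMatrix' T).toBlocks₂₂, ?_⟩
  apply LinearMap.toMatrix'.injective
  rw [LinearMap.toMatrix'_toLin']
  conv_lhs => rw [← Matrix.fromBlocks_toBlocks (LinearMap.toMatrix' T)]
  congr 1
  · ext i j
    have := mem_blockSpace_add_one.1 (h (p + 1) (Pi.single (Sum.inr j) 1)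
      (mem_blockSpace_add_one.2 fun k => by simp)) i
    simpa [Matrix.toBlocks₁₂, LinearMap.toMatrix'_apply] using this
  · ext i j
    have := mem_blockSpace_self.1 (h p (Pi.single (Sum.inl j) 1)
      (mem_blockSpace_self.2 fun k => by simp)) i
    simpa [Matrix.toBlocks₂₁, LinearMap.toMatrix'_apply] using this

variable {p : ZMod 2} {g : Submodule F (Matrix (ι ⊕ κ) (ι ⊕ κ) F)} {hgr : ∀ x ∈ g, evenBlock x ∈ g}
  {hbr : ∀ x ∈ g, ∀ y ∈ g, superBracket x y ∈ g}

theorem LieSuperalgebra.Rep.ofBlocks_injective :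
    Function.Injective (LieSuperalgebra.Rep.ofBlocks p g hgr hbr).ρ :=
  Matrix.toLin'.injective.comp Subtype.val_injective

/-- Reduces every block case to a question about pairs `(A, D)` of invertible matrices: parity kills
the off-diagonal blocks of `h`, and conjugation acts on the four blocks separately. -/
theorem mem_normalizer_ofBlocks_iff {h : LinearMap.GeneralLinearGroup F (ι ⊕ κ → F)} :
    h ∈ (LieSuperalgebra.Rep.ofBlocks p g hgr hbr).normalizer ↔
      ∃ (A : GL ι F) (D : GL κ F), glBlock F ι κ (A, D) = h ∧
        ∀ a b c d, Matrix.fromBlocks a b c d ∈ g →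
          Matrix.fromBlocks (A.val * a * A⁻¹.val) (A.val * b * D⁻¹.val)
            (D.val * c * A⁻¹.val) (D.val * d * D⁻¹.val) ∈ g := by
  have hrange : ∀ {T : Matrix (ι ⊕ κ) (ι ⊕ κ) F}, Matrix.toLin' T ∈
      LinearMap.range (LieSuperalgebra.Rep.ofBlocks p g hgr hbr).ρ ↔ T ∈ g := by
    intro T
    refine ⟨?_, fun hT => ⟨⟨T, hT⟩, rfl⟩⟩
    rintro ⟨x, hx⟩
    rw [← Matrix.toLin'.injective hx]
    exact x.2
  constructor
  · intro hh
    obtain ⟨A, D, hAD⟩ := toMatrix_eq_fromBlocks fun i v hv => (hh.1 i v hv).1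
    -- The inverse is block diagonal too, and its blocks provide the inverses of `A` and `D`.
    obtain ⟨A', D', hAD'⟩ := toMatrix_eq_fromBlocks fun i v hv => (hh.1 i v hv).2
    have h1 := h.mul_inv
    have h2 := h.inv_mul
    have hone : (1 : Module.End F (ι ⊕ κ → F)) = Matrix.toLin' (Matrix.fromBlocks 1 0 0 1) := by
      rw [Matrix.fromBlocks_one, Matrix.toLin'_one, Module.End.one_eq_id]
    rw [hAD, hAD', Module.End.mul_eq_comp, ← Matrix.toLin'_mul, Matrix.fromBlocks_multiply, hone] at h1 h2
    have k1 := Matrix.fromBlocks_inj.1 (Matrix.toLin'.injective h1)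
    have k2 := Matrix.fromBlocks_inj.1 (Matrix.toLin'.injective h2)
    simp only [Matrix.mul_zero, add_zero, zero_add] at k1 k2
    have hE : glBlock F ι κ (⟨A, A', k1.1, k2.1⟩, ⟨D, D', k1.2.2.2, k2.2.2.2⟩) = h :=
      Units.ext hAD.symm
    refine ⟨_, _, hE, fun a b c d hg => ?_⟩
    rw [← hrange, ← conjEquiv_glBlock, hE]
    exact (hh.2 _ (hrange.2 hg)).1
  · rintro ⟨A, D, rfl, hg⟩
    refine LieSuperalgebra.Rep.mem_normalizer_iff.2 ⟨fun i v hv => ?_, fun x => ?_⟩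
    · rw [coe_glBlock, Matrix.toLin'_apply]
      rcases eq_or_eq_add_one i p with rfl | rfl
      · rw [mem_blockSpace_self] at hv ⊢
        intro k
        simp [Matrix.mulVec, dotProduct, hv]
      · rw [mem_blockSpace_add_one] at hv ⊢
        intro k
        simp [Matrix.mulVec, dotProduct, hv]
    · have hx : (LieSuperalgebra.Rep.ofBlocks p g hgr hbr).ρ x = Matrix.toLin' (Matrix.fromBlocks
          x.1.toBlocks₁₁ x.1.toBlocks₁₂ x.1.toBlocks₂₁ x.1.toBlocks₂₂) := by
        rw [Matrix.fromBlocks_toBlocks]; rfl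
      rw [hx, conjEquiv_glBlock, hrange]
      exact hg _ _ _ _ (by rw [Matrix.fromBlocks_toBlocks]; exact x.2)

theorem scalarHom_mul_glBlock_eq_iff {c : Fˣ} {A A' : GL ι F} {D D' : GL κ F} :
    scalarHom F (ι ⊕ κ → F) c * glBlock F ι κ (A, D) = glBlock F ι κ (A', D') ↔
      (c : F) • A.val = A'.val ∧ (c : F) • D.val = D'.val := by
  rw [Units.ext_iff, Units.val_mul, coe_glBlock, coe_glBlock]
  have : (scalarHom F (ι ⊕ κ → F) c : Module.End F (ι ⊕ κ → F)) *
      Matrix.toLin' (Matrix.fromBlocks A.val 0 0 D.val) =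
      Matrix.toLin' (Matrix.fromBlocks ((c : F) • A.val) 0 0 ((c : F) • D.val)) := by
    have e : Matrix.fromBlocks ((c : F) • A.val) 0 0 ((c : F) • D.val) =
        (c : F) • Matrix.fromBlocks A.val 0 0 D.val := by
      rw [Matrix.fromBlocks_smul, smul_zero, smul_zero]
    rw [e, map_smul]
    rfl
  rw [this, Matrix.toLin'.injective.eq_iff, Matrix.fromBlocks_inj]
  simp

/-- An almost direct product of the scalars and a group embedded in the block diagonal matrices. -/
theorem IsAlmostDirectProduct.of_block [Nonempty (ι ⊕ κ)] {H : Type*} [Group H] (f : H →* GL ι F × GL κ F)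
    (hf : Function.Injective f) {G : Subgroup (LinearMap.GeneralLinearGroup F (ι ⊕ κ → F))}
    {m : ℕ} (hm : 0 < m)
    (hG : ∀ h, h ∈ G ↔ ∃ A D, glBlock F ι κ (A, D) = h ∧ ∃ (c : Fˣ) (x : H),
      (c : F) • (f x).1.val = A.val ∧ (c : F) • (f x).2.val = D.val)
    (hfin : ∀ (c : Fˣ) (x : H), (f x).1.val = (c : F) • (1 : Matrix ι ι F) →
      (f x).2.val = (c : F) • (1 : Matrix κ κ F) → (c : F) ^ m = 1) :
    IsAlmostDirectProduct G (scalarHom F (ι ⊕ κ → F)) ((glBlock F ι κ).comp f) := by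
  refine .of_commute scalarHom_injective (glBlock_injective.comp hf)
    (fun a b => scalarHom_commute _ _) (fun h => ?_) ?_
  · rw [hG]
    constructor
    · rintro ⟨A, D, rfl, c, x, hc⟩
      exact ⟨c, x, scalarHom_mul_glBlock_eq_iff.2 hc⟩
    · rintro ⟨c, x, rfl⟩
      refine ⟨c • (f x).1, c • (f x).2, ?_, c, x, rfl, rfl⟩
      exact (scalarHom_mul_glBlock_eq_iff.2 ⟨rfl, rfl⟩).symm
  · refine (finite_setOf_units_pow_eq_one hm).subset ?_
    rintro c ⟨x, hx⟩
    have h1 : scalarHom F (ι ⊕ κ → F) c * glBlock F ι κ (1, 1) =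
        glBlock F ι κ ((f x).1, (f x).2) := by
      rw [← Prod.one_eq_mk, map_one, mul_one]; exact hx
    have h2 := scalarHom_mul_glBlock_eq_iff.1 h1
    exact hfin c x (by simpa using h2.1.symm) (by simpa using h2.2.symm)

end BlockNormalizer

/-! ### `sl(m, n)` -/

/-- The supertrace sees only the traces of the diagonal blocks, which conjugation by `A` and `D`
leaves unchanged. -/
theorem normalizer_slSuper (F : Type*) [Field F] (m n : ℕ) :
    (slSuper F m n).normalizer = (glBlock F (Fin m) (Fin n)).range := by
  refine Subgroup.ext fun h => ?_
  rw [slSuper, mem_normalizer_ofBlocks_iff]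
  constructor
  · rintro ⟨A, D, hAD, -⟩
    exact ⟨(A, D), hAD⟩
  · rintro ⟨⟨A, D⟩, hAD⟩
    refine ⟨A, D, hAD, fun a b c d hg => ?_⟩
    change Matrix.trace _ - Matrix.trace _ = 0 at hg
    change Matrix.trace _ - Matrix.trace _ = 0
    simp only [Matrix.toBlocks_fromBlocks₁₁, Matrix.toBlocks_fromBlocks₂₂] at hg ⊢
    rwa [Matrix.trace_mul_comm (_ * _), Matrix.trace_mul_comm (_ * _), ← mul_assoc, ← mul_assoc,
      Units.inv_mul, Units.inv_mul, one_mul, one_mul]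

/-! ### `spo(2k, n)` -/

section SPO

theorem eq_smul_one_of_commute_single {F ι : Type*} [Field F] [Fintype ι] [DecidableEq ι]
    {N : Matrix ι ι F} (h : ∀ i j, i ≠ j → Commute (Matrix.single i j 1) N) :
    ∃ μ : F, N = μ • 1 := by
  obtain ⟨μ, hμ⟩ := Matrix.mem_range_scalar_of_commute_single (M := N) (fun i j hij => h i j hij)
  exact ⟨μ, by rw [← hμ, Matrix.scalar_apply, Matrix.smul_one_eq_diagonal]⟩

variable {F : Type*} [Field F]

/-- For `i ≠ j` the matrix unit `E_ij` is the product of the symmetric matrices `E_ii` and `E_ij +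
E_ji`. -/
theorem eq_smul_one_of_commute_symm {ι : Type*} [Fintype ι] [DecidableEq ι]
    {N : Matrix ι ι F} (h : ∀ s : Matrix ι ι F, s.transpose = s → Commute s N) :
    ∃ μ : F, N = μ • 1 := by
  refine eq_smul_one_of_commute_single fun i j hij => ?_
  have h1 := h (Matrix.single i i 1) (by simp)
  have h2 := h (Matrix.single i j 1 + Matrix.single j i 1) (by simp [add_comm])
  have h3 := h1.mul_left h2
  simpa [mul_add, Matrix.single_mul_single_of_ne, hij] using h3

/-- Every `J s` with `s` symmetric lies in `sp`. Putting `K = AᵀJA`, the hypothesis on these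
elements makes `KJ` commute with every symmetric matrix, so `KJ` is scalar and `K` is a multiple of
`J`. -/
theorem exists_symplectic_multiplier {k : ℕ} {A A' : Matrix (Fin k ⊕ Fin k) (Fin k ⊕ Fin k) F}
    (hA : A' * A = 1) (h : ∀ a ∈ LieAlgebra.Symplectic.sp (Fin k) F,
      A * a * A' ∈ LieAlgebra.Symplectic.sp (Fin k) F) :
    ∃ μ : F, A.transpose * Matrix.J (Fin k) F * A = μ • Matrix.J (Fin k) F := by
  set J := Matrix.J (Fin k) F with hJ
  have hJJ : J * J = -1 := Matrix.J_squared _ _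
  have hJt : J.transpose = -J := Matrix.J_transpose _ _
  have hAt : A.transpose * A'.transpose = 1 := by
    rw [← Matrix.transpose_mul, hA, Matrix.transpose_one]
  set K := A.transpose * J * A with hK
  have hKt : K.transpose = -K := by
    simp [hK, Matrix.transpose_mul, hJt, Matrix.mul_assoc]
  have key : ∀ s : Matrix (Fin k ⊕ Fin k) (Fin k ⊕ Fin k) F, s.transpose = s →
      s * (J * K) = K * J * s := by
    intro s hs
    have h1 : J * s ∈ LieAlgebra.Symplectic.sp (Fin k) F := by
      rw [mem_sp_iff, ← hJ, Matrix.transpose_mul, hs, hJt, mul_assoc, neg_mul, hJJ, ← mul_assoc, hJJ]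
      simp
    have h2 := h _ h1
    rw [mem_sp_iff, ← hJ] at h2
    have h3 := congrArg (fun X => A.transpose * X * A) h2
    simp only [Matrix.transpose_mul, hs, hJt] at h3
    calc s * (J * K) = -((A.transpose * A'.transpose) * (s * -J * A.transpose) * J * A) := by
          rw [hAt, hK]; noncomm_ring
      _ = -(A.transpose * (A'.transpose * (s * -J * A.transpose)) * J * A) := by noncomm_ring
      _ = A.transpose * J * A * (J * s) * (A' * A) := by
          rw [← neg_inj, neg_neg]
          have e : A.transpose * (A'.transpose * (s * -J * A.transpose)) * J * A =
            A.transpose * (A'.transpose * (s * -J * A.transpose) * J) * A := by noncomm_ring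
          rw [e]
          have h4 : A'.transpose * (s * -J * A.transpose) * J = -(J * (A * (J * s) * A')) := by
            rw [← h2]; simp [Matrix.transpose_mul, hs, hJt, mul_assoc]
          rw [h4]; noncomm_ring
      _ = K * J * s := by rw [hA, hK]; noncomm_ring
  -- The case `s = 1` identifies the two sides, turning `key` into a genuine commutation relation.
  have hsym : J * K = K * J := by simpa using key 1 (by simp)
  obtain ⟨μ, hμ⟩ := eq_smul_one_of_commute_symm (N := K * J) fun s hs => by
    have := key s hs
    rwa [hsym] at this
  refine ⟨-μ, ?_⟩
  have h5 := congrArg (fun X => X * J) hμ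
  simp only [mul_assoc, hJJ, Matrix.smul_mul, one_mul] at h5
  rw [neg_smul, ← h5]
  simp

/-- `K = DᵀD` commutes with all skew matrices. Its symmetry is needed as well: for `n = 2` the skew
matrices alone have a commutant larger than the scalars. -/
theorem exists_orthogonal_multiplier [CharZero F] {n : ℕ} {D D' : Matrix (Fin n) (Fin n) F}
    (hD : D' * D = 1) (h : ∀ d ∈ LieAlgebra.Orthogonal.so (Fin n) F,
      D * d * D' ∈ LieAlgebra.Orthogonal.so (Fin n) F) :
    ∃ μ : F, D.transpose * D = μ • (1 : Matrix (Fin n) (Fin n) F) := by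
  have hDt : D.transpose * D'.transpose = 1 := by
    rw [← Matrix.transpose_mul, hD, Matrix.transpose_one]
  set K := D.transpose * D with hK
  have hKt : K.transpose = K := by simp [hK, Matrix.transpose_mul]
  have key : ∀ X : Matrix (Fin n) (Fin n) F, X.transpose = -X → X * K = K * X := by
    intro X hX
    have h2 := h X ((LieAlgebra.Orthogonal.mem_so _ _ _).2 hX)
    rw [LieAlgebra.Orthogonal.mem_so, Matrix.transpose_mul, Matrix.transpose_mul, hX] at h2
    calc X * K = -((D.transpose * D'.transpose) * (-X * D.transpose) * D) := by
          rw [hDt, hK]; noncomm_ring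
      _ = -(D.transpose * (D'.transpose * (-X * D.transpose)) * D) := by noncomm_ring
      _ = D.transpose * D * X * (D' * D) := by rw [h2]; noncomm_ring
      _ = K * X := by rw [hD, hK]; noncomm_ring
  rcases n with _ | n
  · exact ⟨0, Subsingleton.elim _ _⟩
  have hent : ∀ i j, i ≠ j → K i i = K j j ∧ K i j = 0 := by
    intro i j hij
    have h1 := key (Matrix.single i j 1 - Matrix.single j i 1) (by simp)
    have h2 := congrFun (congrFun h1 i) j
    have h3 := congrFun (congrFun h1 i) i
    simp [sub_mul, mul_sub, hij, hij.symm] at h2 h3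
    -- The `(i, i)` entry of the relation says `K j i = -K i j`, so symmetry and characteristic zero
    -- give zero.
    have h4 : K j i = K i j := congrFun (congrFun hKt i) j
    rw [h4] at h3
    exact ⟨h2.symm, by simpa using (self_eq_neg.1 h3)⟩
  refine ⟨K 0 0, ?_⟩
  ext i j
  by_cases hij : i = j
  · subst hij
    by_cases hi : i = 0
    · simp [hi]
    · simp [(hent i 0 hi).1]
  · simp [hij, (hent i j hij).2]

end SPO


/-! ### The normalizer of `spo(2k, n)`: similitudes with a common multiplier. -/

section SPOMax

variable {F : Type*} [Field F] {k n : ℕ}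

theorem fromBlocks_mem_spo_iff {a : Matrix (Fin k ⊕ Fin k) (Fin k ⊕ Fin k) F}
    {b : Matrix (Fin k ⊕ Fin k) (Fin n) F} {c : Matrix (Fin n) (Fin k ⊕ Fin k) F}
    {d : Matrix (Fin n) (Fin n) F} :
    Matrix.fromBlocks a b c d ∈ spoSubmodule F k n ↔
      a ∈ LieAlgebra.Symplectic.sp (Fin k) F ∧ d ∈ LieAlgebra.Orthogonal.so (Fin n) F ∧
        c = b.transpose * Matrix.J (Fin k) F := by
  constructor
  · rintro ⟨a', ha, d', hd, b', h⟩
    obtain ⟨rfl, rfl, rfl, rfl⟩ := Matrix.fromBlocks_inj.1 h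
    exact ⟨ha, hd, rfl⟩
  · rintro ⟨ha, hd, rfl⟩
    exact ⟨a, ha, d, hd, b, rfl⟩

/-- The two even blocks give multipliers `μ` and `ν` separately. If one block is empty, the other
multiplier serves for both; otherwise the relation `c = bᵀJ` on the odd part ties them together. -/
theorem exists_common_multiplier [CharZero F] (hkn : 0 < 2 * k + n) {A : GL (Fin k ⊕ Fin k) F}
    {D : GL (Fin n) F}
    (h : ∀ a b c d, Matrix.fromBlocks a b c d ∈ spoSubmodule F k n →
      Matrix.fromBlocks (A.val * a * A⁻¹.val) (A.val * b * D⁻¹.val)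
        (D.val * c * A⁻¹.val) (D.val * d * D⁻¹.val) ∈ spoSubmodule F k n) :
    ∃ μ : Fˣ, A.val.transpose * Matrix.J (Fin k) F * A.val = (μ : F) • Matrix.J (Fin k) F ∧
      D.val.transpose * D.val = (μ : F) • (1 : Matrix (Fin n) (Fin n) F) := by
  obtain ⟨μ, hμ⟩ := exists_symplectic_multiplier A.inv_mul fun a ha =>
    (fromBlocks_mem_spo_iff.1 (h a 0 0 0 (fromBlocks_mem_spo_iff.2 ⟨ha, zero_mem _, by simp⟩))).1
  obtain ⟨ν, hν⟩ := exists_orthogonal_multiplier D.inv_mul fun d hd =>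
    (fromBlocks_mem_spo_iff.1 (h 0 0 0 d (fromBlocks_mem_spo_iff.2 ⟨zero_mem _, hd, by simp⟩))).2.1
  have hJJ : Matrix.J (Fin k) F * Matrix.J (Fin k) F = -1 := Matrix.J_squared _ _
  rcases Nat.eq_zero_or_pos n with rfl | hn
  · have : Nonempty (Fin k) := ⟨⟨0, by omega⟩⟩
    have hμ0 : μ ≠ 0 := by
      rintro rfl
      have h1 : (A.val.transpose * Matrix.J (Fin k) F * A.val) = 0 := by rw [hμ, zero_smul]
      have h2 : A⁻¹.val.transpose * (A.val.transpose * Matrix.J (Fin k) F * A.val) * A⁻¹.val = 0 := by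
        rw [h1]; simp
      have h3 : A⁻¹.val.transpose * A.val.transpose = 1 := by
        rw [← Matrix.transpose_mul, A.mul_inv, Matrix.transpose_one]
      have h4 : Matrix.J (Fin k) F = 0 := by
        rw [← h2]
        calc Matrix.J (Fin k) F = (A⁻¹.val.transpose * A.val.transpose) * Matrix.J (Fin k) F *
              (A.val * A⁻¹.val) := by rw [h3, A.mul_inv]; simp
          _ = _ := by simp only [mul_assoc]
      rw [h4, zero_mul] at hJJ
      exact one_ne_zero (neg_eq_zero.1 hJJ.symm)
    exact ⟨Units.mk0 μ hμ0, hμ, Subsingleton.elim _ _⟩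
  · have : Nonempty (Fin n) := ⟨⟨0, hn⟩⟩
    have hν0 : ν ≠ 0 := by
      rintro rfl
      have h3 : D⁻¹.val.transpose * D.val.transpose = 1 := by
        rw [← Matrix.transpose_mul, D.mul_inv, Matrix.transpose_one]
      have h4 : (1 : Matrix (Fin n) (Fin n) F) = 0 := by
        calc (1 : Matrix (Fin n) (Fin n) F) =
              (D⁻¹.val.transpose * D.val.transpose) * (D.val * D⁻¹.val) := by
              rw [h3, D.mul_inv, one_mul]
          _ = D⁻¹.val.transpose * (D.val.transpose * D.val) * D⁻¹.val := by simp only [mul_assoc]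
          _ = 0 := by rw [hν]; simp
      exact one_ne_zero h4
    refine ⟨Units.mk0 ν hν0, ?_, hν⟩
    rcases Nat.eq_zero_or_pos k with rfl | hk
    · exact Subsingleton.elim _ _
    have hodd : ∀ b : Matrix (Fin k ⊕ Fin k) (Fin n) F, ν • (b.transpose * Matrix.J (Fin k) F) =
        μ • (b.transpose * Matrix.J (Fin k) F) := by
      intro b
      have h1 := (fromBlocks_mem_spo_iff.1 (h 0 b _ 0
        (fromBlocks_mem_spo_iff.2 ⟨zero_mem _, zero_mem _, rfl⟩))).2.2
      have h2 : D.val.transpose * D⁻¹.val.transpose = 1 := by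
        rw [← Matrix.transpose_mul, D.inv_mul, Matrix.transpose_one]
      calc ν • (b.transpose * Matrix.J (Fin k) F)
          = D.val.transpose * D.val * (b.transpose * Matrix.J (Fin k) F) * (A⁻¹.val * A.val) := by
            rw [hν, A.inv_mul]; simp
        _ = D.val.transpose * (D.val * (b.transpose * Matrix.J (Fin k) F) * A⁻¹.val) * A.val := by
            simp only [Matrix.mul_assoc]
        _ = (D.val.transpose * D⁻¹.val.transpose) * b.transpose *
              (A.val.transpose * Matrix.J (Fin k) F * A.val) := by
            rw [h1]; simp only [Matrix.transpose_mul, Matrix.mul_assoc]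
        _ = _ := by rw [h2, hμ]; simp
    -- A single matrix unit is a sufficient test; cancelling `J` through `J² = -1` leaves the entry
    -- that compares `ν` with `μ`.
    have h5 := hodd (Matrix.single (Sum.inl ⟨0, hk⟩) ⟨0, hn⟩ 1)
    have h6 := congrArg (fun X => X * Matrix.J (Fin k) F) h5
    simp only [Matrix.smul_mul, Matrix.mul_assoc, hJJ] at h6
    have h7 := congrFun (congrFun h6 ⟨0, hn⟩) (Sum.inl ⟨0, hk⟩)
    simp at h7
    rw [Units.val_mk0, h7, hμ]

/-- A common multiplier rescales the whole form, and the equations defining the algebra are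
homogeneous in the form. -/
theorem conj_mem_spo {A : GL (Fin k ⊕ Fin k) F} {D : GL (Fin n) F} {μ : F} (hμ : μ ≠ 0)
    (hA : A.val.transpose * Matrix.J (Fin k) F * A.val = μ • Matrix.J (Fin k) F)
    (hD : D.val.transpose * D.val = μ • (1 : Matrix (Fin n) (Fin n) F))
    {a : Matrix (Fin k ⊕ Fin k) (Fin k ⊕ Fin k) F}
    {b : Matrix (Fin k ⊕ Fin k) (Fin n) F} {c : Matrix (Fin n) (Fin k ⊕ Fin k) F}
    {d : Matrix (Fin n) (Fin n) F} (h : Matrix.fromBlocks a b c d ∈ spoSubmodule F k n) :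
    Matrix.fromBlocks (A.val * a * A⁻¹.val) (A.val * b * D⁻¹.val)
        (D.val * c * A⁻¹.val) (D.val * d * D⁻¹.val) ∈ spoSubmodule F k n := by
  obtain ⟨ha, hd, rfl⟩ := fromBlocks_mem_spo_iff.1 h
  rw [mem_sp_iff] at ha
  rw [LieAlgebra.Orthogonal.mem_so] at hd
  have hAt : A⁻¹.val.transpose * A.val.transpose = 1 := by
    rw [← Matrix.transpose_mul, A.mul_inv, Matrix.transpose_one]
  have hDt : D⁻¹.val.transpose * D.val.transpose = 1 := by
    rw [← Matrix.transpose_mul, D.mul_inv, Matrix.transpose_one]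
  have h1 : A.val.transpose * Matrix.J (Fin k) F = μ • (Matrix.J (Fin k) F * A⁻¹.val) := by
    rw [← Matrix.smul_mul, ← hA, mul_assoc, A.mul_inv, mul_one]
  have h2 : Matrix.J (Fin k) F * A.val = μ • (A⁻¹.val.transpose * Matrix.J (Fin k) F) := by
    rw [← Matrix.mul_smul, ← hA, ← mul_assoc, ← mul_assoc, hAt, one_mul]
  have h3 : D.val.transpose = μ • D⁻¹.val := by
    calc D.val.transpose = D.val.transpose * D.val * D⁻¹.val := by
          rw [mul_assoc, D.mul_inv, mul_one]
      _ = _ := by rw [hD]; simp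
  have h4 : D⁻¹.val.transpose = μ⁻¹ • D.val := by
    have : D.val = μ • D⁻¹.val.transpose := by
      calc D.val = D⁻¹.val.transpose * D.val.transpose * D.val := by rw [hDt, one_mul]
        _ = _ := by rw [mul_assoc, hD]; simp
    rw [eq_inv_smul_iff₀ hμ, ← this]
  refine fromBlocks_mem_spo_iff.2 ⟨?_, ?_, ?_⟩
  · rw [mem_sp_iff]
    simp only [Matrix.transpose_mul, Matrix.mul_assoc, h1, Matrix.mul_smul]
    rw [← Matrix.mul_assoc (Matrix.J (Fin k) F) A.val, h2, ← Matrix.mul_assoc a.transpose, ha]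
    simp [Matrix.mul_assoc]
  · rw [LieAlgebra.Orthogonal.mem_so]
    simp only [Matrix.transpose_mul, Matrix.mul_assoc, h3, h4, hd, Matrix.mul_smul, Matrix.smul_mul,
      smul_neg, smul_smul, mul_inv_cancel₀ hμ, one_smul, Matrix.neg_mul, Matrix.mul_neg]
  · simp only [Matrix.transpose_mul, Matrix.mul_assoc, h1, h4, Matrix.mul_smul, Matrix.smul_mul,
      smul_smul, inv_mul_cancel₀ hμ, one_smul]

end SPOMax

section SPOGroup

attribute [local instance] starRingOfComm

theorem isAlmostDirectProduct_spo {F : Type*} [Field F] [CharZero F] [IsAlgClosed F] {k n : ℕ}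
    (hkn : 0 < 2 * k + n) :
    IsAlmostDirectProduct (spo F k n).normalizer (scalarHom F _) (spoGroup F k n) := by
  have : Nonempty ((Fin k ⊕ Fin k) ⊕ Fin n) := by
    rcases Nat.eq_zero_or_pos n with rfl | hn
    · exact ⟨Sum.inl (Sum.inl ⟨0, by omega⟩)⟩
    · exact ⟨Sum.inr ⟨0, hn⟩⟩
  refine IsAlmostDirectProduct.of_block _ ?_ (m := 2) (by norm_num) (fun h => ?_) ?_
  · rintro ⟨A, D⟩ ⟨A', D'⟩ h
    have h1 := congrArg (fun x => x.1.val) h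
    have h2 := congrArg (fun x => x.2.val) h
    exact Prod.ext (Subtype.ext h1) (Subtype.ext h2)
  · rw [spo, mem_normalizer_ofBlocks_iff]
    refine exists_congr fun A => exists_congr fun D => and_congr_right fun _ => ?_
    constructor
    · intro H
      obtain ⟨μ, hA, hD⟩ := exists_common_multiplier hkn H
      -- Dividing by a square root of the multiplier turns similitudes into isometries.
      obtain ⟨c, hc⟩ := IsAlgClosed.exists_pow_nat_eq (μ : F) (n := 2) (by norm_num)
      have hc0 : c ≠ 0 := by
        rintro rfl
        exact μ.ne_zero (by rw [← hc]; norm_num)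
      have hcc : c⁻¹ * (c⁻¹ * (μ : F)) = 1 := by
        rw [← hc]; field_simp
      refine ⟨Units.mk0 c hc0, (⟨c⁻¹ • A.val, ?_⟩, ⟨c⁻¹ • D.val, ?_⟩), ?_, ?_⟩
      · rw [SymplecticGroup.mem_iff']
        simp only [Matrix.transpose_smul, Matrix.smul_mul, Matrix.mul_smul, hA, smul_smul, hcc,
          one_smul]
      · rw [Matrix.mem_orthogonalGroup_iff']
        simp only [Matrix.transpose_smul, Matrix.smul_mul, Matrix.mul_smul, hD, smul_smul, hcc, one_smul]
      · exact smul_inv_smul₀ hc0 _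
      · exact smul_inv_smul₀ hc0 _
    · rintro ⟨c, ⟨⟨S, hS⟩, ⟨O, hO⟩⟩, hA, hD⟩ a b c' d H
      rw [SymplecticGroup.mem_iff'] at hS
      rw [Matrix.mem_orthogonalGroup_iff'] at hO
      replace hA : (c : F) • S = A.val := hA
      replace hD : (c : F) • O = D.val := hD
      refine conj_mem_spo (μ := (c : F) * c) (mul_ne_zero c.ne_zero c.ne_zero) ?_ ?_ H
      · rw [← hA]
        simp only [Matrix.transpose_smul, Matrix.smul_mul, Matrix.mul_smul, hS, smul_smul]
      · rw [← hD]
        simp only [Matrix.transpose_smul, Matrix.smul_mul, Matrix.mul_smul, hO, smul_smul]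
  · rintro c ⟨⟨S, hS⟩, ⟨O, hO⟩⟩ h1 h2
    rw [SymplecticGroup.mem_iff'] at hS
    rw [Matrix.mem_orthogonalGroup_iff'] at hO
    replace h1 : S = (c : F) • 1 := h1
    replace h2 : O = (c : F) • 1 := h2
    -- A scalar isometry satisfies `c² = 1`, read off from an entry of `J` when `n = 0` and of the
    -- identity otherwise.
    rcases Nat.eq_zero_or_pos n with rfl | hn
    · have hk : 0 < k := by omega
      rw [h1] at hS
      have := congrFun (congrFun hS (Sum.inr ⟨0, hk⟩)) (Sum.inl ⟨0, hk⟩)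
      simp [Matrix.J] at this
      rw [sq]; exact this
    · rw [h2] at hO
      have := congrFun (congrFun hO ⟨0, hn⟩) ⟨0, hn⟩
      simp at this
      rw [sq]; exact this

end SPOGroup


/-! ### `P_n` and `P̂_4` -/

section Dual

variable {F : Type*} [Field F]

/-- `GL_n` embedded in `GL_n × GL_n` by `A ↦ (A, (A⁻¹)ᵀ)`. -/
def dualPair (F : Type*) [Field F] (n : ℕ) : GL (Fin n) F →* GL (Fin n) F × GL (Fin n) F where
  toFun A := (A, ⟨A⁻¹.val.transpose, A.val.transpose,
    by rw [← Matrix.transpose_mul, A.mul_inv, Matrix.transpose_one],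
    by rw [← Matrix.transpose_mul, A.inv_mul, Matrix.transpose_one]⟩)
  map_one' := by
    refine Prod.ext rfl (Units.ext ?_)
    simp
  map_mul' A B := by
    refine Prod.ext rfl (Units.ext ?_)
    simp only [mul_inv_rev, Units.val_mul, Matrix.transpose_mul, Prod.mk_mul_mk]

theorem glDual_eq (n : ℕ) : glDual F n = (glBlock F (Fin n) (Fin n)).comp (dualPair F n) :=
  MonoidHom.ext fun _ => Units.ext rfl

theorem dualPair_injective (n : ℕ) : Function.Injective (dualPair F n) :=
  fun _ _ h => congrArg Prod.fst h

/-- The hypothesis says that `AᵀD` commutes with the transpose of every traceless matrix; the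
off-diagonal matrix units among these already force it to be scalar. -/
theorem dual_mul_eq_smul_one {n : ℕ} {A D : GL (Fin n) F}
    (h : ∀ a : Matrix (Fin n) (Fin n) F, a.trace = 0 →
      D.val * a.transpose * D⁻¹.val = (A.val * a * A⁻¹.val).transpose) :
    ∃ μ : F, A.val.transpose * D.val = μ • (1 : Matrix (Fin n) (Fin n) F) := by
  have hAt : A.val.transpose * A⁻¹.val.transpose = 1 := by
    rw [← Matrix.transpose_mul, A.inv_mul, Matrix.transpose_one]
  refine eq_smul_one_of_commute_single fun i j hij => ?_
  have h1 := h (Matrix.single j i 1) (by simp [Matrix.trace_single_eq_of_ne, hij.symm])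
  rw [Matrix.transpose_single] at h1
  set E := Matrix.single i j (1 : F)
  calc E * (A.val.transpose * D.val)
      = (A.val.transpose * A⁻¹.val.transpose) * E * A.val.transpose * D.val := by
        rw [hAt]; noncomm_ring
    _ = A.val.transpose * (D.val * E * D⁻¹.val) * D.val := by
        rw [h1, Matrix.transpose_mul, Matrix.transpose_mul, Matrix.transpose_single]
        noncomm_ring
    _ = A.val.transpose * D.val * E * (D⁻¹.val * D.val) := by noncomm_ring
    _ = A.val.transpose * D.val * E := by rw [D.inv_mul, mul_one]

theorem eq_smul_dual_iff {n : ℕ} {A D : GL (Fin n) F} {μ : F} :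
    A.val.transpose * D.val = μ • (1 : Matrix (Fin n) (Fin n) F) ↔
      D.val = μ • A⁻¹.val.transpose := by
  have hAt : A.val.transpose * A⁻¹.val.transpose = 1 := by
    rw [← Matrix.transpose_mul, A.inv_mul, Matrix.transpose_one]
  have hAt' : A⁻¹.val.transpose * A.val.transpose = 1 := by
    rw [← Matrix.transpose_mul, A.mul_inv, Matrix.transpose_one]
  constructor
  · intro h
    calc D.val = A⁻¹.val.transpose * (A.val.transpose * D.val) := by
          rw [← mul_assoc, hAt', one_mul]
      _ = _ := by rw [h]; simp
  · intro h
    rw [h, Matrix.mul_smul, hAt]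

theorem smul_dual_ne_zero {n : ℕ} (hn : 0 < n) {D : GL (Fin n) F} {μ : F}
    {X : Matrix (Fin n) (Fin n) F} (h : D.val = μ • X) : μ ≠ 0 := by
  rintro rfl
  have : Nonempty (Fin n) := ⟨⟨0, hn⟩⟩
  exact D.ne_zero (by rw [h, zero_smul])

theorem inv_val_of_smul_eq {n : ℕ} {A D : GL (Fin n) F} {μ : F} (hμ : μ ≠ 0)
    (h : D.val = μ • A⁻¹.val.transpose) : D⁻¹.val = μ⁻¹ • A.val.transpose := by
  have hAt : A⁻¹.val.transpose * A.val.transpose = 1 := by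
    rw [← Matrix.transpose_mul, A.mul_inv, Matrix.transpose_one]
  refine Units.inv_eq_of_mul_eq_one_right ?_
  rw [h, Matrix.smul_mul, Matrix.mul_smul, hAt, smul_smul, mul_inv_cancel₀ hμ, one_smul]

theorem val_inv_smul_inv {n : ℕ} {A : GL (Fin n) F} {c : F} (hc : c ≠ 0) :
    (((Units.mk0 c hc)⁻¹ • A)⁻¹).val = c • A⁻¹.val := by
  refine Units.inv_eq_of_mul_eq_one_right ?_
  change (c⁻¹ • A.val) * (c • A⁻¹.val) = 1
  rw [Matrix.smul_mul, Matrix.mul_smul, A.mul_inv, smul_smul, inv_mul_cancel₀ hc, one_smul]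

theorem dual_eq_smul_one {n : ℕ} (hn : 0 < n) {B : GL (Fin n) F} {c : F} (h1 : B.val = c • 1)
    (h2 : B⁻¹.val.transpose = c • 1) : c ^ 2 = 1 := by
  have h3 : B.val * (B⁻¹.val.transpose).transpose = 1 := by
    rw [Matrix.transpose_transpose, B.mul_inv]
  rw [h1, h2] at h3
  have := congrFun (congrFun h3 ⟨0, hn⟩) ⟨0, hn⟩
  simp at this
  rw [sq]; exact this

/-- If `A = cB` and `D = c (B⁻¹)ᵀ`, then `D = c² (A⁻¹)ᵀ`; conversely `c` is a square root of `μ`. -/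
theorem exists_smul_dualPair_iff [IsAlgClosed F] {n : ℕ} {A D : GL (Fin n) F} (hn : 0 < n) :
    (∃ (c : Fˣ) (B : GL (Fin n) F), (c : F) • (dualPair F n B).1.val = A.val ∧
      (c : F) • (dualPair F n B).2.val = D.val) ↔ ∃ μ : F, D.val = μ • A⁻¹.val.transpose := by
  constructor
  · rintro ⟨c, B, hA, hD⟩
    replace hA : (c : F) • B.val = A.val := hA
    replace hD : (c : F) • B⁻¹.val.transpose = D.val := hD
    refine ⟨(c : F) * c, eq_smul_dual_iff.1 ?_⟩
    have hBt : B.val.transpose * B⁻¹.val.transpose = 1 := by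
      rw [← Matrix.transpose_mul, B.inv_mul, Matrix.transpose_one]
    rw [← hA, ← hD, Matrix.transpose_smul, Matrix.smul_mul, Matrix.mul_smul, hBt, smul_smul]
  · rintro ⟨μ, hμ⟩
    have hμ0 := smul_dual_ne_zero hn hμ
    obtain ⟨c, hc⟩ := IsAlgClosed.exists_pow_nat_eq μ (n := 2) (by norm_num)
    have hc0 : c ≠ 0 := by
      rintro rfl
      exact hμ0 (by rw [← hc]; norm_num)
    refine ⟨Units.mk0 c hc0, (Units.mk0 c hc0)⁻¹ • A, ?_, ?_⟩
    · exact smul_inv_smul₀ hc0 A.val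
    · change c • (((Units.mk0 c hc0)⁻¹ • A)⁻¹).val.transpose = D.val
      rw [val_inv_smul_inv hc0, Matrix.transpose_smul, smul_smul, hμ, ← hc, sq]

end Dual

/-! ### The normalizer of `P_n`. -/

section PMax

variable {F : Type*} [Field F] {n : ℕ}

theorem fromBlocks_mem_p_iff {a b c d : Matrix (Fin n) (Fin n) F} :
    Matrix.fromBlocks a b c d ∈ pSubmodule F n ↔ a.trace = 0 ∧ b.transpose = b ∧
      c.transpose = -c ∧ d = -a.transpose := by
  constructor
  · rintro ⟨a', b', c', ha, hb, hc, h⟩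
    obtain ⟨rfl, rfl, rfl, rfl⟩ := Matrix.fromBlocks_inj.1 h
    exact ⟨ha, hb, hc, rfl⟩
  · rintro ⟨ha, hb, hc, rfl⟩
    exact ⟨a, b, c, ha, hb, hc, rfl⟩

theorem trace_conj (A : GL (Fin n) F) (a : Matrix (Fin n) (Fin n) F) :
    (A.val * a * A⁻¹.val).trace = a.trace := by
  rw [Matrix.trace_mul_comm, ← mul_assoc, A.inv_mul, one_mul]

theorem dual_conj {A D : GL (Fin n) F} {μ : F} (hμ : μ ≠ 0)
    (h : D.val = μ • A⁻¹.val.transpose) (X : Matrix (Fin n) (Fin n) F) :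
    D.val * X.transpose * D⁻¹.val = (A.val * X * A⁻¹.val).transpose ∧
    A.val * X * D⁻¹.val = μ⁻¹ • (A.val * X * A.val.transpose) ∧
    D.val * X * A⁻¹.val = μ • (A⁻¹.val.transpose * X * A⁻¹.val) := by
  rw [inv_val_of_smul_eq hμ h, h]
  refine ⟨?_, by simp, by simp⟩
  simp [Matrix.transpose_mul, smul_smul, hμ, mul_assoc]

/-- The diagonal blocks force `D = μ (A⁻¹)ᵀ`. The odd blocks impose nothing more: they are
transformed by congruence up to the factors `μ⁻¹` and `μ`, which keeps them symmetric and skew. -/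
theorem isAlmostDirectProduct_p [CharZero F] [IsAlgClosed F] (hn : 0 < n) (p : ZMod 2) :
    IsAlmostDirectProduct (periplectic F n p).normalizer (scalarHom F _) (glDual F n) := by
  have : Nonempty (Fin n) := ⟨⟨0, hn⟩⟩
  rw [glDual_eq]
  refine IsAlmostDirectProduct.of_block _ (dualPair_injective n) (m := 2) (by norm_num)
    (fun h => ?_) ?_
  · rw [periplectic, mem_normalizer_ofBlocks_iff]
    refine exists_congr fun A => exists_congr fun D => and_congr_right fun _ => ?_
    rw [exists_smul_dualPair_iff hn]
    constructor
    · intro H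
      obtain ⟨μ, hμ⟩ := dual_mul_eq_smul_one (A := A) (D := D) fun a ha => by
        have := (fromBlocks_mem_p_iff.1 (H a 0 0 (-a.transpose)
          (fromBlocks_mem_p_iff.2 ⟨ha, by simp, by simp, rfl⟩))).2.2.2
        rw [Matrix.mul_neg, Matrix.neg_mul] at this
        exact neg_injective this
      exact ⟨μ, eq_smul_dual_iff.1 hμ⟩
    · rintro ⟨μ, hμ⟩ a b c d H
      have hμ0 := smul_dual_ne_zero hn hμ
      obtain ⟨ha, hb, hc, rfl⟩ := fromBlocks_mem_p_iff.1 H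
      refine fromBlocks_mem_p_iff.2 ⟨?_, ?_, ?_, ?_⟩
      · rw [trace_conj, ha]
      · rw [(dual_conj hμ0 hμ b).2.1]
        simp [Matrix.transpose_mul, hb, mul_assoc]
      · rw [(dual_conj hμ0 hμ c).2.2]
        simp [Matrix.transpose_mul, hc, mul_assoc]
      · rw [← (dual_conj hμ0 hμ a).1]
        simp
  · exact fun c B h1 h2 => dual_eq_smul_one hn h1 h2

end PMax

/-! ### The normalizer of `P̂_4`. -/

section PHat

variable {F : Type*} [Field F]

-- The Hodge star comes from the pairing of `Λ²F⁴` with itself into `Λ⁴F⁴`, on which `A` acts by its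
-- determinant. As a polynomial identity in the entries it needs no invertibility of `A`.
set_option maxHeartbeats 4000000 in
theorem mul_hodge_conj_mul [CharZero F] (A : Matrix (Fin 4) (Fin 4) F) {c : Matrix (Fin 4) (Fin 4) F}
    (hc : c.transpose = -c) :
    A * hodge F (A.transpose * c * A) * A.transpose = A.det • hodge F c := by
  rw [skew_eq F hc, Matrix.det_succ_row_zero]
  ext i j
  fin_cases i <;> fin_cases j <;>
    simp [hodge, Matrix.mul_apply, Fin.sum_univ_four,
      Matrix.det_fin_three, Matrix.submatrix_apply, Fin.succAbove] <;> ring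

theorem mul_hodge_mul_transpose [CharZero F] (A : GL (Fin 4) F) {c : Matrix (Fin 4) (Fin 4) F}
    (hc : c.transpose = -c) : A.val * hodge F c * A.val.transpose =
      A.val.det • hodge F (A⁻¹.val.transpose * c * A⁻¹.val) := by
  have hAt : A.val.transpose * A⁻¹.val.transpose = 1 := by
    rw [← Matrix.transpose_mul, A.inv_mul, Matrix.transpose_one]
  have hc' : (A⁻¹.val.transpose * c * A⁻¹.val).transpose = -(A⁻¹.val.transpose * c * A⁻¹.val) := by
    simp [Matrix.transpose_mul, hc, mul_assoc]
  rw [← mul_hodge_conj_mul A.val hc']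
  have : A.val.transpose * (A⁻¹.val.transpose * c * A⁻¹.val) * A.val = c := by
    calc _ = (A.val.transpose * A⁻¹.val.transpose) * c * (A⁻¹.val * A.val) := by
          simp only [mul_assoc]
      _ = c := by rw [hAt, A.inv_mul, one_mul, mul_one]
  rw [this]

theorem hodge_transpose [CharZero F] {c : Matrix (Fin 4) (Fin 4) F} (hc : c.transpose = -c) :
    (hodge F c).transpose = -hodge F c := by
  rw [skew_eq F hc]
  ext i j
  fin_cases i <;> fin_cases j <;> simp [hodge]

/-- The even part gives `D = μ (A⁻¹)ᵀ` as for `P_n`. The Hodge dual in the upper right block is then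
scaled by `μ⁻¹ det A`, whereas the lower left block is scaled by `μ`; the two must agree. -/
theorem normalizer_pHat [CharZero F] (p : ZMod 2)
    {h : LinearMap.GeneralLinearGroup F (Fin 4 ⊕ Fin 4 → F)} :
    h ∈ (periplecticHat F p).normalizer ↔ ∃ A D, glBlock F (Fin 4) (Fin 4) (A, D) = h ∧
      ∃ μ : F, D.val = μ • A⁻¹.val.transpose ∧ μ ^ 2 = A.val.det := by
  rw [periplecticHat, mem_normalizer_ofBlocks_iff]
  refine exists_congr fun A => exists_congr fun D => and_congr_right fun _ => ?_
  have hdet : A.val.det ≠ 0 := (Matrix.isUnit_iff_isUnit_det _).1 A.isUnit |>.ne_zero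
  constructor
  · intro H
    obtain ⟨μ, hμ⟩ := dual_mul_eq_smul_one (A := A) (D := D) fun a ha => by
      obtain ⟨a', b', c', z, ha', -, -, e⟩ := H a 0 0 (-a.transpose)
        ⟨a, 0, 0, 0, ha, by simp, by simp, by simp⟩
      obtain ⟨e1, -, -, e2⟩ := Matrix.fromBlocks_inj.1 e
      -- Comparing traces shows that no central term `z` can appear, since `4z = 0`.
      have ht := congrArg Matrix.trace e1
      rw [trace_conj, ha, Matrix.trace_add, ha', Matrix.trace_smul, Matrix.trace_one] at ht
      have hz : z = 0 := by simpa using ht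
      rw [hz, zero_smul, add_zero] at e1 e2
      rw [Matrix.mul_neg, Matrix.neg_mul] at e2
      rw [e1]
      exact neg_injective e2
    rw [eq_smul_dual_iff] at hμ
    have hμ0 := smul_dual_ne_zero (by norm_num) hμ
    refine ⟨μ, hμ, ?_⟩
    -- The odd test element has this skew `c` and symmetric parameter `0`, so its upper right block
    -- is `-hodge c`.
    have hc : (Matrix.single 0 1 1 - Matrix.single 1 0 1 : Matrix (Fin 4) (Fin 4) F).transpose =
        -(Matrix.single 0 1 1 - Matrix.single 1 0 1) := by simp
    set c : Matrix (Fin 4) (Fin 4) F := Matrix.single 0 1 1 - Matrix.single 1 0 1 with hcdef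
    obtain ⟨a', b', c', z, -, hb', -, e⟩ := H 0 (-hodge F c) c 0
        ⟨0, 0, c, 0, by simp, by simp, hc, by simp⟩
    obtain ⟨-, e1, e2, -⟩ := Matrix.fromBlocks_inj.1 e
    rw [(dual_conj hμ0 hμ _).2.1, Matrix.mul_neg, Matrix.neg_mul, mul_hodge_mul_transpose A hc] at e1
    rw [(dual_conj hμ0 hμ _).2.2] at e2
    set Y := A⁻¹.val.transpose * c * A⁻¹.val with hY
    have hYt : Y.transpose = -Y := by simp [hY, Matrix.transpose_mul, hc, mul_assoc]
    rw [← e2, map_smul] at e1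
    have e3 : (μ - μ⁻¹ * A.val.det) • hodge F Y = b' := by
      rw [eq_sub_iff_add_eq] at e1
      rw [sub_smul, mul_smul, ← e1, smul_neg]
      abel
    -- By `e3` this matrix equals the symmetric `b'`, while a Hodge dual is skew; so it vanishes.
    have e4 : (μ - μ⁻¹ * A.val.det) • hodge F Y = 0 := by
      have e5 := congrArg Matrix.transpose e3
      rw [Matrix.transpose_smul, hodge_transpose hYt, hb', smul_neg, ← e3] at e5
      exact Matrix.ext fun i j => self_eq_neg.1 (congrFun (congrFun e5.symm i) j)
    have hYne : hodge F Y ≠ 0 := by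
      intro h0
      have h1 := mul_hodge_mul_transpose A hc
      rw [← hY, h0, smul_zero] at h1
      have hAt : A.val.transpose * A⁻¹.val.transpose = 1 := by
        rw [← Matrix.transpose_mul, A.inv_mul, Matrix.transpose_one]
      have h2 : hodge F c = 0 := by
        calc hodge F c = (A⁻¹.val * A.val) * hodge F c * (A.val.transpose * A⁻¹.val.transpose) := by
              rw [A.inv_mul, hAt, one_mul, mul_one]
          _ = A⁻¹.val * (A.val * hodge F c * A.val.transpose) * A⁻¹.val.transpose := by
              simp only [mul_assoc]
          _ = 0 := by rw [h1]; simp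
      have h3 := congrFun (congrFun h2 2) 3
      simp [hodge, hcdef] at h3
    have e6 := (smul_eq_zero.1 e4).resolve_right hYne
    field_simp at e6
    rw [mul_zero] at e6
    exact sub_eq_zero.1 e6
  · rintro ⟨μ, hμ, hdetμ⟩ _ _ c _ ⟨a, b, c', z, ha, hb, hc, e⟩
    obtain ⟨rfl, rfl, rfl, rfl⟩ := Matrix.fromBlocks_inj.1 e
    have hμ0 := smul_dual_ne_zero (by norm_num) hμ
    have hdc := dual_conj hμ0 hμ
    refine ⟨A.val * a * A⁻¹.val, A.val * b * D⁻¹.val, D.val * c * A⁻¹.val, z, ?_, ?_, ?_, ?_⟩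
    · rw [trace_conj, ha]
    · rw [(hdc b).2.1]
      simp [Matrix.transpose_mul, hb, mul_assoc]
    · rw [(hdc c).2.2]
      simp [Matrix.transpose_mul, hc, mul_assoc]
    · congr 1
      · simp [mul_add, add_mul]
      · rw [Matrix.mul_sub, Matrix.sub_mul, (hdc (hodge F c)).2.1, mul_hodge_mul_transpose A hc,
          (hdc c).2.2, map_smul, smul_smul, ← hdetμ]
        congr 2
        field_simp
      · rw [← (hdc a).1]
        simp [mul_add, add_mul]

theorem isAlmostDirectProduct_pHat [CharZero F] [IsAlgClosed F] (p : ZMod 2) :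
    IsAlmostDirectProduct (periplecticHat F p).normalizer (scalarHom F _) (slDual F 4) := by
  have e : slDual F 4 = (glBlock F (Fin 4) (Fin 4)).comp
      ((dualPair F 4).comp Matrix.SpecialLinearGroup.toGL) := by
    rw [slDual, glDual_eq, MonoidHom.comp_assoc]
  rw [e]
  refine IsAlmostDirectProduct.of_block _ ?_ (m := 2) (by norm_num) (fun h => ?_) ?_
  · exact (dualPair_injective 4).comp Matrix.SpecialLinearGroup.toGL_injective
  · rw [normalizer_pHat]
    refine exists_congr fun A => exists_congr fun D => and_congr_right fun _ => ?_
    constructor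
    · rintro ⟨μ, hμ, hdet⟩
      have hμ0 := smul_dual_ne_zero (by norm_num) hμ
      obtain ⟨c, hc⟩ := IsAlgClosed.exists_pow_nat_eq μ (n := 2) (by norm_num)
      have hc0 : c ≠ 0 := by
        rintro rfl
        exact hμ0 (by rw [← hc]; norm_num)
      -- The determinant is `c⁻⁴ det A`, and `c⁴ = μ² = det A`.
      let S : Matrix.SpecialLinearGroup (Fin 4) F := ⟨c⁻¹ • A.val, by
        rw [Matrix.det_smul, ← hdet, ← hc, Fintype.card_fin]; field_simp⟩
      have hS : Matrix.SpecialLinearGroup.toGL S = (Units.mk0 c hc0)⁻¹ • A := Units.ext rfl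
      refine ⟨Units.mk0 c hc0, S, ?_, ?_⟩
      · exact smul_inv_smul₀ hc0 A.val
      · change c • (Matrix.SpecialLinearGroup.toGL S)⁻¹.val.transpose = D.val
        rw [hS, val_inv_smul_inv hc0, Matrix.transpose_smul, smul_smul, hμ, ← hc, sq]
    · rintro ⟨c, S, hA, hD⟩
      set B := Matrix.SpecialLinearGroup.toGL S with hB
      replace hA : (c : F) • B.val = A.val := hA
      replace hD : (c : F) • B⁻¹.val.transpose = D.val := hD
      have hBt : B.val.transpose * B⁻¹.val.transpose = 1 := by
        rw [← Matrix.transpose_mul, B.inv_mul, Matrix.transpose_one]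
      refine ⟨(c : F) * c, eq_smul_dual_iff.1 ?_, ?_⟩
      · rw [← hA, ← hD, Matrix.transpose_smul, Matrix.smul_mul, Matrix.mul_smul, hBt, smul_smul]
      · have : B.val.det = 1 := S.2
        rw [← hA, Matrix.det_smul, this, Fintype.card_fin]
        ring
  · exact fun c S h1 h2 => dual_eq_smul_one (by norm_num) h1 h2

theorem mem_normalizer_pHat_iff [CharZero F] (p : ZMod 2)
    {h : LinearMap.GeneralLinearGroup F (Fin 4 ⊕ Fin 4 → F)} :
    h ∈ (periplecticHat F p).normalizer ↔
      ∃ (A : GL (Fin 4) F) (l : Fˣ), (l : F) ^ 2 = (A : Matrix (Fin 4) (Fin 4) F).det ∧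
        (h : Module.End F (Fin 4 ⊕ Fin 4 → F)) =
          Matrix.toLin' (Matrix.fromBlocks (A : Matrix (Fin 4) (Fin 4) F) 0 0
            ((l : F) • ((A⁻¹ : GL (Fin 4) F) : Matrix (Fin 4) (Fin 4) F).transpose)) := by
  rw [normalizer_pHat]
  constructor
  · rintro ⟨A, D, rfl, μ, hμ, hdet⟩
    exact ⟨A, Units.mk0 μ (smul_dual_ne_zero (by norm_num) hμ), hdet, by rw [coe_glBlock, hμ]; rfl⟩
  · rintro ⟨A, l, hdet, hh⟩
    refine ⟨A, l • (dualPair F 4 A).2, Units.ext ?_, l, rfl, hdet⟩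
    rw [hh]
    rfl

end PHat


/-! ### Normalizers of matrix algebras -/

section Skolem

variable {F : Type*} [Field F]

/-- Skolem–Noether for a matrix algebra. Injectivity suffices, since source and target have the same
finite dimension. -/
theorem exists_conj_of_algHom {n : ℕ}
    (σ : Matrix (Fin n) (Fin n) F →ₐ[F] Matrix (Fin n) (Fin n) F) (hσ : Function.Injective σ) :
    ∃ g : GL (Fin n) F, ∀ x, σ x = g.val * x * g⁻¹.val := by
  have hbij : Function.Bijective σ :=
    ⟨hσ, (LinearMap.injective_iff_surjective (f := σ.toLinearMap)).1 hσ⟩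
  let τ : Module.End F (Fin n → F) ≃ₐ[F] Module.End F (Fin n → F) :=
    (Matrix.toLinAlgEquiv'.symm.trans (AlgEquiv.ofBijective σ hbij)).trans Matrix.toLinAlgEquiv'
  obtain ⟨T, hT⟩ := τ.eq_linearEquivConjAlgEquiv
  let u : LinearMap.GeneralLinearGroup F (Fin n → F) := LinearMap.GeneralLinearGroup.ofLinearEquiv T
  let g : GL (Fin n) F := Units.map
    ((LinearMap.toMatrixAlgEquiv' : _ ≃ₐ[F] Matrix (Fin n) (Fin n) F) : _ →* _) u
  refine ⟨g, fun x => ?_⟩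
  have h1 : τ (Matrix.toLinAlgEquiv' x) = Matrix.toLinAlgEquiv' (σ x) := by
    simp [τ]
  rw [hT] at h1
  apply (Matrix.toLinAlgEquiv' : Matrix (Fin n) (Fin n) F ≃ₐ[F] _).injective
  rw [← h1, map_mul, map_mul]
  have hg : Matrix.toLinAlgEquiv' g.val = (T : Module.End F (Fin n → F)) := by
    simp [g, u]; rfl
  have hg' : Matrix.toLinAlgEquiv' g⁻¹.val = (T.symm : Module.End F (Fin n → F)) := by
    simp [g, u]; rfl
  rw [hg, hg']
  rfl

variable {V : Type*} [AddCommGroup V] [Module F V]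

/-- Conjugation by `h` is an algebra automorphism of `End(V)`; preserving the image of `φ`, it pulls
back to an injective endomorphism of the matrix algebra. -/
theorem exists_conj_of_normalizes {n : ℕ} {φ : Matrix (Fin n) (Fin n) F →ₐ[F] Module.End F V}
    (hφ : Function.Injective φ) {h : LinearMap.GeneralLinearGroup F V}
    (hh : ∀ x, ∃ y, conjEquiv h (φ x) = φ y) :
    ∃ g : GL (Fin n) F, ∀ x, conjEquiv h (φ x) = φ (g.val * x * g⁻¹.val) := by
  choose f hf using hh
  let σ : Matrix (Fin n) (Fin n) F →ₐ[F] Matrix (Fin n) (Fin n) F :=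
    AlgHom.ofLinearMap
      { toFun := f
        map_add' := fun x y => hφ (by rw [map_add, ← hf, ← hf, ← hf, map_add, map_add])
        map_smul' := fun c x => hφ (by
          rw [RingHom.id_apply, map_smul, ← hf, ← hf, map_smul, map_smul]) }
      (hφ (by
        change φ (f 1) = φ 1
        rw [← hf, map_one, conjEquiv_one_apply]))
      (fun x y => hφ (by
        change φ (f (x * y)) = φ (f x * f y)
        rw [← hf, map_mul φ, conjEquiv_mul_apply, hf, hf, map_mul φ]))
  have hσ : ∀ x, σ x = f x := fun _ => rfl
  obtain ⟨g, hg⟩ := exists_conj_of_algHom σ fun x y hxy => by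
    rw [hσ, hσ] at hxy
    have := congrArg φ hxy
    rw [← hf, ← hf] at this
    exact hφ ((conjEquiv h).injective this)
  exact ⟨g, fun x => by rw [← hg, hσ, hf]⟩

/-- Used to split an element of the normalizer into a known conjugating element and an element of
the commutant. -/
theorem commute_inv_mul_of_conj_eq {u h : LinearMap.GeneralLinearGroup F V} {T S : Module.End F V}
    (h1 : conjEquiv h T = S) (h2 : conjEquiv u T = S) :
    ((u⁻¹ * h : LinearMap.GeneralLinearGroup F V) : Module.End F V) * T =
      T * ((u⁻¹ * h : LinearMap.GeneralLinearGroup F V) : Module.End F V) := by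
  rw [← conjEquiv_mem_iff]
  have h3 : conjEquiv (u⁻¹ * h) T = conjEquiv u⁻¹ (conjEquiv h T) := by
    simp [conjEquiv_apply, mul_assoc]
  rw [h3, h1, ← h2]
  simp [conjEquiv_apply, mul_assoc]

theorem scalarHom_mul_comm (c : Fˣ) (T : Module.End F V) :
    (scalarHom F V c : Module.End F V) * T = T * (scalarHom F V c : Module.End F V) := by
  refine LinearMap.ext fun v => ?_
  simp [scalarHom_apply]

theorem exists_slVal_eq {n : ℕ} {x : Matrix (Fin n) (Fin n) F} (hx : x.trace = 0) :
    ∃ y, slVal F n y = x :=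
  ⟨⟨x, hx⟩, rfl⟩

theorem trace_slVal {n : ℕ} (y : LieAlgebra.SpecialLinear.sl (Fin n) F) :
    (slVal F n y).trace = 0 := y.2

/-- Passes from `sl_n` to the full matrix algebra: the identity is fixed by conjugation, so
normalizing one amounts to normalizing the other. -/
theorem exists_slVal_add_smul_one [CharZero F] {n : ℕ} (hn : 0 < n) (x : Matrix (Fin n) (Fin n) F) :
    ∃ (y : _) (t : F), x = slVal F n y + t • 1 := by
  obtain ⟨y, hy⟩ := exists_slVal_eq (x := x - (x.trace / n) • 1) (by
    have : (n : F) ≠ 0 := Nat.cast_ne_zero.2 hn.ne'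
    simp [Matrix.trace_sub, Matrix.trace_smul, this])
  exact ⟨y, x.trace / n, by rw [hy, sub_add_cancel]⟩

theorem mem_pure_part {p i : ZMod 2} {u : LinearMap.GeneralLinearGroup F V} {v : V}
    (hv : v ∈ (Superspace.pure F V p).part i) :
    (u : Module.End F V) v ∈ (Superspace.pure F V p).part i := by
  by_cases h : i = p
  · simp [Superspace.pure, h]
  · simp only [Superspace.pure, h, if_false, Submodule.mem_bot] at hv ⊢
    rw [hv, map_zero]

theorem mem_normalizer_ofLie_iff [FiniteDimensional F V] {L : Type*} [LieRing L] [LieAlgebra F L]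
    {p : ZMod 2} {φ : L →ₗ[F] Module.End F V}
    {hφ : ∀ x y, φ ⁅x, y⁆ = φ x * φ y - φ y * φ x} {h : LinearMap.GeneralLinearGroup F V} :
    h ∈ (LieSuperalgebra.Rep.ofLie p φ hφ).normalizer ↔ ∀ x, ∃ y, conjEquiv h (φ x) = φ y := by
  rw [LieSuperalgebra.Rep.mem_normalizer_iff]
  constructor
  · intro H x
    obtain ⟨y, hy⟩ := H.2 x
    exact ⟨y, hy.symm⟩
  · intro H
    refine ⟨fun i v hv => mem_pure_part hv, fun x => ?_⟩
    obtain ⟨y, hy⟩ := H x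
    exact ⟨y, hy.symm⟩

theorem exists_specialLinear_smul [IsAlgClosed F] {n : ℕ} (hn : 0 < n) (A : GL (Fin n) F) :
    ∃ (c : Fˣ) (S : Matrix.SpecialLinearGroup (Fin n) F), A.val = (c : F) • S.val := by
  have hdet : A.val.det ≠ 0 := ((Matrix.isUnit_iff_isUnit_det _).1 A.isUnit).ne_zero
  obtain ⟨c, hc⟩ := IsAlgClosed.exists_pow_nat_eq A.val.det hn
  have hc0 : c ≠ 0 := by
    rintro rfl
    exact hdet (by rw [← hc, zero_pow hn.ne'])
  refine ⟨Units.mk0 c hc0, ⟨c⁻¹ • A.val, ?_⟩, (smul_inv_smul₀ hc0 A.val).symm⟩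
  rw [Matrix.det_smul, Fintype.card_fin, ← hc, ← mul_pow, inv_mul_cancel₀ hc0, one_pow]

theorem pow_eq_one_of_specialLinear {n : ℕ} {S : Matrix.SpecialLinearGroup (Fin n) F} {t : F}
    (h : S.val = t • 1) : t ^ n = 1 := by
  have := S.2
  rw [h, Matrix.det_smul, Fintype.card_fin, Matrix.det_one, mul_one] at this
  exact this

end Skolem

/-! ### `sl_n` on `Fⁿ ⊕ Fⁿ` -/

section TwoCopiesMax

variable {F : Type*} [Field F] {n : ℕ}

theorem diagAction_apply (x : Matrix (Fin n) (Fin n) F) (v : Fin 2 → Fin n → F) (i : Fin 2) :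
    diagAction F n x v i = Matrix.mulVec x (v i) := rfl

theorem gl2Mixing_apply (A : GL (Fin 2) F) (v : Fin 2 → Fin n → F) (i : Fin 2) :
    (gl2Mixing F n A : Module.End F (Fin 2 → Fin n → F)) v i = A.val i 0 • v 0 + A.val i 1 • v 1 := by
  simp [gl2Mixing, Fin.sum_univ_two]

theorem coe_glDiag (B : GL (Fin n) F) :
    (glDiag F n B : Module.End F (Fin 2 → Fin n → F)) = diagAction F n B.val := rfl

/-- The diagonal action as a homomorphism of algebras. -/
def diagAlgHom (F : Type*) [Field F] (n : ℕ) :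
    Matrix (Fin n) (Fin n) F →ₐ[F] Module.End F (Fin 2 → Fin n → F) :=
  AlgHom.ofLinearMap (diagAction F n)
    (by ext; simp [diagAction]) (fun x y => by ext; simp [diagAction])

theorem diagAlgHom_apply (x : Matrix (Fin n) (Fin n) F) : diagAlgHom F n x = diagAction F n x := rfl

theorem diagAction_injective : Function.Injective (diagAction F n) := by
  intro x y h
  apply Matrix.toLin'.injective
  refine LinearMap.ext fun v => ?_
  exact congrFun (LinearMap.congr_fun h (fun _ => v)) 0

theorem commute_gl2Mixing (A : GL (Fin 2) F) (x : Matrix (Fin n) (Fin n) F) :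
    (gl2Mixing F n A : Module.End F _) * diagAction F n x =
      diagAction F n x * (gl2Mixing F n A : Module.End F _) := by
  refine LinearMap.ext fun v => funext fun i => ?_
  rw [Module.End.mul_apply, Module.End.mul_apply, gl2Mixing_apply, diagAction_apply,
    diagAction_apply, diagAction_apply, gl2Mixing_apply, Matrix.mulVec_add, Matrix.mulVec_smul,
    Matrix.mulVec_smul]

theorem conj_mixing (A : GL (Fin 2) F) (B : GL (Fin n) F) (x : Matrix (Fin n) (Fin n) F) :
    conjEquiv (gl2Mixing F n A * glDiag F n B) (diagAction F n x) =
      diagAction F n (B.val * x * B⁻¹.val) := by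
  rw [conjEquiv_mem_iff, Units.val_mul, coe_glDiag, mul_assoc, ← mul_assoc (diagAction F n _),
    ← commute_gl2Mixing, mul_assoc]
  congr 1
  rw [← diagAlgHom_apply, ← diagAlgHom_apply, ← diagAlgHom_apply, ← map_mul, ← map_mul, mul_assoc,
    B.inv_mul, mul_one]

theorem conj_glDiag (B : GL (Fin n) F) (x : Matrix (Fin n) (Fin n) F) :
    conjEquiv (glDiag F n B) (diagAction F n x) = diagAction F n (B.val * x * B⁻¹.val) := by
  simpa using conj_mixing 1 B x

/-- The commutant of `M_n` on `F² ⊗ F^n` is `M_2`. Applying this to `u` and to `u⁻¹` gives mutually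
inverse matrices. -/
theorem exists_gl2Mixing_eq (hn : 0 < n) {u : LinearMap.GeneralLinearGroup F (Fin 2 → Fin n → F)}
    (hu : ∀ x, (u : Module.End F _) * diagAction F n x = diagAction F n x * (u : Module.End F _)) :
    ∃ A, gl2Mixing F n A = u := by
  have key : ∀ T : Module.End F (Fin 2 → Fin n → F),
      (∀ x, T * diagAction F n x = diagAction F n x * T) →
      ∃ A : Matrix (Fin 2) (Fin 2) F, ∀ v i, T v i = A i 0 • v 0 + A i 1 • v 1 := by
    intro T hT
    let e : Fin n → F := Pi.single ⟨0, hn⟩ 1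
    have h1 : ∀ (j : Fin 2) (w : Fin n → F) (i : Fin 2),
        T (Pi.single j w) i = T (Pi.single j e) i ⟨0, hn⟩ • w := by
      intro j w i
      -- This rank-one matrix carries `e` to `w` and has image in the line of `w`, so commuting with
      -- it determines `T` from its values on the two copies of `e`.
      let X : Matrix (Fin n) (Fin n) F := Matrix.vecMulVec w e
      have hX : ∀ v, Matrix.mulVec X v = v ⟨0, hn⟩ • w := by
        intro v
        rw [Matrix.vecMulVec_mulVec]
        ext; simp [e, mul_comm]
      have h2 : diagAction F n X (Pi.single j e) = Pi.single j w := by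
        funext i
        rw [diagAction_apply, hX]
        by_cases hij : i = j
        · subst hij; simp [e]
        · simp [hij]
      have h3 := congrFun (LinearMap.congr_fun (hT X) (Pi.single j e)) i
      rw [Module.End.mul_apply, h2, Module.End.mul_apply, diagAction_apply, hX] at h3
      exact h3
    refine ⟨fun i j => T (Pi.single j e) i ⟨0, hn⟩, fun v i => ?_⟩
    have hv : v = Pi.single 0 (v 0) + Pi.single 1 (v 1) := by
      funext j; fin_cases j <;> simp
    conv_lhs => rw [hv, map_add, Pi.add_apply, h1, h1 1]
  obtain ⟨A, hA⟩ := key _ hu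
  have hu' : ∀ x, ((u⁻¹ : LinearMap.GeneralLinearGroup F _) : Module.End F _) * diagAction F n x =
      diagAction F n x * ((u⁻¹ : LinearMap.GeneralLinearGroup F _) : Module.End F _) :=
    fun x => ((show Commute (u : Module.End F _) (diagAction F n x) from hu x).units_inv_left).eq
  obtain ⟨A', hA'⟩ := key _ hu'
  have hmul : ∀ {S T : Module.End F (Fin 2 → Fin n → F)} {X Y : Matrix (Fin 2) (Fin 2) F},
      (∀ v i, S v i = X i 0 • v 0 + X i 1 • v 1) → (∀ v i, T v i = Y i 0 • v 0 + Y i 1 • v 1) →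
      S * T = 1 → X * Y = 1 := by
    intro S T X Y hS hT hST
    ext i j
    have := congrFun (congrFun (LinearMap.congr_fun hST (Pi.single j (Pi.single ⟨0, hn⟩ 1))) i) ⟨0, hn⟩
    rw [Module.End.mul_apply, hS, hT, hT] at this
    fin_cases i <;> fin_cases j <;> simpa [Matrix.mul_apply, Fin.sum_univ_two] using this
  refine ⟨⟨A, A', hmul hA hA' u.mul_inv, hmul hA' hA u.inv_mul⟩, Units.ext ?_⟩
  refine LinearMap.ext fun v => funext fun i => ?_
  rw [gl2Mixing_apply, hA]

theorem slTwoCopies_injective (p : ZMod 2) : Function.Injective (slTwoCopies F n p).ρ :=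
  diagAction_injective.comp Subtype.val_injective

/-- Adjoining scalars, `h` normalizes the diagonal `M_n` and acts on it as some `B`; then `B⁻¹h`
commutes with `M_n` and lies in `GL_2`. -/
theorem mem_normalizer_slTwoCopies [CharZero F] (hn : 0 < n) (p : ZMod 2)
    {h : LinearMap.GeneralLinearGroup F (Fin 2 → Fin n → F)} :
    h ∈ (slTwoCopies F n p).normalizer ↔ ∃ A B, gl2Mixing F n A * glDiag F n B = h := by
  rw [slTwoCopies, mem_normalizer_ofLie_iff]
  constructor
  · intro H
    obtain ⟨B, hB⟩ := exists_conj_of_normalizes (φ := diagAlgHom F n) diagAction_injective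
      (h := h) fun x => by
        obtain ⟨y, t, rfl⟩ := exists_slVal_add_smul_one hn x
        obtain ⟨z, hz⟩ := H y
        refine ⟨slVal F n z + t • 1, ?_⟩
        rw [map_add, map_add, map_add, map_smul, map_smul, map_one, conjEquiv_one_apply]
        exact congrArg (· + t • 1) hz
    obtain ⟨A, hA⟩ := exists_gl2Mixing_eq hn (u := (glDiag F n B)⁻¹ * h) fun x =>
      commute_inv_mul_of_conj_eq (hB x) (conj_glDiag B x)
    have hc : Commute (gl2Mixing F n A) (glDiag F n B) := Units.ext (commute_gl2Mixing A B.val)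
    exact ⟨A, B, by rw [hc.eq, hA, mul_inv_cancel_left]⟩
  · rintro ⟨A, B, rfl⟩ x
    obtain ⟨y, hy⟩ := exists_slVal_eq (x := B.val * slVal F n x * B⁻¹.val)
      (by rw [trace_conj, trace_slVal])
    refine ⟨y, ?_⟩
    rw [LinearMap.comp_apply, LinearMap.comp_apply, conj_mixing, hy]

theorem gl2Mixing_mul_glDiag_congr {A A' : GL (Fin 2) F} {B B' : GL (Fin n) F} {c : Fˣ}
    (hA : A'.val = (c : F) • A.val) (hB : B.val = (c : F) • B'.val) :
    gl2Mixing F n A * glDiag F n B = gl2Mixing F n A' * glDiag F n B' := by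
  refine Units.ext (LinearMap.ext fun v => funext fun i => ?_)
  simp only [Units.val_mul, Module.End.mul_apply, gl2Mixing_apply, coe_glDiag, diagAction_apply, hA,
    hB, Matrix.smul_mulVec, Matrix.smul_apply, smul_smul, smul_eq_mul, mul_comm]

/-- A scalar conjugates trivially, so `B` is central, hence scalar; what is left determines `A`. -/
theorem eq_smul_one_of_mixing_eq_scalar (hn : 0 < n) {A : GL (Fin 2) F} {B : GL (Fin n) F} {c : Fˣ}
    (h : gl2Mixing F n A * glDiag F n B = scalarHom F _ c) :
    ∃ s t : F, A.val = s • 1 ∧ B.val = t • 1 ∧ s * t = c := by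
  have h1 : ∀ x, B.val * x * B⁻¹.val = x := by
    intro x
    apply diagAction_injective
    rw [← conj_mixing A, h, conjEquiv_mem_iff]
    exact scalarHom_mul_comm c _
  have h2 : ∀ x, B.val * x = x * B.val := by
    intro x
    conv_rhs => rw [← h1 x]
    rw [mul_assoc, B.inv_mul, mul_one]
  obtain ⟨t, ht⟩ := eq_smul_one_of_commute_single (N := B.val) fun i j _ => (h2 _).symm
  have h3 : t • A.val = (c : F) • 1 := by
    ext i j
    have := congrFun (congrFun (LinearMap.congr_fun (congrArg Units.val h)
      (Pi.single j (Pi.single ⟨0, hn⟩ 1))) i) ⟨0, hn⟩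
    rw [Units.val_mul, Module.End.mul_apply, gl2Mixing_apply, coe_glDiag, diagAction_apply,
      diagAction_apply, ht, scalarHom_apply] at this
    fin_cases i <;> fin_cases j <;> simpa [mul_comm] using this
  have : Nonempty (Fin n) := ⟨⟨0, hn⟩⟩
  have ht0 : t ≠ 0 := by
    rintro rfl
    exact B.ne_zero (by rw [ht, zero_smul])
  refine ⟨t⁻¹ * c, t, ?_, ht, by field_simp⟩
  rw [mul_smul, ← h3, inv_smul_smul₀ ht0]

theorem slDiag_apply (S : Matrix.SpecialLinearGroup (Fin n) F) :
    slDiag F n S = glDiag F n (Matrix.SpecialLinearGroup.toGL S) := rfl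

theorem isAlmostDirectProduct_gl2_sl [CharZero F] [IsAlgClosed F] (hn : 0 < n) (p : ZMod 2) :
    IsAlmostDirectProduct (slTwoCopies F n p).normalizer (gl2Mixing F n) (slDiag F n) := by
  have hscalar : ∀ {A : GL (Fin 2) F} {B : GL (Fin n) F}, gl2Mixing F n A = glDiag F n B →
      ∃ t : F, A.val = t • 1 ∧ B.val = t • 1 := by
    -- The equality is rewritten as a product equal to the scalar `1`, with `B⁻¹` in the second
    -- factor.
    intro A B h
    obtain ⟨s, t, hs, ht, hst⟩ := eq_smul_one_of_mixing_eq_scalar hn (A := A) (B := B⁻¹) (c := 1)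
      (by rw [map_inv, ← h, mul_inv_cancel, map_one])
    rw [Units.val_one] at hst
    refine ⟨s, hs, ?_⟩
    have : B⁻¹⁻¹.val = s • 1 := Units.inv_eq_of_mul_eq_one_left (by
      rw [ht, Matrix.smul_mul, one_mul, smul_smul, hst, one_smul])
    rwa [inv_inv] at this
  refine .of_commute ?_ ?_ (fun A B => Units.ext (commute_gl2Mixing A _)) (fun h => ?_) ?_
  · rw [injective_iff_map_eq_one]
    intro A hA
    obtain ⟨t, hA', hB⟩ := hscalar (A := A) (B := 1) (by rw [hA, map_one])
    have := congrFun (congrFun hB ⟨0, hn⟩) ⟨0, hn⟩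
    simp at this
    rw [← this, one_smul] at hA'
    exact Units.ext hA'
  · rw [injective_iff_map_eq_one]
    intro S hS
    obtain ⟨t, hA, hB⟩ := hscalar (A := 1) (B := Matrix.SpecialLinearGroup.toGL S)
      (by rw [map_one, ← slDiag_apply, hS])
    have := congrFun (congrFun hA 0) 0
    simp at this
    rw [← this, one_smul] at hB
    exact Subtype.ext hB
  · rw [mem_normalizer_slTwoCopies hn]
    constructor
    · rintro ⟨A, B, rfl⟩
      obtain ⟨c, S, hS⟩ := exists_specialLinear_smul hn B
      -- The scalar `c` in `B = cS` is moved to the `GL_2` factor.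
      refine ⟨c • A, S, ?_⟩
      rw [slDiag_apply]
      exact (gl2Mixing_mul_glDiag_congr (c := c) rfl hS).symm
    · rintro ⟨A, S, rfl⟩
      exact ⟨A, Matrix.SpecialLinearGroup.toGL S, rfl⟩
  · refine ((finite_setOf_units_pow_eq_one (F := F) hn).image
      fun t => t • (1 : GL (Fin 2) F)).subset ?_
    rintro A ⟨S, hS⟩
    obtain ⟨t, hA, hB⟩ := hscalar (B := Matrix.SpecialLinearGroup.toGL S) hS
    have ht := pow_eq_one_of_specialLinear (S := S) hB
    have ht0 : t ≠ 0 := by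
      rintro rfl
      rw [zero_pow hn.ne'] at ht
      exact zero_ne_one ht
    exact ⟨Units.mk0 t ht0, ht, Units.ext hA.symm⟩

theorem sl2slMixing_apply (S : Matrix.SpecialLinearGroup (Fin 2) F)
    (T : Matrix.SpecialLinearGroup (Fin n) F) :
    sl2slMixing F n (S, T) = gl2Mixing F n (Matrix.SpecialLinearGroup.toGL S) *
      glDiag F n (Matrix.SpecialLinearGroup.toGL T) := rfl

theorem exists_scalar_mul_sl2slMixing [IsAlgClosed F] (hn : 0 < n) (A : GL (Fin 2) F)
    (B : GL (Fin n) F) : ∃ (c : Fˣ) (S : Matrix.SpecialLinearGroup (Fin 2) F)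
      (T : Matrix.SpecialLinearGroup (Fin n) F),
      scalarHom F _ c * sl2slMixing F n (S, T) = gl2Mixing F n A * glDiag F n B := by
  obtain ⟨c, S, hS⟩ := exists_specialLinear_smul (by norm_num) A
  obtain ⟨d, T, hT⟩ := exists_specialLinear_smul hn B
  refine ⟨c * d, S, T, Units.ext (LinearMap.ext fun v => funext fun i => ?_)⟩
  simp only [sl2slMixing_apply, Units.val_mul, Module.End.mul_apply, gl2Mixing_apply, coe_glDiag,
    diagAction_apply, hS, hT, scalarHom_apply, Matrix.smul_mulVec, Matrix.smul_apply, smul_smul,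
    smul_add, smul_eq_mul, Pi.smul_apply]
  congr 2 <;> exact mul_right_comm _ _ _

theorem exists_gl_of_scalar_mul_sl2slMixing (c : Fˣ) (S : Matrix.SpecialLinearGroup (Fin 2) F)
    (T : Matrix.SpecialLinearGroup (Fin n) F) :
    gl2Mixing F n (c • Matrix.SpecialLinearGroup.toGL S) *
      glDiag F n (Matrix.SpecialLinearGroup.toGL T) = scalarHom F _ c * sl2slMixing F n (S, T) := by
  rw [sl2slMixing_apply, ← mul_assoc]
  congr 1
  refine Units.ext (LinearMap.ext fun v => funext fun i => ?_)
  rw [Units.val_mul, Module.End.mul_apply, scalarHom_apply, Pi.smul_apply, gl2Mixing_apply,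
    gl2Mixing_apply, smul_add, smul_smul, smul_smul]
  rfl

/-- A scalar in the image of `SL_2 × SL_3` is `s t` with `s² = t³ = 1`: it is a sixth root of unity,
and the map is injective because `2` and `3` are coprime. -/
theorem isAlmostDirectProduct_sl2_sl3 [CharZero F] [IsAlgClosed F] (p : ZMod 2) :
    IsAlmostDirectProduct (slTwoCopies F 3 p).normalizer (scalarHom F _) (sl2slMixing F 3) := by
  have hscalar : ∀ {S T} {c : Fˣ}, scalarHom F _ c = sl2slMixing F 3 (S, T) →
      ∃ s t : F, S.val = s • 1 ∧ T.val = t • 1 ∧ s * t = c ∧ s ^ 2 = 1 ∧ t ^ 3 = 1 := by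
    intro S T c h
    obtain ⟨s, t, hs, ht, hst⟩ := eq_smul_one_of_mixing_eq_scalar (by norm_num) h.symm
    exact ⟨s, t, hs, ht, hst, pow_eq_one_of_specialLinear hs, pow_eq_one_of_specialLinear ht⟩
  refine .of_commute scalarHom_injective ?_ (fun c _ => scalarHom_commute c _) (fun h => ?_) ?_
  · rw [injective_iff_map_eq_one]
    rintro ⟨S, T⟩ h
    obtain ⟨s, t, hS, hT, hst, hs, ht⟩ := hscalar (S := S) (T := T) (c := 1) (by rw [h, map_one])
    rw [Units.val_one] at hst
    have ht1 : t = 1 := by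
      have : t ^ 2 = 1 := by
        have := congrArg (· ^ 2) hst
        simpa [mul_pow, hs] using this
      rw [pow_succ, this, one_mul] at ht
      exact ht
    rw [ht1, mul_one] at hst
    rw [hst, one_smul] at hS
    rw [ht1, one_smul] at hT
    exact Prod.ext (Subtype.ext hS) (Subtype.ext hT)
  · rw [mem_normalizer_slTwoCopies (by norm_num)]
    constructor
    · rintro ⟨A, B, rfl⟩
      obtain ⟨c, S, T, h⟩ := exists_scalar_mul_sl2slMixing (by norm_num) A B
      exact ⟨c, (S, T), h⟩
    · rintro ⟨c, ⟨S, T⟩, rfl⟩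
      exact ⟨_, _, exists_gl_of_scalar_mul_sl2slMixing c S T⟩
  · refine (finite_setOf_units_pow_eq_one (n := 6) (by norm_num)).subset ?_
    rintro c ⟨⟨S, T⟩, h⟩
    obtain ⟨s, t, -, -, hst, hs, ht⟩ := hscalar h
    change (c : F) ^ 6 = 1
    rw [← hst, mul_pow, show s ^ 6 = (s ^ 2) ^ 3 by ring, show t ^ 6 = (t ^ 3) ^ 2 by ring, hs, ht]
    norm_num

end TwoCopiesMax


/-! ### `sl_2` on `F² ⊕ F²` and the special orthogonal group -/

section SpecialOrthogonalFour

variable {F : Type*} [Field F]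

/-- The coordinates on `F² ⊕ F²`. -/
def coordsFour (F : Type*) [Field F] : (Fin 2 → Fin 2 → F) ≃ₗ[F] (Fin 4 → F) where
  toFun v := ![v 0 0, v 0 1, v 1 0, v 1 1]
  map_add' v w := by ext i; fin_cases i <;> simp
  map_smul' c v := by ext i; fin_cases i <;> simp
  invFun w := ![![w 0, w 1], ![w 2, w 3]]
  left_inv v := by ext i j; fin_cases i <;> fin_cases j <;> simp
  right_inv w := by ext i; fin_cases i <;> simp

/-- The matrix of an endomorphism of `F² ⊕ F²`. -/
def matrixFour (F : Type*) [Field F] :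
    Module.End F (Fin 2 → Fin 2 → F) ≃ₐ[F] Matrix (Fin 4) (Fin 4) F :=
  ((coordsFour F).conjAlgEquiv F).trans LinearMap.toMatrixAlgEquiv'

theorem matrixFour_apply (T : Module.End F (Fin 2 → Fin 2 → F)) :
    matrixFour F T = LinearMap.toMatrix' ((coordsFour F).conj T) := rfl

theorem det_matrixFour (T : Module.End F (Fin 2 → Fin 2 → F)) :
    (matrixFour F T).det = LinearMap.det T := by
  rw [matrixFour_apply, LinearMap.det_toMatrix']
  exact LinearMap.det_conj T (coordsFour F)

theorem matrixFour_diagAction (x : Matrix (Fin 2) (Fin 2) F) :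
    matrixFour F (diagAction F 2 x) = !![x 0 0, x 0 1, 0, 0; x 1 0, x 1 1, 0, 0;
      0, 0, x 0 0, x 0 1; 0, 0, x 1 0, x 1 1] := by
  ext i j
  rw [matrixFour_apply, LinearMap.toMatrix'_apply]
  fin_cases i <;> fin_cases j <;>
    simp [LinearEquiv.conj_apply, coordsFour, diagAction, Matrix.mulVec, dotProduct, Fin.sum_univ_two]

theorem matrixFour_gl2Mixing (A : GL (Fin 2) F) :
    matrixFour F (gl2Mixing F 2 A : Module.End F _) =
      !![A.val 0 0, 0, A.val 0 1, 0; 0, A.val 0 0, 0, A.val 0 1;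
        A.val 1 0, 0, A.val 1 1, 0; 0, A.val 1 0, 0, A.val 1 1] := by
  ext i j
  rw [matrixFour_apply, LinearMap.toMatrix'_apply]
  fin_cases i <;> fin_cases j <;>
    simp [LinearEquiv.conj_apply, coordsFour, gl2Mixing_apply]

/-- The Gram matrix of the polarized determinant of a `2 × 2` matrix. -/
def gramFour (F : Type*) [Field F] : Matrix (Fin 4) (Fin 4) F :=
  !![0, 0, 0, 1; 0, 0, -1, 0; 0, -1, 0, 0; 1, 0, 0, 0]

theorem gramFour_mul_self : gramFour F * gramFour F = 1 := by
  ext i j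
  fin_cases i <;> fin_cases j <;> simp [gramFour, Matrix.mul_apply, Fin.sum_univ_four]

/-- The polarized determinant on `F² ⊕ F²`. -/
def formFour (F : Type*) [Field F] : LinearMap.BilinForm F (Fin 2 → Fin 2 → F) :=
  (Matrix.toBilin' (gramFour F)).comp (coordsFour F).toLinearMap (coordsFour F).toLinearMap

theorem formFour_apply (v w : Fin 2 → Fin 2 → F) :
    formFour F v w = v 0 0 * w 1 1 - v 0 1 * w 1 0 - v 1 0 * w 0 1 + v 1 1 * w 0 0 := by
  simp [formFour, Matrix.toBilin'_apply, coordsFour, gramFour, Fin.sum_univ_four]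
  ring

theorem formFour_isSymm : (formFour F).IsSymm :=
  ⟨fun v w => by simp only [formFour_apply]; ring⟩

theorem formFour_nondegenerate : (formFour F).Nondegenerate := by
  have h1 : ∀ v, (∀ w, formFour F v w = 0) → v = 0 := by
    intro v hv
    have e := fun i j => hv (Pi.single i (Pi.single j 1))
    simp only [formFour_apply] at e
    have e00 := e 0 0
    have e01 := e 0 1
    have e10 := e 1 0
    have e11 := e 1 1
    simp at e00 e01 e10 e11
    ext i j
    fin_cases i <;> fin_cases j <;> simp [*]
  exact ⟨h1, fun w hw => h1 w fun v => by
    rw [← hw v]; simp only [formFour_apply]; ring⟩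

theorem preserves_formFour_iff {T : Module.End F (Fin 2 → Fin 2 → F)} :
    (∀ v w, formFour F (T v) (T w) = formFour F v w) ↔
      (matrixFour F T).transpose * gramFour F * matrixFour F T = gramFour F := by
  have h1 : (Matrix.toBilin' (gramFour F)).comp ((coordsFour F).conj T) ((coordsFour F).conj T) =
      Matrix.toBilin' ((matrixFour F T).transpose * gramFour F * matrixFour F T) := by
    rw [matrixFour_apply, ← Matrix.toBilin'_comp, Matrix.toLin'_toMatrix']
  constructor
  · intro h
    apply (Matrix.toBilin' : Matrix (Fin 4) (Fin 4) F ≃ₗ[F] _).injective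
    rw [← h1]
    refine LinearMap.ext₂ fun v w => ?_
    have := h ((coordsFour F).symm v) ((coordsFour F).symm w)
    simpa [formFour, LinearEquiv.conj_apply] using this
  · intro h v w
    rw [h] at h1
    have := LinearMap.congr_fun₂ h1 (coordsFour F v) (coordsFour F w)
    simpa [formFour, LinearEquiv.conj_apply] using this

/-- The first hypothesis places `X` in `so_4`. The second is a self-duality condition selecting, of
the two ideals `sl_2` of `so_4`, the one acting diagonally. -/
theorem exists_diagAction_of_selfDual [CharZero F] {X : Module.End F (Fin 2 → Fin 2 → F)}
    (h1 : (gramFour F * matrixFour F X).transpose = -(gramFour F * matrixFour F X))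
    (h2 : hodge F (gramFour F * matrixFour F X) = -(matrixFour F X * gramFour F)) :
    ∃ x : Matrix (Fin 2) (Fin 2) F, x.trace = 0 ∧ X = diagAction F 2 x := by
  obtain ⟨C, hC⟩ : ∃ C, gramFour F * matrixFour F X = C := ⟨_, rfl⟩
  have hX : matrixFour F X = gramFour F * C := by
    rw [← hC, ← mul_assoc, gramFour_mul_self, one_mul]
  rw [hC] at h1 h2
  rw [hX] at h2
  have hCs := skew_eq F h1
  generalize C 0 1 = c₁ at hCs
  generalize C 0 2 = c₂ at hCs
  generalize C 0 3 = c₃ at hCs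
  generalize C 1 2 = c₄ at hCs
  generalize C 1 3 = c₅ at hCs
  generalize C 2 3 = c₆ at hCs
  subst hCs
  have e01 := congrFun (congrFun h2 0) 1
  have e23 := congrFun (congrFun h2 2) 3
  have e03 := congrFun (congrFun h2 0) 3
  simp [hodge, gramFour] at e01 e23 e03
  rw [self_eq_neg] at e01 e23
  refine ⟨!![-c₃, -c₅; c₂, c₄], by simp [Matrix.trace_fin_two, e03], ?_⟩
  apply (matrixFour F).injective
  rw [matrixFour_diagAction, hX]
  ext i j
  fin_cases i <;> fin_cases j <;> simp [gramFour, e01, e23, e03]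

theorem selfDual_diagAction {x : Matrix (Fin 2) (Fin 2) F} (hx : x.trace = 0) :
    (gramFour F * matrixFour F (diagAction F 2 x)).transpose =
        -(gramFour F * matrixFour F (diagAction F 2 x)) ∧
      hodge F (gramFour F * matrixFour F (diagAction F 2 x)) =
        -(matrixFour F (diagAction F 2 x) * gramFour F) := by
  rw [Matrix.trace_fin_two] at hx
  have h11 : x 1 1 = -x 0 0 := by linear_combination hx
  rw [matrixFour_diagAction]
  constructor
  · ext i j
    fin_cases i <;> fin_cases j <;> simp [gramFour, h11]
  · ext i j
    fin_cases i <;> fin_cases j <;> simp [hodge, gramFour, h11]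

theorem mem_specialOrthogonal_iff {h : LinearMap.GeneralLinearGroup F (Fin 2 → Fin 2 → F)} :
    h ∈ specialOrthogonal (formFour F) ↔ (matrixFour F (h : Module.End F _)).det = 1 ∧
      (matrixFour F (h : Module.End F _)).transpose * gramFour F *
        matrixFour F (h : Module.End F _) = gramFour F := by
  rw [det_matrixFour, ← preserves_formFour_iff]
  rfl

/-- The matrix of an automorphism of `F² ⊕ F²`. -/
def matrixFourUnits (F : Type*) [Field F] :
    LinearMap.GeneralLinearGroup F (Fin 2 → Fin 2 → F) →* GL (Fin 4) F :=
  Units.map (matrixFour F : _ →* _)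

/-- An isometry carries `GX` to a congruent matrix, and the Hodge star commutes with congruence up
to the determinant. Determinant `1` therefore preserves the self-dual ideal; determinant `-1` would
exchange it with the other. -/
theorem specialOrthogonal_le_normalizer [CharZero F] (p : ZMod 2) :
    specialOrthogonal (formFour F) ≤ (slTwoCopies F 2 p).normalizer := by
  intro h hh
  rw [slTwoCopies, mem_normalizer_ofLie_iff]
  intro x
  obtain ⟨hdet, hform⟩ := mem_specialOrthogonal_iff.1 hh
  set H : GL (Fin 4) F := matrixFourUnits F h with hH
  have hHv : matrixFour F (h : Module.End F _) = H.val := rfl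
  rw [hHv] at hdet hform
  obtain ⟨h1, h2⟩ := selfDual_diagAction (trace_slVal x)
  set X := matrixFour F (diagAction F 2 (slVal F 2 x)) with hX
  set G := gramFour F with hG
  have hGG : G * G = 1 := gramFour_mul_self
  have hHt : H⁻¹.val.transpose * H.val.transpose = 1 := by
    rw [← Matrix.transpose_mul, H.mul_inv, Matrix.transpose_one]
  have hX' : matrixFour F (conjEquiv h (diagAction F 2 (slVal F 2 x))) = H.val * X * H⁻¹.val := by
    rw [conjEquiv_apply, map_mul, map_mul]
    rfl
  have e1 : G * (H.val * X * H⁻¹.val) = H⁻¹.val.transpose * (G * X) * H⁻¹.val := by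
    have : G * H.val = H⁻¹.val.transpose * G := by
      rw [← hform, ← mul_assoc, ← mul_assoc, hHt, one_mul, hform]
    rw [← mul_assoc, ← mul_assoc, this]
    simp only [mul_assoc]
  -- The isometry condition in its transposed form, obtained because a left inverse of a square
  -- matrix is a right inverse.
  have e2 : H.val * G * H.val.transpose = G := by
    have h3 : (G * H.val.transpose * G) * H.val = 1 := by
      rw [mul_assoc G, mul_assoc G, hform, hGG]
    have h4 := mul_eq_one_comm.1 h3
    calc H.val * G * H.val.transpose = H.val * (G * H.val.transpose * G) * G := by
          simp only [mul_assoc, hGG, mul_one]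
      _ = G := by rw [h4, one_mul]
  obtain ⟨y, hy, hy'⟩ := exists_diagAction_of_selfDual
      (X := conjEquiv h (diagAction F 2 (slVal F 2 x))) (by
    rw [hX', e1, Matrix.transpose_mul, Matrix.transpose_mul, h1, Matrix.transpose_transpose]
    simp only [Matrix.neg_mul, Matrix.mul_neg, mul_assoc]) (by
    rw [hX', e1]
    have h5 := mul_hodge_mul_transpose H h1
    rw [hdet, one_smul] at h5
    rw [← h5, h2]
    calc H.val * -(X * G) * H.val.transpose
        = -(H.val * X * (H⁻¹.val * H.val) * G * H.val.transpose) := by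
          rw [H.inv_mul]; simp [mul_assoc]
      _ = -(H.val * X * H⁻¹.val * (H.val * G * H.val.transpose)) := by simp only [mul_assoc]
      _ = _ := by rw [e2])
  obtain ⟨z, hz⟩ := exists_slVal_eq hy
  exact ⟨z, by rw [LinearMap.comp_apply, LinearMap.comp_apply, hz, hy']⟩

/-- The form polarizes the determinant of a `2 × 2` matrix, on which `S` and `T` act from the two
sides; each scales it by its own determinant and has determinant `(det)²` on `F⁴`. -/
theorem sl2slMixing_mem_specialOrthogonal (S T : Matrix.SpecialLinearGroup (Fin 2) F) :
    sl2slMixing F 2 (S, T) ∈ specialOrthogonal (formFour F) := by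
  have hS := S.2
  have hT := T.2
  rw [Matrix.det_fin_two] at hS hT
  constructor
  · rw [sl2slMixing_apply, Units.val_mul, map_mul, ← det_matrixFour, ← det_matrixFour,
      matrixFour_gl2Mixing, coe_glDiag, matrixFour_diagAction]
    have h1 : ∀ a b c d : F, (!![a, b, 0, 0; c, d, 0, 0; 0, 0, a, b; 0, 0, c, d] :
        Matrix (Fin 4) (Fin 4) F).det = (a * d - b * c) ^ 2 := by
      intro a b c d
      rw [Matrix.det_succ_row_zero]
      simp [Fin.sum_univ_four, Matrix.det_fin_three, Matrix.submatrix_apply, Fin.succAbove]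
      ring
    have h2 : ∀ a b c d : F, (!![a, 0, b, 0; 0, a, 0, b; c, 0, d, 0; 0, c, 0, d] :
        Matrix (Fin 4) (Fin 4) F).det = (a * d - b * c) ^ 2 := by
      intro a b c d
      rw [Matrix.det_succ_row_zero]
      simp [Fin.sum_univ_four, Matrix.det_fin_three, Matrix.submatrix_apply, Fin.succAbove]
      ring
    rw [h1, h2]
    change (S.val 0 0 * S.val 1 1 - S.val 0 1 * S.val 1 0) ^ 2 *
      (T.val 0 0 * T.val 1 1 - T.val 0 1 * T.val 1 0) ^ 2 = 1
    rw [hS, hT]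
    norm_num
  · have hg : ∀ v w, formFour F ((gl2Mixing F 2 (Matrix.SpecialLinearGroup.toGL S) :
        Module.End F _) v) ((gl2Mixing F 2 (Matrix.SpecialLinearGroup.toGL S) :
        Module.End F _) w) = formFour F v w := by
      intro v w
      simp only [formFour_apply, gl2Mixing_apply, Pi.add_apply, Pi.smul_apply, smul_eq_mul]
      change (S.val 0 0 * v 0 0 + S.val 0 1 * v 1 0) * (S.val 1 0 * w 0 1 + S.val 1 1 * w 1 1) -
        (S.val 0 0 * v 0 1 + S.val 0 1 * v 1 1) * (S.val 1 0 * w 0 0 + S.val 1 1 * w 1 0) -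
        (S.val 1 0 * v 0 0 + S.val 1 1 * v 1 0) * (S.val 0 0 * w 0 1 + S.val 0 1 * w 1 1) +
        (S.val 1 0 * v 0 1 + S.val 1 1 * v 1 1) * (S.val 0 0 * w 0 0 + S.val 0 1 * w 1 0) = _
      linear_combination (v 0 0 * w 1 1 - v 0 1 * w 1 0 - v 1 0 * w 0 1 + v 1 1 * w 0 0) * hS
    have hd : ∀ v w, formFour F ((glDiag F 2 (Matrix.SpecialLinearGroup.toGL T) :
        Module.End F _) v) ((glDiag F 2 (Matrix.SpecialLinearGroup.toGL T) :
        Module.End F _) w) = formFour F v w := by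
      intro v w
      simp only [formFour_apply, coe_glDiag, diagAction_apply, Matrix.mulVec, dotProduct,
        Fin.sum_univ_two]
      change (T.val 0 0 * v 0 0 + T.val 0 1 * v 0 1) * (T.val 1 0 * w 1 0 + T.val 1 1 * w 1 1) -
        (T.val 1 0 * v 0 0 + T.val 1 1 * v 0 1) * (T.val 0 0 * w 1 0 + T.val 0 1 * w 1 1) -
        (T.val 0 0 * v 1 0 + T.val 0 1 * v 1 1) * (T.val 1 0 * w 0 0 + T.val 1 1 * w 0 1) +
        (T.val 1 0 * v 1 0 + T.val 1 1 * v 1 1) * (T.val 0 0 * w 0 0 + T.val 0 1 * w 0 1) = _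
      linear_combination (v 0 0 * w 1 1 - v 0 1 * w 1 0 - v 1 0 * w 0 1 + v 1 1 * w 0 0) * hT
    intro v w
    rw [sl2slMixing_apply, Units.val_mul, Module.End.mul_apply, Module.End.mul_apply, hg, hd]

/-- The normalizer is generated by scalars and `SL_2 × SL_2`, which lies in `SO_4`; the reverse
inclusion is `specialOrthogonal_le_normalizer`. -/
theorem isAlmostDirectProduct_specialOrthogonal [CharZero F] [IsAlgClosed F] (p : ZMod 2) :
    IsAlmostDirectProduct (slTwoCopies F 2 p).normalizer (scalarHom F (Fin 2 → Fin 2 → F))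
      (specialOrthogonal (formFour F)).subtype := by
  refine .of_commute scalarHom_injective Subtype.val_injective (fun c _ => scalarHom_commute c _)
    (fun h => ?_) ?_
  · constructor
    · intro hh
      obtain ⟨A, B, rfl⟩ := (mem_normalizer_slTwoCopies (by norm_num) p).1 hh
      obtain ⟨c, S, T, h⟩ := exists_scalar_mul_sl2slMixing (by norm_num) A B
      exact ⟨c, ⟨_, sl2slMixing_mem_specialOrthogonal S T⟩, h⟩
    · rintro ⟨c, k, rfl⟩
      refine mul_mem ((mem_normalizer_slTwoCopies (by norm_num) p).2 ⟨c • 1, 1, ?_⟩)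
        (specialOrthogonal_le_normalizer p k.2)
      have := exists_gl_of_scalar_mul_sl2slMixing (n := 2) c 1 1
      rw [map_one, map_one, ← Prod.one_eq_mk, map_one, mul_one, mul_one] at this
      rwa [map_one (glDiag F 2), mul_one]
  · refine (finite_setOf_units_pow_eq_one (n := 2) (by norm_num)).subset ?_
    rintro c ⟨⟨k, hk⟩, h⟩
    -- The form takes the value `1` on this pair, so a scalar isometry has `c² = 1`.
    have h1 := hk.2 (Pi.single 0 (Pi.single 0 1)) (Pi.single 1 (Pi.single 1 1))
    replace h : scalarHom F _ c = k := h
    rw [← h, scalarHom_apply, scalarHom_apply, formFour_apply, formFour_apply] at h1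
    simp at h1
    change (c : F) ^ 2 = 1
    rw [sq]; exact h1

end SpecialOrthogonalFour


/-! ### `sl_2 ⊕ sl_3` on `F³ ⊠ F²` -/

section BoxMax

variable {F : Type*} [Field F]

/-- The operator `a ⊗ b` on `F³ ⊠ F²`. -/
def boxMap (a : Matrix (Fin 3) (Fin 3) F) (b : Matrix (Fin 2) (Fin 2) F) :
    Module.End F ((Fin 3 → F) ⊗[F] (Fin 2 → F)) :=
  TensorProduct.map (Matrix.toLin' a) (Matrix.toLin' b)

theorem boxMap_mul (a a' : Matrix (Fin 3) (Fin 3) F) (b b' : Matrix (Fin 2) (Fin 2) F) :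
    boxMap a b * boxMap a' b' = boxMap (a * a') (b * b') := by
  simp [boxMap, Matrix.toLin'_mul, Module.End.mul_eq_comp, TensorProduct.map_comp]

theorem boxMap_one : boxMap (1 : Matrix (Fin 3) (Fin 3) F) (1 : Matrix (Fin 2) (Fin 2) F) = 1 := by
  simp [boxMap, Module.End.one_eq_id]

theorem boxMap_tmul (a : Matrix (Fin 3) (Fin 3) F) (b : Matrix (Fin 2) (Fin 2) F)
    (v : Fin 3 → F) (w : Fin 2 → F) :
    boxMap a b (v ⊗ₜ w) = Matrix.mulVec a v ⊗ₜ Matrix.mulVec b w := by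
  simp [boxMap]

theorem trace_boxMap (a : Matrix (Fin 3) (Fin 3) F) (b : Matrix (Fin 2) (Fin 2) F) :
    LinearMap.trace F _ (boxMap a b) = a.trace * b.trace := by
  rw [boxMap, LinearMap.trace_tensorProduct', Matrix.trace_toLin'_eq, Matrix.trace_toLin'_eq]

/-- Evaluation of the second factor at the first coordinate. -/
def boxSlice (F : Type*) [Field F] : (Fin 3 → F) ⊗[F] (Fin 2 → F) →ₗ[F] (Fin 3 → F) :=
  (TensorProduct.rid F _).toLinearMap ∘ₗ TensorProduct.map LinearMap.id (LinearMap.proj 0)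

theorem boxSlice_tmul (v : Fin 3 → F) (w : Fin 2 → F) : boxSlice F (v ⊗ₜ w) = w 0 • v := by
  simp [boxSlice]

theorem boxMap_smul_left (s : F) (a : Matrix (Fin 3) (Fin 3) F) (b : Matrix (Fin 2) (Fin 2) F) :
    boxMap (s • a) b = s • boxMap a b := by
  simp [boxMap, TensorProduct.map_smul_left]

theorem boxMap_smul_right (s : F) (a : Matrix (Fin 3) (Fin 3) F) (b : Matrix (Fin 2) (Fin 2) F) :
    boxMap a (s • b) = s • boxMap a b := by
  simp [boxMap, TensorProduct.map_smul_right]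

theorem boxMap_add_right (a : Matrix (Fin 3) (Fin 3) F) (b b' : Matrix (Fin 2) (Fin 2) F) :
    boxMap a (b + b') = boxMap a b + boxMap a b' := by
  simp [boxMap, TensorProduct.map_add_right]

theorem boxMap_left_injective : Function.Injective
    fun a : Matrix (Fin 3) (Fin 3) F => boxMap a (1 : Matrix (Fin 2) (Fin 2) F) := by
  intro a a' h
  apply Matrix.toLin'.injective
  refine LinearMap.ext fun v => ?_
  have := congrArg (boxSlice F) (LinearMap.congr_fun h (v ⊗ₜ Pi.single 0 1))
  simpa [boxMap_tmul, boxSlice_tmul] using this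

/-- The operators `1 ⊗ b` as a homomorphism of algebras. -/
def boxRight (F : Type*) [Field F] :
    Matrix (Fin 2) (Fin 2) F →ₐ[F] Module.End F ((Fin 3 → F) ⊗[F] (Fin 2 → F)) :=
  AlgHom.ofLinearMap
    { toFun := fun b => boxMap 1 b
      map_add' := fun b b' => boxMap_add_right _ _ _
      map_smul' := fun c b => boxMap_smul_right _ _ _ }
    boxMap_one (fun b b' => by
      change boxMap 1 (b * b') = boxMap 1 b * boxMap 1 b'
      rw [boxMap_mul, mul_one])

theorem boxRight_apply (b : Matrix (Fin 2) (Fin 2) F) : boxRight F b = boxMap 1 b := rfl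

theorem boxRight_injective : Function.Injective (boxRight F) := (boxRight F).toRingHom.injective

/-- The commutant of `1 ⊗ M_2` is `M_3 ⊗ 1`. The rank-one matrix `X` carries `v ⊗ e` to `v ⊗ w`, so
`T` is determined by its values on `F³ ⊗ e`. -/
theorem exists_boxMap_of_commute {T : Module.End F ((Fin 3 → F) ⊗[F] (Fin 2 → F))}
    (hT : ∀ b, T * boxMap 1 b = boxMap 1 b * T) : ∃ a, T = boxMap a 1 := by
  let e : Fin 2 → F := Pi.single 0 1
  let a : Module.End F (Fin 3 → F) := boxSlice F ∘ₗ T ∘ₗ (TensorProduct.mk F _ _).flip e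
  refine ⟨LinearMap.toMatrix' a, TensorProduct.ext' fun v w => ?_⟩
  let X : Matrix (Fin 2) (Fin 2) F := Matrix.vecMulVec w e
  have hX : ∀ u, Matrix.mulVec X u = u 0 • w := by
    intro u
    rw [Matrix.vecMulVec_mulVec]
    ext; simp [e, mul_comm]
  have h1 : ∀ z, boxMap 1 X z = boxSlice F z ⊗ₜ w := by
    intro z
    induction z with
    | zero => simp
    | tmul x y => rw [boxMap_tmul, hX, boxSlice_tmul, Matrix.one_mulVec, TensorProduct.tmul_smul,
        TensorProduct.smul_tmul']
    | add x y hx hy => rw [map_add, map_add, hx, hy, TensorProduct.add_tmul]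
  have h2 : boxMap 1 X (v ⊗ₜ e) = v ⊗ₜ w := by
    rw [h1, boxSlice_tmul]; simp [e]
  have h3 := LinearMap.congr_fun (hT X) (v ⊗ₜ e)
  rw [Module.End.mul_apply, h2, Module.End.mul_apply, h1] at h3
  rw [h3, boxMap_tmul, Matrix.one_mulVec, LinearMap.toMatrix'_mulVec]
  rfl

/-- `GL_3 × GL_2` acting on `F³ ⊠ F²`. -/
def boxUnits (F : Type*) [Field F] : GL (Fin 3) F × GL (Fin 2) F →*
    LinearMap.GeneralLinearGroup F ((Fin 3 → F) ⊗[F] (Fin 2 → F)) :=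
  MonoidHom.toHomUnits
    { toFun := fun A => boxMap A.1.val A.2.val
      map_one' := boxMap_one
      map_mul' := fun _ _ => (boxMap_mul _ _ _ _).symm }

theorem coe_boxUnits (A : GL (Fin 3) F) (B : GL (Fin 2) F) :
    (boxUnits F (A, B) : Module.End F _) = boxMap A.val B.val := rfl

theorem conj_boxUnits (A : GL (Fin 3) F) (B : GL (Fin 2) F) (a : Matrix (Fin 3) (Fin 3) F)
    (b : Matrix (Fin 2) (Fin 2) F) : conjEquiv (boxUnits F (A, B)) (boxMap a b) =
      boxMap (A.val * a * A⁻¹.val) (B.val * b * B⁻¹.val) := by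
  rw [conjEquiv_mem_iff, coe_boxUnits, boxMap_mul, boxMap_mul]
  simp [mul_assoc]

theorem exists_boxUnits_of_normalizes {h : LinearMap.GeneralLinearGroup F ((Fin 3 → F) ⊗[F] (Fin 2 → F))}
    (hh : ∀ b, ∃ b', conjEquiv h (boxMap 1 b) = boxMap 1 b') : ∃ A B, boxUnits F (A, B) = h := by
  obtain ⟨B, hB⟩ := exists_conj_of_normalizes (φ := boxRight F) boxRight_injective hh
  set u := (boxUnits F (1, B))⁻¹ * h with hu
  have hc : ∀ b, (u : Module.End F _) * boxMap 1 b = boxMap 1 b * (u : Module.End F _) := fun b =>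
    commute_inv_mul_of_conj_eq (hB b) (by rw [conj_boxUnits]; simp [boxRight_apply])
  obtain ⟨a, ha⟩ := exists_boxMap_of_commute hc
  obtain ⟨a', ha'⟩ := exists_boxMap_of_commute (T := ((u⁻¹ : LinearMap.GeneralLinearGroup F _) :
    Module.End F _)) fun b =>
      ((show Commute (u : Module.End F _) (boxMap 1 b) from hc b).units_inv_left).eq
  have h1 : a * a' = 1 := boxMap_left_injective (by
    have := u.mul_inv
    rw [ha, ha', boxMap_mul, one_mul] at this
    exact this.trans boxMap_one.symm)
  have h2 : a' * a = 1 := mul_eq_one_comm.1 h1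
  refine ⟨⟨a, a', h1, h2⟩, B, ?_⟩
  have h3 : boxUnits F (⟨a, a', h1, h2⟩, 1) = u := Units.ext ha.symm
  have h4 : boxUnits F (1, B) * u = h := by rw [hu, mul_inv_cancel_left]
  rw [← h4, ← h3, ← map_mul]
  simp

theorem eq_smul_one_of_boxUnits_eq_scalar {A : GL (Fin 3) F} {B : GL (Fin 2) F} {c : Fˣ}
    (h : boxUnits F (A, B) = scalarHom F _ c) :
    ∃ s t : F, A.val = s • 1 ∧ B.val = t • 1 ∧ s * t = c := by
  have h1 : ∀ b, B.val * b = b * B.val := by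
    intro b
    have h2 := scalarHom_mul_comm c (boxMap 1 b)
    rw [← conjEquiv_mem_iff, ← h, conj_boxUnits, mul_one, A.mul_inv] at h2
    have h3 := boxRight_injective h2
    conv_rhs => rw [← h3]
    rw [mul_assoc, B.inv_mul, mul_one]
  obtain ⟨t, ht⟩ := eq_smul_one_of_commute_single (N := B.val) fun i j _ => (h1 _).symm
  have ht0 : t ≠ 0 := by
    rintro rfl
    exact B.ne_zero (by rw [ht, zero_smul])
  have h4 : boxMap (t • A.val) 1 = boxMap ((c : F) • 1) (1 : Matrix (Fin 2) (Fin 2) F) := by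
    rw [boxMap_smul_left, ← boxMap_smul_right, ← ht, boxMap_smul_left, boxMap_one]
    exact congrArg Units.val h
  have h5 := boxMap_left_injective h4
  refine ⟨t⁻¹ * c, t, ?_, ht, by field_simp⟩
  rw [mul_smul, ← h5, inv_smul_smul₀ ht0]

theorem slBox_apply (p : ZMod 2)
    (x : LieAlgebra.SpecialLinear.sl (Fin 2) F × LieAlgebra.SpecialLinear.sl (Fin 3) F) :
    (slBox F p).ρ x = boxMap (slVal F 3 x.2) 1 + boxMap 1 (slVal F 2 x.1) := by
  simp [slBox, LieSuperalgebra.Rep.ofLie, boxMap]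

/-- By Cayley–Hamilton the square of a traceless `2 × 2` matrix is scalar. -/
theorem trace_mul_sq_two {b d : Matrix (Fin 2) (Fin 2) F} (hb : b.trace = 0) (hd : d.trace = 0) :
    (b * (d * d)).trace = 0 := by
  rw [Matrix.trace_fin_two] at hb hd
  have h1 : b 1 1 = -b 0 0 := by linear_combination hb
  have h2 : d 1 1 = -d 0 0 := by linear_combination hd
  simp only [Matrix.trace_fin_two, Matrix.mul_apply, Fin.sum_univ_two, h1, h2]
  ring

/-- Each mixed term contains the trace of a traceless matrix, and the pure `sl_2` term vanishes by
`trace_mul_sq_two`. The cubic trace form thus sees only the `sl_3` components. -/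
theorem trace_slBox (p : ZMod 2)
    (x z : LieAlgebra.SpecialLinear.sl (Fin 2) F × LieAlgebra.SpecialLinear.sl (Fin 3) F) :
    LinearMap.trace F _ ((slBox F p).ρ x * ((slBox F p).ρ z * (slBox F p).ρ z)) =
      2 * (slVal F 3 x.2 * (slVal F 3 z.2 * slVal F 3 z.2)).trace := by
  have h1 := trace_mul_sq_two (trace_slVal x.1) (trace_slVal z.1)
  simp only [slBox_apply, mul_add, add_mul, boxMap_mul, mul_one, one_mul, map_add, trace_boxMap,
    trace_slVal, h1, Matrix.trace_one, Fintype.card_fin]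
  push_cast
  ring

/-- The square of `E_ij + E_jk` is `E_ik`, which isolates the off-diagonal entries; the square of
`E_ij + E_ji` is `E_ii + E_jj`, which with the trace kills the diagonal. -/
theorem eq_zero_of_trace_mul_sq {a : Matrix (Fin 3) (Fin 3) F} (ha : a.trace = 0)
    (h : ∀ c : Matrix (Fin 3) (Fin 3) F, c.trace = 0 → (a * (c * c)).trace = 0) : a = 0 := by
  have hoff : ∀ i j k : Fin 3, i ≠ j → j ≠ k → i ≠ k → a k i = 0 := by
    intro i j k hij hjk hik
    have := h (Matrix.single i j 1 + Matrix.single j k 1) (by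
      simp [Matrix.trace_single_eq_of_ne, hij, hjk])
    simpa [mul_add, add_mul, hij, hjk, hik, hij.symm, hik.symm, hjk.symm, Matrix.trace_mul_single] using this
  have hdiag : ∀ i j k : Fin 3, i ≠ j → j ≠ k → i ≠ k → a i i + a j j = 0 := by
    intro i j k hij hjk hik
    have := h (Matrix.single i j 1 + Matrix.single j i 1) (by
      simp [Matrix.trace_single_eq_of_ne, hij, hij.symm])
    rw [add_comm]
    simpa [mul_add, add_mul, hij, hij.symm, Matrix.trace_mul_single] using this
  rw [Matrix.trace_fin_three] at ha
  have h0 := hdiag 1 2 0 (by decide) (by decide) (by decide)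
  have h1 := hdiag 0 2 1 (by decide) (by decide) (by decide)
  have h2 := hdiag 0 1 2 (by decide) (by decide) (by decide)
  ext i j
  fin_cases i <;> fin_cases j
  · simp; linear_combination ha - h0
  · exact hoff 1 2 0 (by decide) (by decide) (by decide)
  · exact hoff 2 1 0 (by decide) (by decide) (by decide)
  · exact hoff 0 2 1 (by decide) (by decide) (by decide)
  · simp; linear_combination ha - h1
  · exact hoff 2 0 1 (by decide) (by decide) (by decide)
  · exact hoff 0 1 2 (by decide) (by decide) (by decide)
  · exact hoff 1 0 2 (by decide) (by decide) (by decide)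
  · simp; linear_combination ha - h2

/-- Characterizes the summand `sl_2` by traces on `V` alone, hence in a way that conjugation
preserves. -/
theorem slBox_snd_eq_zero [CharZero F] {p : ZMod 2}
    {x : LieAlgebra.SpecialLinear.sl (Fin 2) F × LieAlgebra.SpecialLinear.sl (Fin 3) F}
    (h : ∀ z, LinearMap.trace F _ ((slBox F p).ρ x * ((slBox F p).ρ z * (slBox F p).ρ z)) = 0) :
    slVal F 3 x.2 = 0 := by
  refine eq_zero_of_trace_mul_sq (trace_slVal _) fun c hc => ?_
  obtain ⟨y, rfl⟩ := exists_slVal_eq hc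
  have := h (0, y)
  rw [trace_slBox] at this
  simpa using this

theorem slBox_injective [CharZero F] (p : ZMod 2) : Function.Injective (slBox F p).ρ := by
  rw [injective_iff_map_eq_zero]
  rintro x hx
  have h2 : slVal F 3 x.2 = 0 := slBox_snd_eq_zero (p := p) fun z => by rw [hx]; simp
  have h1 : boxRight F (slVal F 2 x.1) = 0 := by
    rw [slBox_apply, h2] at hx
    simpa [boxMap, boxRight_apply] using hx
  have h3 : slVal F 2 x.1 = 0 := boxRight_injective (h1.trans (map_zero _).symm)
  exact Prod.ext (Subtype.ext h3) (Subtype.ext h2)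

/-- Since conjugation preserves traces, the induced automorphism maps the summand `sl_2` into
itself. Hence `h` normalizes `1 ⊗ M_2`, and the commutant supplies the `GL_3` factor. -/
theorem mem_normalizer_slBox [CharZero F] (p : ZMod 2)
    {h : LinearMap.GeneralLinearGroup F ((Fin 3 → F) ⊗[F] (Fin 2 → F))} :
    h ∈ (slBox F p).normalizer ↔ ∃ A B, boxUnits F (A, B) = h := by
  constructor
  · intro hh
    refine exists_boxUnits_of_normalizes fun b => ?_
    obtain ⟨y, t, rfl⟩ := exists_slVal_add_smul_one (by norm_num) b
    obtain ⟨σ, -, hσ⟩ := LieSuperalgebra.Rep.exists_automorphism (slBox_injective p) hh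
    have hy := hσ (y, 0)
    -- Surjectivity of `σ` lets the test element be written as `σ z`, so the trace is conjugated
    -- back to one involving `(y, 0)`, whose `sl_3` component is zero.
    have hz : slVal F 3 (σ (y, 0)).2 = 0 := slBox_snd_eq_zero (p := p) fun z => by
      obtain ⟨z, rfl⟩ := σ.surjective z
      rw [← hσ, ← hσ, ← conjEquiv_mul_apply, ← conjEquiv_mul_apply, conjEquiv_apply,
        LinearMap.trace_mul_comm, ← mul_assoc, Units.inv_mul, one_mul, trace_slBox]
      simp
    rw [slBox_apply, slBox_apply, hz] at hy
    refine ⟨slVal F 2 (σ (y, 0)).1 + t • 1, ?_⟩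
    have h0 : ∀ b : Matrix (Fin 2) (Fin 2) F, boxMap (0 : Matrix (Fin 3) (Fin 3) F) b = 0 := by
      simp [boxMap]
    rw [map_zero, h0, zero_add, zero_add] at hy
    rw [boxMap_add_right, boxMap_add_right, boxMap_smul_right, boxMap_one, map_add, map_smul,
      conjEquiv_one_apply, hy]
  · rintro ⟨A, B, rfl⟩
    rw [slBox, mem_normalizer_ofLie_iff]
    intro x
    obtain ⟨a, ha⟩ := exists_slVal_eq (x := A.val * slVal F 3 x.2 * A⁻¹.val)
      (by rw [trace_conj, trace_slVal])
    obtain ⟨b, hb⟩ := exists_slVal_eq (x := B.val * slVal F 2 x.1 * B⁻¹.val)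
      (by rw [trace_conj, trace_slVal])
    refine ⟨(b, a), ?_⟩
    change conjEquiv _ ((slBox F p).ρ x) = (slBox F p).ρ (b, a)
    rw [slBox_apply, slBox_apply, map_add, conj_boxUnits, conj_boxUnits, ha, hb, mul_one, mul_one,
      A.mul_inv, B.mul_inv]

theorem isAlmostDirectProduct_box [CharZero F] [IsAlgClosed F] (p : ZMod 2) :
    IsAlmostDirectProduct (slBox F p).normalizer (scalarHom F _) (sl2sl3Box F) := by
  have hbox : ∀ S T, sl2sl3Box F (S, T) = boxUnits F (Matrix.SpecialLinearGroup.toGL T,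
      Matrix.SpecialLinearGroup.toGL S) := fun S T => Units.ext rfl
  have hscalar : ∀ {S T} {c : Fˣ}, scalarHom F _ c = sl2sl3Box F (S, T) →
      ∃ s t : F, T.val = s • 1 ∧ S.val = t • 1 ∧ s * t = c ∧ s ^ 3 = 1 ∧ t ^ 2 = 1 := by
    intro S T c h
    obtain ⟨s, t, hs, ht, hst⟩ := eq_smul_one_of_boxUnits_eq_scalar ((hbox S T).symm.trans h.symm)
    exact ⟨s, t, hs, ht, hst, pow_eq_one_of_specialLinear hs, pow_eq_one_of_specialLinear ht⟩
  refine .of_commute scalarHom_injective ?_ (fun c _ => scalarHom_commute c _) (fun h => ?_) ?_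
  · rw [injective_iff_map_eq_one]
    rintro ⟨S, T⟩ h
    obtain ⟨s, t, hT, hS, hst, hs, ht⟩ := hscalar (S := S) (T := T) (c := 1) (by rw [h, map_one])
    rw [Units.val_one] at hst
    have hs1 : s = 1 := by
      have : s ^ 2 = 1 := by
        have := congrArg (· ^ 2) hst
        simpa [mul_pow, ht] using this
      rw [pow_succ, this, one_mul] at hs
      exact hs
    rw [hs1, one_mul] at hst
    rw [hst, one_smul] at hS
    rw [hs1, one_smul] at hT
    exact Prod.ext (Subtype.ext hS) (Subtype.ext hT)
  · rw [mem_normalizer_slBox]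
    constructor
    · rintro ⟨A, B, rfl⟩
      obtain ⟨c, T, hT⟩ := exists_specialLinear_smul (by norm_num) A
      obtain ⟨d, S, hS⟩ := exists_specialLinear_smul (by norm_num) B
      refine ⟨c * d, (S, T), Units.ext ?_⟩
      rw [coe_boxUnits, hT, hS, boxMap_smul_left, boxMap_smul_right, smul_smul]
      rfl
    · rintro ⟨c, ⟨S, T⟩, rfl⟩
      refine ⟨c • Matrix.SpecialLinearGroup.toGL T, Matrix.SpecialLinearGroup.toGL S, Units.ext ?_⟩
      exact boxMap_smul_left _ _ _
  · refine (finite_setOf_units_pow_eq_one (n := 6) (by norm_num)).subset ?_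
    rintro c ⟨⟨S, T⟩, h⟩
    obtain ⟨s, t, -, -, hst, hs, ht⟩ := hscalar h
    change (c : F) ^ 6 = 1
    rw [← hst, mul_pow, show s ^ 6 = (s ^ 3) ^ 2 by ring, show t ^ 6 = (t ^ 2) ^ 3 by ring, hs, ht]
    norm_num

end BoxMax


/-! ### `sl_5` on `Λ² F⁵` -/

section ExtSquareMax

variable {F : Type*} [Field F] {n : ℕ}

/-- The wedge product as a bilinear map. -/
def wedgeBilin (F W : Type*) [Field F] [AddCommGroup W] [Module F W] : W →ₗ[F] W →ₗ[F] ⋀[F]^2 W :=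
  LinearMap.mk₂ F wedge (wedge_add_left F) (wedge_smul_left F) (wedge_add_right F)
    (wedge_smul_right F)

theorem wedgeBilin_apply {W : Type*} [AddCommGroup W] [Module F W] (v w : W) :
    wedgeBilin F W v w = wedge v w := rfl

/-- The wedge product of two standard basis vectors. -/
def wedgeBasis (F : Type*) [Field F] {n : ℕ} (i j : Fin n) : ⋀[F]^2 (Fin n → F) :=
  wedge (Pi.single i 1) (Pi.single j 1)

theorem wedge_eq_sum (v w : Fin n → F) :
    wedge (F := F) v w = ∑ i, ∑ j, (v i * w j) • wedgeBasis F i j := by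
  have h : ∀ u : Fin n → F, u = ∑ i, u i • (Pi.single i 1 : Fin n → F) := by
    intro u
    ext j
    simp [Finset.sum_apply, Pi.single_apply]
  conv_lhs => rw [h v, h w]
  simp only [← wedgeBilin_apply, map_sum, LinearMap.sum_apply, map_smul, LinearMap.smul_apply,
    wedgeBasis, smul_smul, Finset.smul_sum]
  rw [Finset.sum_comm]
  simp only [mul_comm]

theorem wedgeBasis_hom_ext {N : Type*} [AddCommGroup N] [Module F N]
    {f g : ⋀[F]^2 (Fin n → F) →ₗ[F] N} (h : ∀ i j, f (wedgeBasis F i j) = g (wedgeBasis F i j)) :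
    f = g := by
  refine extSquare_hom_ext F fun v w => ?_
  simp only [wedge_eq_sum, map_sum, map_smul, h]

/-- The Plücker coordinates on `Λ² Fⁿ`. -/
def pluecker (F : Type*) [Field F] {n : ℕ} (i j : Fin n) : ⋀[F]^2 (Fin n → F) →ₗ[F] F :=
  exteriorPower.alternatingMapLinearEquiv
    { toFun := fun v => v 0 i * v 1 j - v 0 j * v 1 i
      map_update_add' := by
        intro _ v k a b
        fin_cases k <;> simp <;> ring
      map_update_smul' := by
        intro _ v k c a
        fin_cases k <;> simp <;> ring
      map_eq_zero_of_eq' := by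
        intro v k l hv hkl
        have h01 : v 0 = v 1 := by
          fin_cases k <;> fin_cases l <;> simp_all
        rw [h01]
        ring }

theorem pluecker_wedge (i j : Fin n) (v w : Fin n → F) :
    pluecker F i j (wedge v w) = v i * w j - v j * w i := by
  simp [pluecker, wedge, exteriorPower.alternatingMapLinearEquiv_apply_ιMulti]

/-- The sum runs over ordered pairs, so each basis bivector is counted twice. -/
theorem sum_pluecker_smul (s : ⋀[F]^2 (Fin n → F)) :
    ∑ i, ∑ j, pluecker F i j s • wedgeBasis F i j = (2 : F) • s := by
  have h : (∑ i, ∑ j, (pluecker F i j).smulRight (wedgeBasis F i j)) =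
      (2 : F) • (LinearMap.id : ⋀[F]^2 (Fin n → F) →ₗ[F] _) := by
    refine extSquare_hom_ext F fun v w => ?_
    simp only [LinearMap.sum_apply, LinearMap.smulRight_apply, pluecker_wedge, sub_smul,
      Finset.sum_sub_distrib, LinearMap.smul_apply, LinearMap.id_apply]
    rw [← wedge_eq_sum]
    have h2 : ∑ i, ∑ j, (v j * w i) • wedgeBasis F i j = wedge (F := F) w v := by
      rw [wedge_eq_sum]
      simp only [mul_comm]
    rw [h2, two_smul, sub_eq_add_neg]
    congr 1
    exact (eq_neg_of_add_eq_zero_left (wedge_swap F v w)).symm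
  have := LinearMap.congr_fun h s
  simpa [LinearMap.sum_apply] using this

/-- Writing `2T` as a sum of rank-one operators computes its trace without choosing a basis of `Λ²`.
-/
theorem two_mul_trace_extSquare (T : Module.End F (⋀[F]^2 (Fin n → F))) :
    2 * LinearMap.trace F _ T = ∑ i, ∑ j, pluecker F i j (T (wedgeBasis F i j)) := by
  have h : (2 : F) • T = ∑ i, ∑ j, (pluecker F i j).smulRight (T (wedgeBasis F i j)) := by
    refine LinearMap.ext fun s => ?_
    rw [LinearMap.smul_apply, ← map_smul, ← sum_pluecker_smul]
    simp [LinearMap.sum_apply]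
  rw [← smul_eq_mul, ← map_smul, h]
  simp only [map_sum, LinearMap.trace_smulRight]

/-- The action of a matrix on `Λ² Fⁿ` by derivations. -/
def wedgeDeriv (F : Type*) [Field F] (n : ℕ) :
    Matrix (Fin n) (Fin n) F →ₗ[F] Module.End F (⋀[F]^2 (Fin n → F)) :=
  extSquareDeriv F ∘ₗ (Matrix.toLin' : Matrix (Fin n) (Fin n) F ≃ₗ[F] _).toLinearMap

theorem wedgeDeriv_wedge (x : Matrix (Fin n) (Fin n) F) (v w : Fin n → F) :
    wedgeDeriv F n x (wedge v w) = wedge (Matrix.mulVec x v) w + wedge v (Matrix.mulVec x w) :=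
  extSquareDerivAux_wedge F _ v w

theorem sum_pluecker_wedge (x y : Matrix (Fin n) (Fin n) F) :
    ∑ i, ∑ j, pluecker F i j (wedge (Matrix.mulVec x (Pi.single i 1))
      (Matrix.mulVec y (Pi.single j 1))) = x.trace * y.trace - (x * y).trace := by
  simp only [pluecker_wedge, Matrix.mulVec_single_one, Matrix.col_apply, Finset.sum_sub_distrib,
    Matrix.trace, Matrix.diag_apply, Matrix.mul_apply, Finset.sum_mul_sum]
  congr 1
  rw [Finset.sum_comm]

theorem sum_pluecker_wedge_one_right (x : Matrix (Fin n) (Fin n) F) :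
    ∑ i, ∑ j, pluecker F i j (wedge (Matrix.mulVec x (Pi.single i 1)) (Pi.single j 1)) =
      n * x.trace - x.trace := by
  have := sum_pluecker_wedge x 1
  simpa only [Matrix.one_mulVec, Matrix.trace_one, mul_one, Fintype.card_fin, mul_comm] using this

theorem sum_pluecker_wedge_one_left (x : Matrix (Fin n) (Fin n) F) :
    ∑ i, ∑ j, pluecker F i j (wedge (Pi.single i 1) (Matrix.mulVec x (Pi.single j 1))) =
      n * x.trace - x.trace := by
  have := sum_pluecker_wedge 1 x
  simpa only [Matrix.one_mulVec, Matrix.trace_one, one_mul, Fintype.card_fin] using this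

theorem wedgeDeriv_one : wedgeDeriv F n 1 = (2 : F) • 1 := by
  refine extSquare_hom_ext F fun v w => ?_
  rw [wedgeDeriv_wedge, Matrix.one_mulVec, Matrix.one_mulVec, ← two_smul F]
  rfl

theorem coe_glExtSquare_wedge (A : GL (Fin 5) F) (v w : Fin 5 → F) :
    ((glExtSquare F A : LinearMap.GeneralLinearGroup F (⋀[F]^2 (Fin 5 → F))) :
      Module.End F (⋀[F]^2 (Fin 5 → F))) (wedge v w) =
      wedge (Matrix.mulVec A.val v) (Matrix.mulVec A.val w) := by
  change exteriorPower.map 2 (Matrix.toLin' A.val) (exteriorPower.ιMulti F 2 ![v, w]) = _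
  rw [exteriorPower.map_apply_ιMulti]
  refine congrArg (exteriorPower.ιMulti F 2) ?_
  funext i
  fin_cases i <;> simp

theorem conj_glExtSquare (A : GL (Fin 5) F) (x : Matrix (Fin 5) (Fin 5) F) :
    conjEquiv (glExtSquare F A) (wedgeDeriv F 5 x) = wedgeDeriv F 5 (A.val * x * A⁻¹.val) := by
  rw [conjEquiv_mem_iff]
  refine extSquare_hom_ext F fun v w => ?_
  simp only [Module.End.mul_apply, wedgeDeriv_wedge, coe_glExtSquare_wedge, map_add,
    Matrix.mulVec_mulVec, mul_assoc, A.inv_mul, mul_one]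

theorem trace_conjEquiv {V : Type*} [AddCommGroup V] [Module F V]
    (h : LinearMap.GeneralLinearGroup F V) (T : Module.End F V) :
    LinearMap.trace F V (conjEquiv h T) = LinearMap.trace F V T := by
  rw [conjEquiv_apply, LinearMap.trace_mul_comm, ← mul_assoc, Units.inv_mul, one_mul]

theorem wedgeDeriv_single_wedgeBasis {i j k : Fin n} (hij : i ≠ j) :
    wedgeDeriv F n (Matrix.single k i 1) (wedgeBasis F i j) = wedgeBasis F k j := by
  have h : (Matrix.single k i (1 : F)).mulVec (Pi.single j 1) = 0 := by
    ext l
    simp [hij]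
  have h' : (Matrix.single k i (1 : F)).mulVec (Pi.single i 1) = Pi.single k 1 := by
    ext l
    simp [Matrix.single_apply, Pi.single_apply, eq_comm]
  rw [wedgeBasis, wedgeDeriv_wedge, h, h']
  simp [← wedgeBilin_apply, wedgeBasis]

theorem wedgeBasis_swap (i j : Fin n) : wedgeBasis F i j = -wedgeBasis F j i :=
  eq_neg_of_add_eq_zero_left (wedge_swap F _ _)

/-- For `i ≠ j` the composite is the projection onto the line of `e_i ∧ e_j`, so an operator
commuting with all derivations preserves that line. -/
theorem wedgeDeriv_single_mul_single {i j : Fin n} (hij : i ≠ j) (s : ⋀[F]^2 (Fin n → F)) :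
    wedgeDeriv F n (Matrix.single i i 1) (wedgeDeriv F n (Matrix.single j j 1) s) =
      pluecker F i j s • wedgeBasis F i j := by
  have h : wedgeDeriv F n (Matrix.single i i 1) * wedgeDeriv F n (Matrix.single j j 1) =
      (pluecker F i j).smulRight (wedgeBasis F i j) := by
    have e : ∀ (k : Fin n) (u : Fin n → F), (Matrix.single k k (1 : F)).mulVec u =
        u k • Pi.single k 1 := by
      intro k u
      ext l
      rw [Matrix.single_mulVec]
      simp [Pi.single_apply, Function.update_apply]
    have e0 : (Pi.single j (1 : F) : Fin n → F) i = 0 := Pi.single_eq_of_ne hij 1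
    refine extSquare_hom_ext F fun v w => ?_
    simp only [Module.End.mul_apply, wedgeDeriv_wedge, map_add, e, LinearMap.smulRight_apply,
      pluecker_wedge]
    simp only [← wedgeBilin_apply, map_smul, LinearMap.smul_apply, Pi.smul_apply, e0, smul_zero,
      zero_smul, map_zero, LinearMap.zero_apply, zero_add, add_zero]
    change _ • _ • wedgeBasis F j i + _ • _ • wedgeBasis F i j = _
    rw [wedgeBasis_swap j i]
    module
  exact LinearMap.congr_fun h s

/-- The operator acts by some `t` on one bivector `e_a ∧ e_b`. The derivations of matrix units
replace one index at a time, which spreads the same `t` to all basis bivectors. -/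
theorem exists_eq_smul_one_of_commute_wedgeDeriv (hn : 2 ≤ n)
    {T : Module.End F (⋀[F]^2 (Fin n → F))}
    (hT : ∀ x, T * wedgeDeriv F n x = wedgeDeriv F n x * T) : ∃ t : F, T = t • 1 := by
  have hT' : ∀ x s, T (wedgeDeriv F n x s) = wedgeDeriv F n x (T s) := fun x s =>
    LinearMap.congr_fun (hT x) s
  let a : Fin n := ⟨0, by omega⟩
  let b : Fin n := ⟨1, by omega⟩
  have hab : a ≠ b := by simp [a, b]
  have hpl : pluecker F a b (wedgeBasis F a b) = 1 := by
    rw [wedgeBasis, pluecker_wedge]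
    simp [hab, hab.symm]
  refine ⟨pluecker F a b (T (wedgeBasis F a b)), ?_⟩
  set t := pluecker F a b (T (wedgeBasis F a b)) with ht
  have hbase : T (wedgeBasis F a b) = t • wedgeBasis F a b := by
    rw [ht, ← wedgeDeriv_single_mul_single hab, ← hT', ← hT', wedgeDeriv_single_mul_single hab, hpl,
      one_smul]
  have hleft : ∀ {i j : Fin n} (k : Fin n), i ≠ j → T (wedgeBasis F i j) = t • wedgeBasis F i j →
      T (wedgeBasis F k j) = t • wedgeBasis F k j := by
    intro i j k hij h
    rw [← wedgeDeriv_single_wedgeBasis hij, hT', h, map_smul]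
  have hswap : ∀ {i j : Fin n}, T (wedgeBasis F i j) = t • wedgeBasis F i j →
      T (wedgeBasis F j i) = t • wedgeBasis F j i := by
    intro i j h
    rw [wedgeBasis_swap j i, map_neg, h, smul_neg]
  refine wedgeBasis_hom_ext fun i j => ?_
  change T (wedgeBasis F i j) = t • wedgeBasis F i j
  -- An index may be replaced only when the two indices of the source bivector differ; this dictates
  -- the order of the replacements.
  by_cases hi : i = b
  · subst hi
    exact hswap (hleft j hab hbase)
  · exact hswap (hleft j (Ne.symm hi) (hswap (hleft i hab hbase)))

/-- The matrices `σ (xy)` and `σ x σ y` have the same trace pairing with every `σ z`; since `σ` is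
onto and the trace form is nondegenerate, `σ` is multiplicative. -/
theorem exists_conj_of_trace_eq
    {σ : Matrix (Fin n) (Fin n) F →ₗ[F] Matrix (Fin n) (Fin n) F} (hinj : Function.Injective σ)
    (h1 : σ 1 = 1) (h2 : ∀ x y, (σ x * σ y).trace = (x * y).trace)
    (h3 : ∀ x y z, (σ x * σ y * σ z).trace = (x * y * z).trace) :
    ∃ g : GL (Fin n) F, ∀ x, σ x = g.val * x * g⁻¹.val := by
  have hsurj : Function.Surjective σ := LinearMap.injective_iff_surjective.1 hinj
  have hmul : ∀ x y, σ (x * y) = σ x * σ y := by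
    intro x y
    rw [Matrix.ext_iff_trace_mul_right]
    intro w
    obtain ⟨z, rfl⟩ := hsurj w
    rw [h2, h3]
  exact exists_conj_of_algHom (AlgHom.ofLinearMap σ h1 hmul) hinj

theorem coe_glExtSquare_of_eq_smul {A B : GL (Fin 5) F} {c : F} (h : A.val = c • B.val) :
    ((glExtSquare F A : LinearMap.GeneralLinearGroup F (⋀[F]^2 (Fin 5 → F))) :
      Module.End F (⋀[F]^2 (Fin 5 → F))) = c ^ 2 • (glExtSquare F B).val := by
  refine extSquare_hom_ext F fun v w => ?_
  rw [LinearMap.smul_apply, coe_glExtSquare_wedge, coe_glExtSquare_wedge, h, Matrix.smul_mulVec,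
    Matrix.smul_mulVec, wedge_smul_left, wedge_smul_right, smul_smul, sq]

theorem glExtSquare_eq_scalar_mul {A B : GL (Fin 5) F} {c d : Fˣ} (h : A.val = (c : F) • B.val)
    (hd : d = c ^ 2) : glExtSquare F A = scalarHom F _ d * glExtSquare F B := by
  refine Units.ext ((coe_glExtSquare_of_eq_smul h).trans ?_)
  rw [hd]
  rfl

instance nontrivial_extSquare : Nontrivial (⋀[F]^2 (Fin 5 → F)) := by
  refine ⟨wedgeBasis F 0 1, 0, fun h => ?_⟩
  have := congrArg (pluecker F 0 1) h
  rw [wedgeBasis, pluecker_wedge] at this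
  simp at this

variable [CharZero F]

theorem trace_wedgeDeriv (x : Matrix (Fin n) (Fin n) F) :
    LinearMap.trace F _ (wedgeDeriv F n x) = (n - 1) * x.trace := by
  have h := two_mul_trace_extSquare (wedgeDeriv F n x)
  simp only [wedgeBasis, wedgeDeriv_wedge, map_add, Finset.sum_add_distrib,
    sum_pluecker_wedge_one_right, sum_pluecker_wedge_one_left] at h
  apply mul_left_cancel₀ (two_ne_zero (α := F))
  rw [h]; ring

theorem trace_wedgeDeriv_mul (x y : Matrix (Fin n) (Fin n) F) :
    LinearMap.trace F _ (wedgeDeriv F n x * wedgeDeriv F n y) =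
      (n - 2) * (x * y).trace + x.trace * y.trace := by
  have h := two_mul_trace_extSquare (wedgeDeriv F n x * wedgeDeriv F n y)
  simp only [wedgeBasis, Module.End.mul_apply, wedgeDeriv_wedge, map_add, Finset.sum_add_distrib,
    Matrix.mulVec_mulVec,
    sum_pluecker_wedge_one_right, sum_pluecker_wedge_one_left, sum_pluecker_wedge] at h
  rw [Matrix.trace_mul_comm y x] at h
  apply mul_left_cancel₀ (two_ne_zero (α := F))
  rw [h]; ring

theorem trace_wedgeDeriv_mul_mul (x y z : Matrix (Fin n) (Fin n) F) :
    LinearMap.trace F _ (wedgeDeriv F n x * wedgeDeriv F n y * wedgeDeriv F n z) =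
      (n - 3) * (x * y * z).trace - (y * x * z).trace + x.trace * (y * z).trace +
        y.trace * (x * z).trace + z.trace * (x * y).trace := by
  have h := two_mul_trace_extSquare (wedgeDeriv F n x * wedgeDeriv F n y * wedgeDeriv F n z)
  simp only [wedgeBasis, Module.End.mul_apply, wedgeDeriv_wedge, map_add, Finset.sum_add_distrib,
    Matrix.mulVec_mulVec,
    sum_pluecker_wedge_one_right, sum_pluecker_wedge_one_left, sum_pluecker_wedge] at h
  have e1 : (x * (y * z)).trace = (x * y * z).trace := by rw [mul_assoc]
  have e2 : (y * (x * z)).trace = (y * x * z).trace := by rw [mul_assoc]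
  have e3 : (z * (x * y)).trace = (x * y * z).trace := by rw [Matrix.trace_mul_comm]
  have e4 : (x * z * y).trace = (y * x * z).trace := by rw [Matrix.trace_mul_comm, mul_assoc]
  have e5 : (y * z * x).trace = (x * y * z).trace := by rw [Matrix.trace_mul_comm, mul_assoc]
  apply mul_left_cancel₀ (two_ne_zero (α := F))
  rw [h]
  simp only [← mul_assoc] at *
  simp only [e3, e4, e5]
  ring

/-- An `x` acting by zero has trace zero, and then is orthogonal to everything for the trace form.
For `n = 2` the action is just the trace, whence the bound. -/
theorem wedgeDeriv_injective (hn : 3 ≤ n) : Function.Injective (wedgeDeriv F n) := by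
  rw [injective_iff_map_eq_zero]
  intro x hx
  have h1 : (n : F) - 1 ≠ 0 := by
    rw [sub_ne_zero]; exact_mod_cast (by omega : n ≠ 1)
  have h2 : (n : F) - 2 ≠ 0 := by
    rw [sub_ne_zero]; exact_mod_cast (by omega : n ≠ 2)
  have ht : x.trace = 0 := by
    have := trace_wedgeDeriv x
    rw [hx, map_zero] at this
    exact (mul_eq_zero.1 this.symm).resolve_left h1
  rw [Matrix.ext_iff_trace_mul_right]
  intro y
  have := trace_wedgeDeriv_mul x y
  rw [hx, zero_mul, map_zero, ht, zero_mul, add_zero] at this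
  rw [(mul_eq_zero.1 this.symm).resolve_left h2]
  simp

theorem slExtSquare_injective (p : ZMod 2) : Function.Injective (slExtSquare F p).ρ :=
  (wedgeDeriv_injective (by norm_num)).comp Subtype.val_injective

theorem exists_linearMap_of_normalizes_wedgeDeriv (hn : 3 ≤ n)
    {h : LinearMap.GeneralLinearGroup F (⋀[F]^2 (Fin n → F))}
    (hh : ∀ x, ∃ y, conjEquiv h (wedgeDeriv F n x) = wedgeDeriv F n y) :
    ∃ σ : Matrix (Fin n) (Fin n) F →ₗ[F] Matrix (Fin n) (Fin n) F,
      ∀ x, conjEquiv h (wedgeDeriv F n x) = wedgeDeriv F n (σ x) := by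
  have hD := wedgeDeriv_injective (F := F) hn
  choose f hf using hh
  exact ⟨{ toFun := f
           map_add' := fun x y => hD (by rw [map_add, ← hf, ← hf, ← hf, map_add, map_add])
           map_smul' := fun c x => hD (by
            rw [RingHom.id_apply, map_smul, ← hf, ← hf, map_smul, map_smul]) }, hf⟩

/-- Traces on `Λ²F⁵` of products of one and two derivations recover `tr x` and `tr xy`. For three
factors they give `2 tr(xyz) - tr(yxz)` modulo known terms, which can be solved for `tr(xyz)`. In
dimension `4` the coefficients would be `1` and `-1`, and this would fail. -/
theorem trace_of_conj_wedgeDeriv {h : LinearMap.GeneralLinearGroup F (⋀[F]^2 (Fin 5 → F))}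
    {σ : Matrix (Fin 5) (Fin 5) F →ₗ[F] Matrix (Fin 5) (Fin 5) F}
    (hσ : ∀ x, conjEquiv h (wedgeDeriv F 5 x) = wedgeDeriv F 5 (σ x)) :
    (∀ x y, (σ x * σ y).trace = (x * y).trace) ∧
      ∀ x y z, (σ x * σ y * σ z).trace = (x * y * z).trace := by
  have h1 : ∀ x, (σ x).trace = x.trace := by
    intro x
    have e := trace_conjEquiv h (wedgeDeriv F 5 x)
    rw [hσ, trace_wedgeDeriv, trace_wedgeDeriv] at e
    push_cast at e
    linear_combination (1 / 4 : F) * e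
  have h2 : ∀ x y, (σ x * σ y).trace = (x * y).trace := by
    intro x y
    have e := trace_conjEquiv h (wedgeDeriv F 5 x * wedgeDeriv F 5 y)
    rw [conjEquiv_mul_apply, hσ, hσ, trace_wedgeDeriv_mul, trace_wedgeDeriv_mul, h1, h1] at e
    push_cast at e
    linear_combination (1 / 3 : F) * e
  refine ⟨h2, ?_⟩
  have key : ∀ x y z, 2 * (σ x * σ y * σ z).trace - (σ y * σ x * σ z).trace =
      2 * (x * y * z).trace - (y * x * z).trace := by
    intro x y z
    have e := trace_conjEquiv h (wedgeDeriv F 5 x * wedgeDeriv F 5 y * wedgeDeriv F 5 z)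
    rw [conjEquiv_mul_apply, conjEquiv_mul_apply, hσ, hσ, hσ, trace_wedgeDeriv_mul_mul,
      trace_wedgeDeriv_mul_mul] at e
    simp only [h1, h2] at e
    push_cast at e
    linear_combination e
  intro x y z
  -- Twice the relation plus the one with `x` and `y` exchanged eliminates `tr(yxz)` and leaves `3
  -- tr(xyz)`.
  linear_combination (2 / 3 : F) * key x y z + (1 / 3 : F) * key y x z

theorem exists_conj_of_normalizes_wedgeDeriv
    {h : LinearMap.GeneralLinearGroup F (⋀[F]^2 (Fin 5 → F))}
    (hh : ∀ x, ∃ y, conjEquiv h (wedgeDeriv F 5 x) = wedgeDeriv F 5 y) :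
    ∃ g : GL (Fin 5) F, ∀ x, conjEquiv h (wedgeDeriv F 5 x) =
      wedgeDeriv F 5 (g.val * x * g⁻¹.val) := by
  have hD := wedgeDeriv_injective (F := F) (n := 5) (by norm_num)
  obtain ⟨σ, hσ⟩ := exists_linearMap_of_normalizes_wedgeDeriv (by norm_num) hh
  have hinj : Function.Injective σ := by
    intro x y hxy
    have := congrArg (wedgeDeriv F 5) hxy
    rw [← hσ, ← hσ] at this
    exact hD ((conjEquiv h).injective this)
  have h1 : σ 1 = 1 := hD (by rw [← hσ, wedgeDeriv_one, map_smul, conjEquiv_one_apply])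
  obtain ⟨h2, h3⟩ := trace_of_conj_wedgeDeriv hσ
  obtain ⟨g, hg⟩ := exists_conj_of_trace_eq hinj h1 h2 h3
  exact ⟨g, fun x => by rw [hσ, hg]⟩

theorem eq_smul_one_of_glExtSquare_eq_scalar {A : GL (Fin 5) F} {c : Fˣ}
    (h : glExtSquare F A = scalarHom F _ c) : ∃ t : F, A.val = t • 1 ∧ t ^ 2 = c := by
  have h1 : ∀ x, A.val * x * A⁻¹.val = x := by
    intro x
    apply wedgeDeriv_injective (n := 5) (by norm_num)
    rw [← conj_glExtSquare, h, conjEquiv_mem_iff]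
    exact scalarHom_mul_comm c _
  have h2 : ∀ x, A.val * x = x * A.val := by
    intro x
    conv_rhs => rw [← h1 x]
    rw [mul_assoc, A.inv_mul, mul_one]
  obtain ⟨t, ht⟩ := eq_smul_one_of_commute_single (N := A.val) fun i j _ => (h2 _).symm
  refine ⟨t, ht, ?_⟩
  have h3 := coe_glExtSquare_of_eq_smul (A := A) (B := 1) ht
  rw [h, map_one] at h3
  obtain ⟨s, hs⟩ := exists_ne (0 : ⋀[F]^2 (Fin 5 → F))
  exact (smul_left_injective F hs (LinearMap.congr_fun h3 s)).symm

/-- After division by the action of a suitable `A`, what remains commutes with all derivations and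
is a scalar `t`. -/
theorem normalizer_slExtSquare [IsAlgClosed F] (p : ZMod 2) :
    (slExtSquare F p).normalizer = (glExtSquare F).range := by
  ext h
  rw [slExtSquare, mem_normalizer_ofLie_iff]
  constructor
  · intro H
    obtain ⟨A, hA⟩ := exists_conj_of_normalizes_wedgeDeriv (h := h) fun x => by
      obtain ⟨y, t, rfl⟩ := exists_slVal_add_smul_one (by norm_num) x
      obtain ⟨z, hz⟩ := H y
      refine ⟨slVal F 5 z + t • 1, ?_⟩
      rw [map_add, map_add, map_add, map_smul, map_smul, wedgeDeriv_one, map_smul,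
        conjEquiv_one_apply]
      exact congrArg (· + t • (2 : F) • 1) hz
    obtain ⟨t, ht⟩ := exists_eq_smul_one_of_commute_wedgeDeriv (by norm_num) fun x =>
      commute_inv_mul_of_conj_eq (hA x) (conj_glExtSquare A x)
    have ht0 : t ≠ 0 := by
      rintro rfl
      exact ((glExtSquare F A)⁻¹ * h).ne_zero (by rw [ht, zero_smul])
    -- The scalar matrix `c` acts on `Λ²` by `c²`, so a square root of `t` absorbs the remaining
    -- scalar into `A`.
    obtain ⟨c, hc⟩ := IsAlgClosed.exists_pow_nat_eq t (n := 2) (by norm_num)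
    have hc0 : c ≠ 0 := by
      rintro rfl
      exact ht0 (by rw [← hc]; norm_num)
    refine ⟨Units.mk0 c hc0 • A, ?_⟩
    rw [glExtSquare_eq_scalar_mul (B := A) (c := Units.mk0 c hc0) rfl rfl,
      (scalarHom_commute _ _).eq, ← eq_inv_mul_iff_mul_eq]
    refine Units.ext (Eq.trans ?_ ht.symm)
    rw [← hc]
    rfl
  · rintro ⟨A, rfl⟩ x
    obtain ⟨y, hy⟩ := exists_slVal_eq (x := A.val * slVal F 5 x * A⁻¹.val)
      (by rw [trace_conj, trace_slVal])
    refine ⟨y, (conj_glExtSquare A _).trans ?_⟩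
    rw [← hy]
    rfl

theorem isAlmostDirectProduct_extSquare [IsAlgClosed F] (p : ZMod 2) :
    IsAlmostDirectProduct (slExtSquare F p).normalizer (scalarHom F _) (slGroupExtSquare F) := by
  have hsl : ∀ S, slGroupExtSquare F S = glExtSquare F (Matrix.SpecialLinearGroup.toGL S) :=
    fun _ => rfl
  have hscalar : ∀ {S} {c : Fˣ}, scalarHom F _ c = slGroupExtSquare F S →
      ∃ t : F, S.val = t • 1 ∧ t ^ 2 = c ∧ t ^ 5 = 1 := by
    intro S c h
    obtain ⟨t, ht, htc⟩ := eq_smul_one_of_glExtSquare_eq_scalar ((hsl S).symm.trans h.symm)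
    exact ⟨t, ht, htc, pow_eq_one_of_specialLinear ht⟩
  refine .of_commute scalarHom_injective ?_ (fun c _ => scalarHom_commute c _) (fun h => ?_) ?_
  · rw [injective_iff_map_eq_one]
    intro S h
    obtain ⟨t, hS, ht2, ht5⟩ := hscalar (S := S) (c := 1) (by rw [h, map_one])
    -- A scalar matrix `t` in the kernel satisfies both `t² = 1` and `t⁵ = 1`.
    have ht : t = 1 := by
      rw [Units.val_one] at ht2
      rw [← ht5, show t ^ 5 = t ^ 2 * t ^ 2 * t by ring, ht2, one_mul, one_mul]
    rw [ht, one_smul] at hS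
    exact Subtype.ext hS
  · rw [normalizer_slExtSquare]
    constructor
    · rintro ⟨A, rfl⟩
      obtain ⟨c, S, hS⟩ := exists_specialLinear_smul (by norm_num) A
      exact ⟨c ^ 2, S, (glExtSquare_eq_scalar_mul hS rfl).symm⟩
    · rintro ⟨c, S, rfl⟩
      obtain ⟨d, hd⟩ := IsAlgClosed.exists_pow_nat_eq (c : F) (n := 2) (by norm_num)
      have hd0 : d ≠ 0 := by
        rintro rfl
        exact c.ne_zero (by rw [← hd]; norm_num)
      exact ⟨Units.mk0 d hd0 • Matrix.SpecialLinearGroup.toGL S,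
        glExtSquare_eq_scalar_mul rfl (Units.ext (by simpa using hd.symm))⟩
  · refine (finite_setOf_units_pow_eq_one (n := 5) (by norm_num)).subset ?_
    rintro c ⟨S, h⟩
    obtain ⟨t, -, ht2, ht5⟩ := hscalar h
    change (c : F) ^ 5 = 1
    rw [← ht2, ← pow_mul, mul_comm, pow_mul, ht5, one_pow]

end ExtSquareMax


end

theorem mainTheorem12 {F : Type*} [Field F] [CharZero F] [IsAlgClosed F] :
    -- (a)
    (∀ (n : ℕ) (p : ZMod 2), 0 < n → ∃ G, (slTwoCopies F n p).IsMaximalGroup G ∧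
      IsAlmostDirectProduct G (gl2Mixing F n) (slDiag F n)) ∧
    (∀ p : ZMod 2, ∃ G, (slTwoCopies F 2 p).IsMaximalGroup G ∧
      ∃ B : LinearMap.BilinForm F (Fin 2 → Fin 2 → F), B.IsSymm ∧ B.Nondegenerate ∧
        IsAlmostDirectProduct G (scalarHom F (Fin 2 → Fin 2 → F)) (specialOrthogonal B).subtype) ∧
    (∀ p : ZMod 2, ∃ G, (slTwoCopies F 3 p).IsMaximalGroup G ∧
      IsAlmostDirectProduct G (scalarHom F _) (sl2slMixing F 3)) ∧
    -- (b)
    (∀ p : ZMod 2, ∃ G, (slBox F p).IsMaximalGroup G ∧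
      IsAlmostDirectProduct G (scalarHom F _) (sl2sl3Box F)) ∧
    -- (c)
    (∀ p : ZMod 2, ∃ G, (slExtSquare F p).IsMaximalGroup G ∧
      G = (glExtSquare F).range ∧
      IsAlmostDirectProduct G (scalarHom F _) (slGroupExtSquare F)) ∧
    -- (d)
    (∀ m n : ℕ, ∃ G, (slSuper F m n).IsMaximalGroup G ∧
      G = (glBlock F (Fin m) (Fin n)).range ∧ Function.Injective (glBlock F (Fin m) (Fin n))) ∧
    -- (e)
    (∀ k n : ℕ, 0 < 2 * k + n → ∃ G, (spo F k n).IsMaximalGroup G ∧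
      IsAlmostDirectProduct G (scalarHom F _) (spoGroup F k n)) ∧
    -- (f)
    (∀ (n : ℕ) (p : ZMod 2), 0 < n → ∃ G, (periplectic F n p).IsMaximalGroup G ∧
      IsAlmostDirectProduct G (scalarHom F _) (glDual F n)) ∧
    -- (g)
    (∀ p : ZMod 2, ∃ G, (periplecticHat F p).IsMaximalGroup G ∧
      IsAlmostDirectProduct G (scalarHom F _) (slDual F 4) ∧
      ∀ h : LinearMap.GeneralLinearGroup F (Fin 4 ⊕ Fin 4 → F), h ∈ G ↔
        ∃ (A : GL (Fin 4) F) (l : Fˣ), (l : F) ^ 2 = (A : Matrix (Fin 4) (Fin 4) F).det ∧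
          (h : Module.End F (Fin 4 ⊕ Fin 4 → F)) =
            Matrix.toLin' (Matrix.fromBlocks (A : Matrix (Fin 4) (Fin 4) F) 0 0
              ((l : F) • ((A⁻¹ : GL (Fin 4) F) : Matrix (Fin 4) (Fin 4) F).transpose))) := by
  open LieSuperalgebra.Rep in
  exact ⟨fun n p hn => ⟨_, isMaximalGroup_normalizer (slTwoCopies_injective p),
      isAlmostDirectProduct_gl2_sl hn p⟩,
    fun p => ⟨_, isMaximalGroup_normalizer (slTwoCopies_injective p), formFour F,
      formFour_isSymm, formFour_nondegenerate, isAlmostDirectProduct_specialOrthogonal p⟩,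
    fun p => ⟨_, isMaximalGroup_normalizer (slTwoCopies_injective p),
      isAlmostDirectProduct_sl2_sl3 p⟩,
    fun p => ⟨_, isMaximalGroup_normalizer (slBox_injective p), isAlmostDirectProduct_box p⟩,
    fun p => ⟨_, isMaximalGroup_normalizer (slExtSquare_injective p), normalizer_slExtSquare p,
      isAlmostDirectProduct_extSquare p⟩,
    fun m n => ⟨_, isMaximalGroup_normalizer ofBlocks_injective, normalizer_slSuper F m n,
      glBlock_injective⟩,
    fun k n hkn => ⟨_, isMaximalGroup_normalizer ofBlocks_injective, isAlmostDirectProduct_spo hkn⟩,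
    fun n p hn => ⟨_, isMaximalGroup_normalizer ofBlocks_injective, isAlmostDirectProduct_p hn p⟩,
    fun p => ⟨_, isMaximalGroup_normalizer ofBlocks_injective, isAlmostDirectProduct_pHat p,
      fun _ => mem_normalizer_pHat_iff p⟩⟩
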